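/- Let $V$ be a finite-dimensional complex vector space and let $W\subset \mathrm{GL}(V)$ be a complex reflection group, that is, a finite group generated by pseudo-reflections (elements whose fixed points form a hyperplane of $V$). Let $\mathcal A$ be the set of reflecting hyperplanes of $W$, $\mathcal M=V\setminus\bigcup_{H\in\mathcal A}H$, $x\in\mathcal M$, and let $B(W)=\pi_1(\mathcal M/W,\underline x)$ be the braid group of $W$. For $H\in\mathcal A$ let $W_H$ be the pointwise stabiliser of $H$ in $W$, and let $s_H\in W_H$ be the distinguished pseudo-reflection, whose non-trivial eigenvalue is $\exp(2\pi i/|W_H|)$. A braided reflection around $H$ is the class in $B(W)$ of a path in $\mathcal M$ that goes from $x$ along a path $\gamma$ to a point $y=h+v$ (with $h\in H$, $s_H v=\exp(2\pi i/|W_H|)v$, $v\neq 0$, the disc $\{h+zv:|z|\le 1\}$ meeting no reflecting hyperplane other than $H$), then along the arc $t\mapsto h+\exp(2\pi i t/|W_H|)v$, $0\le t\le 1$, to $s_H(y)$, and then back along $s_H(\gamma)$ to $s_H(x)$. For $\mathcal C\in\mathcal A/W$ let $e_{\mathcal C}=|W_H|$ for any $H\in\mathcal C$, and let $R(W)=\mathbb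 Z[\mathbf u,\mathbf u^{-1}]$ be the Laurent polynomial ring in indeterminates $\mathbf u=(u_{\mathcal C,j})_{\mathcal C\in\mathcal A/W,\,1\le j\le e_{\mathcal C}}$. The generic Hecke algebra $\mathcal H(W)$ is the quotient of $R(W)[B(W)]$ by the two-sided ideal generated by the elements $(\sigma-u_{\mathcal C,1})\cdots(\sigma-u_{\mathcal C,e_{\mathcal C}})$, where $\mathcal C\in\mathcal A/W$ and $\sigma$ runs over the braided reflections around the hyperplanes in $\mathcal C$. Let $I$ be an intersection of reflecting hyperplanes of $W$ (possibly $I=V$), let $W_I$ be the pointwise stabiliser of $I$ in $W$, $\mathcal M_I=V\setminus\bigcup_{H\in\mathcal A,\,I\subset H}H$ and $B_I(W)=\pi_1(\mathcal M_I/W_I,\underline x)$. A homomorphism $B_I(W)\to B(W)$, well defined up to conjugation by $\pi_1(\mathcal M,x)$, is obtained by contracting $\mathcal M_I$, $W_I$-equivariantly, towards a point $p\in I$ that lies on no $H\in\mathcal A$ with $I\not\subset H$, by a map $\mathcal M_I\to\mathcal M$, $y\mapsto p+c(y)(y-p)$, where $c>0$ is a continuous $W_I$-invariant function such that $p+tc(y)(y-p)\in\mathcal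 M$ for all $y\in\mathcal M_I$ and $0<t\le1$, and by then changing the base point along a path in $\mathcal M$ from $x$ to the image of $x$. Let $\mathcal H_I(W)\subset\mathcal H(W)$ be the parabolic Hecke subalgebra, that is, the image of $R(W)[B_I(W)]$ in $\mathcal H(W)$ under the induced map. Then, for every such choice and every integer $r\ge 0$, $\mathcal H(W)$ is free of rank $r$ as a left $\mathcal H_I(W)$-module if and only if $\mathcal H(W)$ is free of rank $r$ as a right $\mathcal H_I(W)$-module. Moreover, in that case $r=|W|/|W_I|$. -/

import Mathlib

noncomputable section

namespace ReflHecke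

section Groups

variable {V : Type*} [AddCommGroup V] [Module ℂ V]

/-- A pseudo-reflection: its fixed points form a hyperplane (so it is not the identity). -/
def IsPseudoReflection (s : V ≃ₗ[ℂ] V) : Prop :=
  IsCoatom (LinearMap.fixedSubmodule (s : V →ₗ[ℂ] V))

/-- A complex reflection group: a finite subgroup of `GL(V)` generated by pseudo-reflections. -/
structure IsComplexReflectionGroup (W : Subgroup (V ≃ₗ[ℂ] V)) : Prop where
  finite : Finite W
  closure_eq : Subgroup.closure {s : V ≃ₗ[ℂ] V | s ∈ W ∧ IsPseudoReflection s} = W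

/-- The set `𝒜` of reflecting hyperplanes of `W`. -/
def reflectingHyperplanes (W : Subgroup (V ≃ₗ[ℂ] V)) : Set (Submodule ℂ V) :=
  {H | ∃ s ∈ W, IsPseudoReflection s ∧ LinearMap.fixedSubmodule (s : V →ₗ[ℂ] V) = H}

/-- The pointwise stabiliser `W_X` of a subspace `X`: a parabolic subgroup of `W`. -/
def fixer (W : Subgroup (V ≃ₗ[ℂ] V)) (X : Submodule ℂ V) : Subgroup (V ≃ₗ[ℂ] V) where
  carrier := {w | w ∈ W ∧ ∀ x ∈ X, w x = x}
  mul_mem' {a b} ha hb :=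
    ⟨W.mul_mem ha.1 hb.1, fun x hx => by
      rw [LinearEquiv.mul_apply, hb.2 x hx, ha.2 x hx]⟩
  one_mem' := ⟨W.one_mem, fun _ _ => rfl⟩
  inv_mem' {a} ha :=
    ⟨W.inv_mem ha.1, fun x hx => by
      have h := congrArg a.symm (ha.2 x hx)
      rw [a.symm_apply_apply] at h
      exact h.symm⟩

theorem fixer_le (W : Subgroup (V ≃ₗ[ℂ] V)) (X : Submodule ℂ V) : fixer W X ≤ W :=
  fun _ h => h.1

theorem reflectingHyperplanes_mono {W W' : Subgroup (V ≃ₗ[ℂ] V)} (h : W' ≤ W) :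
    reflectingHyperplanes W' ⊆ reflectingHyperplanes W := by
  rintro H ⟨s, hs, h1, h2⟩
  exact ⟨s, h hs, h1, h2⟩

/-- Two reflecting hyperplanes are equivalent if they lie in the same `W`-orbit. -/
def hyperplaneSetoid (W : Subgroup (V ≃ₗ[ℂ] V)) : Setoid (reflectingHyperplanes W) where
  r H H' := ∃ w ∈ W, (H : Submodule ℂ V).map (w : V →ₗ[ℂ] V) = H'
  iseqv :=
    { refl := fun H => ⟨1, W.one_mem, by ext v; simp⟩
      symm := by
        rintro H H' ⟨w, hw, h⟩
        refine ⟨w⁻¹, W.inv_mem hw, ?_⟩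
        rw [← h, ← Submodule.map_comp]
        have e : ((w⁻¹ : V ≃ₗ[ℂ] V) : V →ₗ[ℂ] V) ∘ₗ (w : V →ₗ[ℂ] V) = LinearMap.id := by
          ext v
          exact w.symm_apply_apply v
        rw [e, Submodule.map_id]
      trans := by
        rintro H H' H'' ⟨w, hw, h⟩ ⟨w', hw', h'⟩
        refine ⟨w' * w, W.mul_mem hw' hw, ?_⟩
        rw [← h', ← h, ← Submodule.map_comp]
        rfl }

/-- The set `𝒜/W` of `W`-orbits of reflecting hyperplanes. -/
def HyperplaneOrbit (W : Subgroup (V ≃ₗ[ℂ] V)) : Type _ := Quotient (hyperplaneSetoid W)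

/-- The orbit of a reflecting hyperplane. -/
def hyperplaneOrbit (W : Subgroup (V ≃ₗ[ℂ] V)) (H : reflectingHyperplanes W) :
    HyperplaneOrbit W :=
  Quotient.mk (hyperplaneSetoid W) H

/-- `e_H = |W_H|`. -/
def hyperplaneOrder (W : Subgroup (V ≃ₗ[ℂ] V)) (H : Submodule ℂ V) : ℕ :=
  Nat.card (fixer W H)

theorem hyperplaneOrder_map (W : Subgroup (V ≃ₗ[ℂ] V)) (H : Submodule ℂ V)
    (w : V ≃ₗ[ℂ] V) (hw : w ∈ W) :
    hyperplaneOrder W H = hyperplaneOrder W (H.map (w : V →ₗ[ℂ] V)) := by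
  have h : fixer W (H.map (w : V →ₗ[ℂ] V)) = (fixer W H).map (MulAut.conj w).toMonoidHom := by
    ext g
    rw [Subgroup.mem_map_equiv]
    simp only [MulAut.conj_symm_apply]
    constructor
    · rintro ⟨hg, hf⟩
      refine ⟨W.mul_mem (W.mul_mem (W.inv_mem hw) hg) hw, fun x hx => ?_⟩
      rw [LinearEquiv.mul_apply, LinearEquiv.mul_apply,
        hf (w x) (Submodule.mem_map_of_mem hx)]
      exact w.symm_apply_apply x
    · rintro ⟨hg, hf⟩
      refine ⟨?_, ?_⟩
      · have := W.mul_mem (W.mul_mem hw hg) (W.inv_mem hw)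
        simpa [mul_assoc] using this
      · rintro _ ⟨x, hx, rfl⟩
        have := congrArg w (hf x hx)
        rw [LinearEquiv.mul_apply, LinearEquiv.mul_apply] at this
        have e : w (w⁻¹ (g (w x))) = g (w x) := w.apply_symm_apply _
        rw [e] at this
        exact this
  unfold hyperplaneOrder
  rw [h]
  exact Nat.card_congr
    ((fixer W H).equivMapOfInjective _ (MulAut.conj w).injective).toEquiv

/-- `e_𝒞`, the common order of the groups `W_H` for `H ∈ 𝒞`. -/
def orbitOrder (W : Subgroup (V ≃ₗ[ℂ] V)) : HyperplaneOrbit W → ℕ :=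
  Quotient.lift (fun H : reflectingHyperplanes W => hyperplaneOrder W (H : Submodule ℂ V))
    (by
      rintro H H' ⟨w, hw, h⟩
      rw [← h]
      exact hyperplaneOrder_map W H w hw)

/-- The Laurent polynomial ring `R(W) = ℤ[u, u⁻¹]` in indeterminates `u_{𝒞,j}`, `𝒞 ∈ 𝒜/W`,
with `e_𝒞` values of `j` for each `𝒞` (here `0 ≤ j < e_𝒞`): the group ring of the free abelian
group on the set of pairs `(𝒞, j)`. -/
abbrev ParamRing (W : Subgroup (V ≃ₗ[ℂ] V)) : Type _ :=
  AddMonoidAlgebra ℤ ((Σ C : HyperplaneOrbit W, Fin (orbitOrder W C)) →₀ ℤ)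

/-- The indeterminate `u_{𝒞,j}`. -/
def param (W : Subgroup (V ≃ₗ[ℂ] V)) (C : HyperplaneOrbit W) (j : Fin (orbitOrder W C)) :
    ParamRing W :=
  AddMonoidAlgebra.single (Finsupp.single ⟨C, j⟩ 1) 1

/-- The complement `ℳ = V ∖ ⋃_{H ∈ 𝒜} H`. -/
def complement (W : Subgroup (V ≃ₗ[ℂ] V)) : Set V :=
  {v | ∀ H ∈ reflectingHyperplanes W, v ∉ H}

theorem complement_anti {W W' : Subgroup (V ≃ₗ[ℂ] V)} (h : W' ≤ W) :
    complement W ⊆ complement W' :=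
  fun _ hv H hH => hv H (reflectingHyperplanes_mono h hH)

theorem map_mem_complement (W : Subgroup (V ≃ₗ[ℂ] V)) {w : V ≃ₗ[ℂ] V} (hw : w ∈ W)
    {v : V} (hv : v ∈ complement W) : w v ∈ complement W := by
  rintro H ⟨s, hs, hr, rfl⟩ hmem
  have hmap : (LinearMap.fixedSubmodule (s : V →ₗ[ℂ] V)).comap (w : V →ₗ[ℂ] V) =
      LinearMap.fixedSubmodule ((w⁻¹ * s * w : V ≃ₗ[ℂ] V) : V →ₗ[ℂ] V) := by
    ext x
    rw [Submodule.mem_comap, LinearMap.mem_fixedSubmodule_iff, LinearMap.mem_fixedSubmodule_iff]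
    change s (w x) = w x ↔ w.symm (s (w x)) = x
    rw [LinearEquiv.symm_apply_eq]
  refine hv _ ⟨w⁻¹ * s * w, W.mul_mem (W.mul_mem (W.inv_mem hw) hs) hw, ?_, rfl⟩ ?_
  · unfold IsPseudoReflection at hr ⊢
    rw [← hmap]
    exact ((Submodule.orderIsoMapComap w).symm.isCoatom_iff _).2 hr
  · rw [← hmap]
    exact hmem

instance complementMulAction (W : Subgroup (V ≃ₗ[ℂ] V)) : MulAction W (complement W) where
  smul w v := ⟨(w : V ≃ₗ[ℂ] V) (v : V), map_mem_complement W w.2 v.2⟩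
  one_smul _ := rfl
  mul_smul _ _ _ := rfl

@[simp] theorem coe_smul_complement (W : Subgroup (V ≃ₗ[ℂ] V)) (w : W) (v : complement W) :
    ((w • v : complement W) : V) = (w : V ≃ₗ[ℂ] V) (v : V) := rfl

end Groups

section Braids

variable {V : Type*} [NormedAddCommGroup V] [NormedSpace ℂ V]

/-- The orbit space `ℳ/W`, with the quotient topology. -/
abbrev OrbitSpace (W : Subgroup (V ≃ₗ[ℂ] V)) : Type _ :=
  MulAction.orbitRel.Quotient W (complement W)

/-- The projection `ℳ → ℳ/W`. -/
def proj (W : Subgroup (V ≃ₗ[ℂ] V)) (x : complement W) : OrbitSpace W :=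
  Quotient.mk (MulAction.orbitRel W (complement W)) x

theorem continuous_proj (W : Subgroup (V ≃ₗ[ℂ] V)) : Continuous (proj W) :=
  continuous_quotient_mk'

theorem proj_smul (W : Subgroup (V ≃ₗ[ℂ] V)) (w : W) (x : complement W) :
    proj W (w • x) = proj W x :=
  Quotient.sound ⟨w, rfl⟩

theorem continuous_smul_complement [FiniteDimensional ℂ V] (W : Subgroup (V ≃ₗ[ℂ] V)) (w : W) :
    Continuous (fun v : complement W => w • v) :=
  Continuous.subtype_mk
    ((LinearMap.continuous_of_finiteDimensional
      (((w : V ≃ₗ[ℂ] V)) : V →ₗ[ℂ] V)).comp continuous_subtype_val) _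

/-- The braid group `B(W) = π₁(ℳ/W, x̲)`. -/
abbrev BraidGroup (W : Subgroup (V ≃ₗ[ℂ] V)) (x : complement W) : Type _ :=
  FundamentalGroup (OrbitSpace W) (proj W x)

/-- The class in `B(W)` of the loop in `ℳ/W` that is the image of a path in `ℳ` from `x` to
`w x`, where `w ∈ W`. -/
def braidOfPath (W : Subgroup (V ≃ₗ[ℂ] V)) {x : complement W} (w : W) (η : Path x (w • x)) :
    BraidGroup W x :=
  FundamentalGroup.fromPath
    (Path.Homotopic.Quotient.mk
      ((η.map (continuous_proj W)).cast rfl (proj_smul W w x).symm))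

/-- `σ ∈ B(W)` is a (distinguished) braided reflection around the reflecting hyperplane `H`.
Here `s` is the distinguished pseudo-reflection of `W` around `H`: it fixes `H` pointwise and
has the eigenvalue `exp(2πi/e_H)`, with eigenvector `v`. The point `y = h + v` is so close to
`H` that the disc `{h + z v : |z| ≤ 1}` meets no reflecting hyperplane but `H`; `γ` is a path
in `ℳ` from `x` to `y`, and `α` is the arc `t ↦ h + exp(2πit/e_H) v` from `y` to `s y`.
Then `σ` is the class of the path `γ`, followed by `α`, followed by the reverse of `s γ`. -/
def IsBraidedReflection [FiniteDimensional ℂ V] (W : Subgroup (V ≃ₗ[ℂ] V)) (x : complement W)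
    (H : reflectingHyperplanes W) (σ : BraidGroup W x) : Prop :=
  ∃ (s : W) (h v : V) (y : complement W) (γ : Path x y) (α : Path y (s • y)),
    (s : V ≃ₗ[ℂ] V) ∈ fixer W (H : Submodule ℂ V) ∧
    v ≠ 0 ∧
    (s : V ≃ₗ[ℂ] V) v =
      Complex.exp (2 * Real.pi * Complex.I / hyperplaneOrder W (H : Submodule ℂ V)) • v ∧
    h ∈ (H : Submodule ℂ V) ∧
    (∀ z : ℂ, ‖z‖ ≤ 1 → ∀ H' ∈ reflectingHyperplanes W, h + z • v ∈ H' →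
      H' = (H : Submodule ℂ V)) ∧
    (y : V) = h + v ∧
    (∀ t : unitInterval, ((α t : complement W) : V) =
      h + Complex.exp (2 * Real.pi * Complex.I * ((t : ℝ) : ℂ) /
        hyperplaneOrder W (H : Submodule ℂ V)) • v) ∧
    σ = braidOfPath W s
      ((γ.trans α).trans (γ.map (continuous_smul_complement W s)).symm)

/-- The Hecke relations `∏_j (σ - u_{𝒞,j}) = 0` in `R(W)[B(W)]`, for every braided reflection `σ`
around a hyperplane of the orbit `𝒞`. -/
inductive HeckeRel [FiniteDimensional ℂ V] (W : Subgroup (V ≃ₗ[ℂ] V)) (x : complement W) :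
    MonoidAlgebra (ParamRing W) (BraidGroup W x) →
    MonoidAlgebra (ParamRing W) (BraidGroup W x) → Prop
  | braided (H : reflectingHyperplanes W) (σ : BraidGroup W x)
      (hσ : IsBraidedReflection W x H σ) :
      HeckeRel W x
        (Polynomial.aeval (MonoidAlgebra.of (ParamRing W) (BraidGroup W x) σ)
          (∏ j : Fin (orbitOrder W (hyperplaneOrbit W H)),
            (Polynomial.X - Polynomial.C (param W (hyperplaneOrbit W H) j))))
        0

/-- The generic Hecke algebra `ℋ(W)`: the quotient of the group algebra `R(W)[B(W)]` by the
two-sided ideal generated by the Hecke relations. -/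
abbrev HeckeAlgebra [FiniteDimensional ℂ V] (W : Subgroup (V ≃ₗ[ℂ] V)) (x : complement W) : Type _ :=
  RingQuot (HeckeRel W x)

/-- The canonical surjection `R(W)[B(W)] → ℋ(W)`. -/
def heckeMk [FiniteDimensional ℂ V] (W : Subgroup (V ≃ₗ[ℂ] V)) (x : complement W) :
    MonoidAlgebra (ParamRing W) (BraidGroup W x) →ₐ[ParamRing W] HeckeAlgebra W x :=
  RingQuot.mkAlgHom (ParamRing W) (HeckeRel W x)

/-- The inclusion `ℳ ⊆ ℳ_I`, where `ℳ_I`, the complement of the reflecting hyperplanes of `W`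
that contain `I`, is the complement attached to the group `W_I`. -/
def toParabolic (W : Subgroup (V ≃ₗ[ℂ] V)) (I : Submodule ℂ V) (x : complement W) :
    complement (fixer W I) :=
  ⟨x, complement_anti (fixer_le W I) x.2⟩

/-- A contraction of `ℳ_I` into the part of `ℳ` near a generic point `p` of `I`: the map
`y ↦ p + c(y) (y - p)`, where the continuous, `W_I`-invariant function `c > 0` is so small that
`ℳ` contains the whole segment from the image of `y` towards `p` (`p` itself excluded).
It is a homotopy inverse of the inclusion into `ℳ_I` of the part of `ℳ` in a small ball
around `p`. -/
structure ParabolicContraction (W : Subgroup (V ≃ₗ[ℂ] V)) (I : Submodule ℂ V) where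
  center : V
  center_mem : center ∈ I
  center_generic : ∀ H ∈ reflectingHyperplanes W, center ∈ H → I ≤ H
  scale : complement (fixer W I) → ℝ
  continuous_scale : Continuous scale
  scale_pos : ∀ y, 0 < scale y
  scale_smul : ∀ (w : fixer W I) (y : complement (fixer W I)), scale (w • y) = scale y
  segment_mem : ∀ (y : complement (fixer W I)) (t : ℝ), 0 < t → t ≤ 1 →
    center + (t * scale y) • ((y : V) - center) ∈ complement W

namespace ParabolicContraction

variable {W : Subgroup (V ≃ₗ[ℂ] V)} {I : Submodule ℂ V}

/-- The contraction `ℳ_I → ℳ`. -/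
def toFun (D : ParabolicContraction W I) (y : complement (fixer W I)) : complement W :=
  ⟨D.center + D.scale y • ((y : V) - D.center), by
    simpa using D.segment_mem y 1 one_pos le_rfl⟩

theorem continuous_toFun (D : ParabolicContraction W I) : Continuous D.toFun :=
  Continuous.subtype_mk
    (continuous_const.add
      (D.continuous_scale.smul (continuous_subtype_val.sub continuous_const))) _

theorem toFun_smul (D : ParabolicContraction W I) (w : fixer W I)
    (y : complement (fixer W I)) :
    D.toFun (w • y) = (⟨w, fixer_le W I w.2⟩ : W) • D.toFun y := by
  apply Subtype.ext
  have hc : (w : V ≃ₗ[ℂ] V) D.center = D.center := w.2.2 _ D.center_mem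
  have hs : (w : V ≃ₗ[ℂ] V) (D.scale y • ((y : V) - D.center)) =
      D.scale y • ((w : V ≃ₗ[ℂ] V) ((y : V) - D.center)) :=
    LinearMap.map_smul_of_tower ((w : V ≃ₗ[ℂ] V) : V →ₗ[ℂ] V) (D.scale y) _
  change D.center + D.scale (w • y) • ((w : V ≃ₗ[ℂ] V) (y : V) - D.center) =
    (w : V ≃ₗ[ℂ] V) (D.center + D.scale y • ((y : V) - D.center))
  rw [D.scale_smul, map_add, hs, map_sub, hc]

/-- The induced map `ℳ_I/W_I → ℳ/W`. -/
def orbitMap (D : ParabolicContraction W I) : C(OrbitSpace (fixer W I), OrbitSpace W) where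
  toFun := Quotient.lift (fun y => proj W (D.toFun y)) (by
    rintro _ y ⟨w, rfl⟩
    change proj W (D.toFun (w • y)) = proj W (D.toFun y)
    rw [D.toFun_smul, proj_smul])
  continuous_toFun := ((continuous_proj W).comp D.continuous_toFun).quotient_lift _

/-- The embedding `B_I(W) = π₁(ℳ_I/W_I, x̲) ↪ B(W) = π₁(ℳ/W, x̲)` given by the contraction,
followed by the change of base point along a path `γ` in `ℳ` from `x` to its image. Another
choice of contraction or path changes the embedding by a conjugation in `P(W)`. -/
def braidHom (D : ParabolicContraction W I) (x : complement W)
    (γ : Path x (D.toFun (toParabolic W I x))) :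
    BraidGroup (fixer W I) (toParabolic W I x) →* BraidGroup W x :=
  (FundamentalGroup.fundamentalGroupMulEquivOfPath
      (γ.map (continuous_proj W)).symm).toMonoidHom.comp
    (FundamentalGroup.map D.orbitMap (proj (fixer W I) (toParabolic W I x)))

end ParabolicContraction

/-- The parabolic Hecke subalgebra `ℋ_I(W)`: the image in `ℋ(W)` of the Hecke algebra of `W_I`
over `R(W)`, that is, of its preimage `R(W)[B_I(W)]`, under the map induced by the embedding
`B_I(W) ↪ B(W)`. -/
def parabolicHecke [FiniteDimensional ℂ V] (W : Subgroup (V ≃ₗ[ℂ] V)) (I : Submodule ℂ V) (x : complement W)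
    (D : ParabolicContraction W I) (γ : Path x (D.toFun (toParabolic W I x))) :
    Subalgebra (ParamRing W) (HeckeAlgebra W x) :=
  ((heckeMk W x).comp
    (MonoidAlgebra.mapDomainAlgHom (ParamRing W) (ParamRing W) (D.braidHom x γ))).range

end Braids

section Freeness

variable {R A : Type*} [CommSemiring R] [Semiring A] [Algebra R A]

/-- `A` is free of rank `r` as a left module over the subalgebra `S`. -/
def IsLeftFreeOfRank (S : Subalgebra R A) (r : ℕ) : Prop :=
  Nonempty (Module.Basis (Fin r) S A)

/-- `A` is free of rank `r` as a right module over the subalgebra `S`, that is, as a module over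
the opposite algebra of `S`, which acts by right multiplication. -/
def IsRightFreeOfRank (S : Subalgebra R A) (r : ℕ) : Prop :=
  Nonempty (Module.Basis (Fin r) S.op A)

end Freeness

end ReflHecke

end

/-! The equivalence of left and right freeness comes from an anti-involution of the Hecke algebra
that sends each braid to its inverse and each `u_{𝒞,j}` to its inverse (`exists_antiInvolution`). It
respects the Hecke relations because `∏ (σ - u_j) = 0` with `σ` and the `u_j` invertible forces `∏
(σ⁻¹ - u_j⁻¹) = 0`. It preserves the parabolic subalgebra because that is spanned over the
parameters by the image of a group. So it carries a left basis to a right basis and back; it is only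
semilinear over the parameters, which does no harm.

For the rank, specialize the `u_{𝒞,j}` to the `e_𝒞`-th roots of unity, so that the relations become
`σ ^ e = 1`. Through the trivial character, `ℂ` becomes a module over the parabolic subalgebra `S`,
and freeness of rank `r` gives the space `Hom_S(ℋ, ℂ)` the dimension `r`. A map in this space is
determined by its values on braids. These values depend only on the image of the braid in the
reflection group, and are constant on cosets of `W_I`; conversely every function on these cosets
occurs, since the specialized algebra maps to the group algebra of the reflection group. Hence `r =
|W|/|W_I|`. No freeness of the Hecke algebra over its parameters is needed.

Two facts about the braid group support this. By Steinberg's theorem, a point on no reflecting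
hyperplane has trivial stabiliser (`eq_one_of_apply_eq`), so `ℳ → ℳ/W` is a covering and braids have
images in the opposite of `W`. Its proof studies the determinant of the translates of generators of
the polynomial ring over the invariants near the origin: a fixed point makes two rows equal, whereas
outside the reflecting hyperplanes all inertia is trivial and the determinant cannot vanish.

Moreover, a homomorphism on the braid group that kills the `e_H`-th powers of the braided
reflections kills all pure braids (`eq_one_of_pure`). It is extended to a `W`-invariant function on
the paths in `ℳ`, trivial on small circles around the hyperplanes. Triviality on all loops is then
proved in a plane with finitely many punctures, next in the complex lines through one point, and
finally in `ℳ`, by gluing local primitives (`PathHom.Flat`). -/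

noncomputable section

namespace ReflHecke

/-! ### Finite groups acting on rings: independence over the invariants -/

section Invariants

variable {G S : Type*} [Group G] [Fintype G] [CommRing S] [MulSemiringAction G S]

/-- If finitely many elements, as many as the group has, generate `S` over its invariants outside a
prime `P` at which the group has trivial inertia, then the matrix of their translates is invertible
modulo `P`. -/
theorem det_smul_notMem [DecidableEq G] (P : Ideal S) [P.IsPrime] (h : G → S) (g : S) (hg : g ∉ P)
    (hgen : ∀ f : S, ∃ a : G → S, (∀ j (w : G), w • a j = a j) ∧ g * f = ∑ j, a j * h j)
    (hgG : ∀ w : G, w • g = g)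
    (hdist : ∀ w : G, (∀ f : S, w • f - f ∈ P) → w = 1) :
    (Matrix.of fun w j : G => w • h j).det ∉ P := by
  intro hdet
  let φ : S →+* S ⧸ P := Ideal.Quotient.mk P
  have hdet0 : ((Matrix.of fun w j : G => w • h j).map φ).det = 0 := by
    have := (RingHom.map_det φ (Matrix.of fun w j : G => w • h j)).symm
    rw [RingHom.mapMatrix_apply] at this
    rw [this]
    exact Ideal.Quotient.eq_zero_iff_mem.2 hdet
  -- A left kernel vector is a linear relation between the maps `f ↦ φ (w • f)`, valid at the
  -- generators. Being invariant, the coefficients `a j` pull out of it, so it holds at every `f`,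
  -- against Dedekind's independence of characters.
  obtain ⟨c, hc0, hc⟩ := Matrix.exists_vecMul_eq_zero_iff.2 hdet0
  have hc' : ∀ j, ∑ w, c w * φ (w • h j) = 0 := fun j => by
    have := congrFun hc j
    simpa [Matrix.vecMul, dotProduct] using this
  have hall : ∀ f, ∑ w, c w * φ (w • f) = 0 := by
    intro f
    obtain ⟨a, ha, hf⟩ := hgen f
    have hg0 : φ g ≠ 0 := fun h0 => hg (Ideal.Quotient.eq_zero_iff_mem.1 h0)
    refine (mul_eq_zero.1 (?_ : φ g * _ = 0)).resolve_left hg0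
    calc φ g * ∑ w, c w * φ (w • f) = ∑ w, c w * φ (w • (g * f)) := by
          rw [Finset.mul_sum]
          refine Finset.sum_congr rfl fun w _ => ?_
          rw [smul_mul', hgG, map_mul]; ring
      _ = ∑ w, ∑ j, φ (a j) * (c w * φ (w • h j)) := by
          refine Finset.sum_congr rfl fun w _ => ?_
          rw [hf, Finset.smul_sum, map_sum, Finset.mul_sum]
          refine Finset.sum_congr rfl fun j _ => ?_
          rw [smul_mul', ha, map_mul]; ring
      _ = 0 := by
          rw [Finset.sum_comm]
          refine Finset.sum_eq_zero fun j _ => ?_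
          rw [← Finset.mul_sum, hc', mul_zero]
  let ψ : G → (S →* S ⧸ P) := fun w =>
    -- Trivial inertia at `P` is what makes these multiplicative maps distinct.
    (φ : S →* S ⧸ P).comp ((MulSemiringAction.toRingHom G S w : S →+* S) : S →* S)
  have hψ : Function.Injective ψ := by
    intro w w' hww
    rw [← mul_inv_eq_one]
    refine hdist _ fun f => ?_
    have h1 : φ (w • w'⁻¹ • f) = φ (w' • w'⁻¹ • f) := DFunLike.congr_fun hww (w'⁻¹ • f)
    rw [smul_inv_smul, smul_smul] at h1
    exact Ideal.Quotient.eq.1 h1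
  have hli := (linearIndependent_monoidHom S (S ⧸ P)).comp ψ hψ
  rw [Fintype.linearIndependent_iff] at hli
  refine hc0 (funext fun w => hli c ?_ w)
  funext f
  simpa [ψ] using hall f

/-- Elements that are linearly independent over the invariants of a faithful action are at most as
many as the elements of the group. -/
theorem card_le_of_linearIndependent_invariants [IsDomain S] [FaithfulSMul G S]
    {m : ℕ} (h : Fin m → S)
    (hli : ∀ a : Fin m → S, (∀ j (w : G), w • a j = a j) → ∑ j, a j * h j = 0 → a = 0) :
    m ≤ Fintype.card G := by
  let ℓ : (Fin m → S) →ₗ[S] (G → S) :=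
    { toFun := fun c w => ∑ j, c j * (w • h j)
      map_add' := fun c d => by funext w; simp [add_mul, Finset.sum_add_distrib]
      map_smul' := fun c d => by funext w; simp [Finset.mul_sum, mul_assoc] }
  have hinj : Function.Injective ℓ := by
    rw [← LinearMap.ker_eq_bot, LinearMap.ker_eq_bot']
    intro c hc
    by_contra hne
    obtain ⟨j, hj⟩ := Function.ne_iff.1 hne
    let ψ : G → (S →* S) := fun w => ((MulSemiringAction.toRingHom G S w : S →+* S) : S →* S)
    have hψ : Function.Injective ψ := by
      intro w w' hww
      refine eq_of_smul_eq_smul (α := S) fun f => ?_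
      exact DFunLike.congr_fun hww f
    have hli' := (linearIndependent_monoidHom S S).comp ψ hψ
    rw [Fintype.linearIndependent_iff] at hli'
    -- By Dedekind's theorem some multiple of `c j` has nonzero trace. The traces of the `b * c i`
    -- are then invariant coefficients of a nontrivial relation between the `h i`.
    obtain ⟨b, hb⟩ : ∃ b : S, ∑ w : G, w • (b * c j) ≠ 0 := by
      by_contra! hb
      have := hli' (fun w => w • c j) (by
        funext f
        simpa [ψ, smul_mul', mul_comm] using hb f) 1
      exact hj (by simpa using this)
    refine hb ?_
    have := hli (fun i => ∑ w : G, w • (b * c i)) (fun i w => ?_) ?_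
    · exact congrFun this j
    · rw [Finset.smul_sum]
      simp only [smul_smul]
      exact Fintype.sum_bijective _ (Group.mulLeft_bijective w) _ _ fun _ => rfl
    · simp only [Finset.sum_mul]
      rw [Finset.sum_comm]
      refine Finset.sum_eq_zero fun w _ => ?_
      have h1 : ∑ i, c i * (w⁻¹ • h i) = 0 := congrFun hc w⁻¹
      have h2 := congrArg (fun z => w • (b * z)) h1
      simpa [Finset.mul_sum, Finset.smul_sum, smul_mul', smul_smul, mul_assoc] using h2
  simpa using card_le_of_injective S ℓ hinj

end Invariants

/-! ### Divided differences and generators over the invariants -/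

section DividedDifferences

variable {k G S : Type*} [Field k] [Group G] [CommRing S] [Algebra k S] [MulSemiringAction G S]

/-- Divided difference operators `T s`, `p - s • p = α s * T s p`, for the elements `s` of a
generating set of a group that acts on an algebra with an invariant augmentation `ε`. -/
structure DividedDifferences (k G S : Type*) [Field k] [Group G] [CommRing S] [Algebra k S]
    [MulSemiringAction G S] where
  ε : S →ₐ[k] k
  ε_smul : ∀ (w : G) (p : S), ε (w • p) = ε p
  R : Set G
  closure_R : Subgroup.closure R = ⊤
  α : G → S
  α_ne_zero : ∀ s ∈ R, α s ≠ 0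
  T : G → S → S
  α_mul_T : ∀ s ∈ R, ∀ p, p - s • p = α s * T s p
  deg : S → ℕ
  deg_T : ∀ s ∈ R, ∀ p, T s p ≠ 0 → deg (T s p) < deg p

namespace DividedDifferences

variable (D : DividedDifferences k G S)

/-- The invariants with augmentation zero. -/
def augInvariants : Set S := {f | (∀ w : G, w • f = f) ∧ D.ε f = 0}

/-- The ideal generated by the invariants with augmentation zero. -/
def augIdeal : Ideal S := Ideal.span D.augInvariants

theorem smul_mem_augIdeal (w : G) {p : S} (hp : p ∈ D.augIdeal) : w • p ∈ D.augIdeal := by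
  refine Submodule.span_induction (p := fun p _ => w • p ∈ D.augIdeal) ?_ ?_ ?_ ?_ hp
  · intro f hf
    rw [hf.1 w]
    exact Ideal.subset_span hf
  · simp
  · intro p q _ _ hp hq
    rw [smul_add]
    exact add_mem hp hq
  · intro a p _ hp
    rw [smul_eq_mul, smul_mul']
    exact Ideal.mul_mem_left _ _ hp

variable [IsDomain S]

theorem T_add {s : G} (hs : s ∈ D.R) (p q : S) : D.T s (p + q) = D.T s p + D.T s q := by
  refine mul_left_cancel₀ (D.α_ne_zero s hs) ?_
  rw [mul_add, ← D.α_mul_T s hs, ← D.α_mul_T s hs, ← D.α_mul_T s hs, smul_add]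
  ring

theorem T_mul {s : G} (hs : s ∈ D.R) {f : S} (hf : ∀ w : G, w • f = f) (p : S) :
    D.T s (f * p) = f * D.T s p := by
  refine mul_left_cancel₀ (D.α_ne_zero s hs) ?_
  rw [mul_left_comm, ← D.α_mul_T s hs, ← D.α_mul_T s hs, smul_mul', hf]
  ring

/-- The iterated operators `T s₁ ∘ ⋯ ∘ T sₙ`, as additive maps. -/
def iter (l : List D.R) : S →+ S :=
  l.foldr (fun (s : D.R) (g : S →+ S) => (AddMonoidHom.mk' (D.T (s : G)) (D.T_add s.2)).comp g) (AddMonoidHom.id S)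

theorem iter_mul (l : List D.R) {f : S} (hf : ∀ w : G, w • f = f) (p : S) :
    D.iter l (f * p) = f * D.iter l p := by
  induction l with
  | nil => rfl
  | cons s l ih =>
    change D.T s (D.iter l (f * p)) = f * D.T s (D.iter l p)
    rw [ih, D.T_mul s.2 hf]

theorem iter_append_singleton (l : List D.R) (s : D.R) (p : S) :
    D.iter (l ++ [s]) p = D.iter l (D.T s p) := by
  induction l with
  | nil => rfl
  | cons t l ih =>
    change D.T t (D.iter (l ++ [s]) p) = D.T t (D.iter l (D.T s p))
    rw [ih]

variable [CharZero k] [Fintype G]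

/-- By induction on the degree each `T s p` lies in the ideal, hence so does `p - s • p`, and then
`p - w • p` for every `w`. Summing over `w` writes `|G| * p` as an element of the ideal plus the
trace of `p`, which is an invariant with augmentation zero. This is where characteristic zero
enters. -/
theorem mem_augIdeal_of_iter (p : S) (hp : ∀ l, D.ε (D.iter l p) = 0) : p ∈ D.augIdeal := by
  induction hn : D.deg p using Nat.strong_induction_on generalizing p with
  | _ n ih =>
  have hs : ∀ s ∈ D.R, p - s • p ∈ D.augIdeal := by
    intro s hs
    rw [D.α_mul_T s hs]
    refine Ideal.mul_mem_left _ _ ?_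
    by_cases h0 : D.T s p = 0
    · rw [h0]; exact zero_mem _
    · refine ih _ (hn ▸ D.deg_T s hs p h0) _ (fun l => ?_) rfl
      rw [← D.iter_append_singleton l ⟨s, hs⟩]
      exact hp _
  have hw : ∀ w : G, p - w • p ∈ D.augIdeal := by
    intro w
    have hmem : w ∈ Subgroup.closure D.R := by rw [D.closure_R]; trivial
    induction hmem using Subgroup.closure_induction with
    | mem s h => exact hs s h
    | one => simp
    | mul a b _ _ ha hb =>
      have := add_mem ha (D.smul_mem_augIdeal a hb)
      rw [smul_sub, smul_smul] at this
      simpa using this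
    | inv a _ ha =>
      have := neg_mem (D.smul_mem_augIdeal a⁻¹ ha)
      rw [smul_sub, inv_smul_smul] at this
      simpa using this
  have hsum : ∑ w : G, (p - w • p) ∈ D.augIdeal := sum_mem fun w _ => hw w
  have havg : ∑ w : G, w • p ∈ D.augIdeal := by
    refine Ideal.subset_span ⟨fun w => ?_, ?_⟩
    · rw [Finset.smul_sum]
      simp only [smul_smul]
      exact Fintype.sum_bijective _ (Group.mulLeft_bijective w) _ _ fun _ => rfl
    · rw [map_sum]
      refine Finset.sum_eq_zero fun w _ => ?_
      rw [D.ε_smul]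
      exact hp []
  have hcard : (Fintype.card G : k) ≠ 0 := by simp
  have hm : (Fintype.card G : S) * p ∈ D.augIdeal := by
    have := add_mem hsum havg
    simpa using this
  have : p = algebraMap k S (Fintype.card G : k)⁻¹ * ((Fintype.card G : S) * p) := by
    rw [← mul_assoc, ← map_natCast (algebraMap k S), ← map_mul, inv_mul_cancel₀ hcard, map_one,
      one_mul]
  rw [this]
  exact Ideal.mul_mem_left _ _ hm

variable [SMulCommClass G k S]

/-- Elements that are independent modulo the augmentation ideal are independent over the
invariants. -/
theorem eq_zero_of_sum_eq_zero {m : ℕ} (h : Fin m → S)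
    (hh : ∀ c : Fin m → k, ∑ j, algebraMap k S (c j) * h j ∈ D.augIdeal → c = 0)
    (a : Fin m → S) (ha : ∀ j (w : G), w • a j = a j) (hsum : ∑ j, a j * h j = 0) : a = 0 := by
  let v : List D.R → Fin m → k := fun l j => D.ε (D.iter l (h j))
  -- A functional that kills all the vectors `v l` gives a combination of the `h j` all of whose
  -- iterated divided differences have augmentation zero; this combination lies in the ideal, so its
  -- coefficients vanish.
  have hspan : Submodule.span k (Set.range v) = ⊤ := by
    by_contra hne
    obtain ⟨φ, hφ0, hφ⟩ := Submodule.exists_le_ker_of_lt_top _ (lt_top_iff_ne_top.2 hne)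
    let c : Fin m → k := fun j => φ (Pi.single j 1)
    have hφc : ∀ x, φ x = ∑ j, c j * x j := by
      intro x
      conv_lhs => rw [← Finset.univ_sum_single x]
      rw [map_sum]
      refine Finset.sum_congr rfl fun j _ => ?_
      have : (Pi.single j (x j) : Fin m → k) = x j • Pi.single j 1 := by
        rw [← Pi.single_smul, smul_eq_mul, mul_one]
      rw [this, map_smul, smul_eq_mul, mul_comm]
    have hc : c = 0 := by
      refine hh c (D.mem_augIdeal_of_iter _ fun l => ?_)
      have h1 : φ (v l) = 0 := hφ (Submodule.subset_span ⟨l, rfl⟩)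
      rw [hφc] at h1
      rw [map_sum, map_sum]
      rw [← h1]
      refine Finset.sum_congr rfl fun j _ => ?_
      rw [D.iter_mul l (fun w => by rw [Algebra.algebraMap_eq_smul_one, smul_comm, smul_one]),
        map_mul, AlgHom.commutes]
      rfl
    refine hφ0 (LinearMap.ext fun x => ?_)
    rw [hφc, hc]
    simp
  obtain ⟨b, hb, hspan', hli⟩ := exists_linearIndependent k (Set.range v)
  rw [hspan] at hspan'
  let B := Module.Basis.mk hli (by rw [Subtype.range_coe, hspan'])
  let _ : Fintype b := FiniteDimensional.fintypeBasisIndex B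
  have hcard : Fintype.card b = m := by
    rw [← Module.finrank_eq_card_basis B, Module.finrank_fin_fun]
  let e : Fin m ≃ b := Fintype.equivOfCardEq (by simp [hcard])
  have hex : ∀ i : Fin m, ∃ l, v l = (e i : Fin m → k) := fun i => hb (e i).2
  choose l hl using hex
  -- Divided differences are linear over the invariants, so applying them to the given relation
  -- yields `A.mulVec a = 0`. The augmentation of `A` is invertible by the choice of the `l i`,
  -- hence `det A ≠ 0`.
  let A : Matrix (Fin m) (Fin m) S := Matrix.of fun i j => D.iter (l i) (h j)
  have hAε : (A.map D.ε).det ≠ 0 := by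
    have h1 : LinearIndependent k (A.map D.ε).row := by
      have : (A.map D.ε).row = fun i => (e i : Fin m → k) := by
        funext i j
        rw [← hl i]
        rfl
      rw [this]
      exact hli.comp e e.injective
    have := Matrix.linearIndependent_rows_iff_isUnit.1 h1
    exact ((Matrix.isUnit_iff_isUnit_det _).1 this).ne_zero
  have hA : A.det ≠ 0 := by
    intro h0
    refine hAε ?_
    have := AlgHom.map_det D.ε A
    rw [AlgHom.mapMatrix_apply] at this
    rw [← this, h0, map_zero]
  refine Matrix.eq_zero_of_mulVec_eq_zero hA ?_
  funext i
  have h2 := congrArg (D.iter (l i)) hsum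
  rw [map_sum, map_zero] at h2
  rw [Pi.zero_apply, ← h2]
  refine (Finset.sum_congr rfl fun j _ => ?_ : (∑ j, A i j * a j) = _)
  rw [D.iter_mul _ (ha j), mul_comm]
  rfl

/-- Outside the zeros of an invariant with nonzero augmentation, `S` is generated over the
invariants by as many elements as the group has. -/
theorem exists_generators [FaithfulSMul G S] [Algebra.FiniteType k S] :
    ∃ g : S, (∀ w : G, w • g = g) ∧ D.ε g ≠ 0 ∧ ∃ h : G → S, ∀ f : S, ∃ a : G → S,
      (∀ j (w : G), w • a j = a j) ∧ g * f = ∑ j, a j * h j := by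
  classical
  let P : ℕ → Prop := fun m => ∃ h : Fin m → S,
    ∀ c : Fin m → k, ∑ j, algebraMap k S (c j) * h j ∈ D.augIdeal → c = 0
  have hP0 : P 0 := ⟨Fin.elim0, fun c _ => Subsingleton.elim _ _⟩
  have hPle : ∀ m, P m → m ≤ Fintype.card G := by
    rintro m ⟨h, hh⟩
    exact card_le_of_linearIndependent_invariants h (D.eq_zero_of_sum_eq_zero h hh)
  let m := Nat.findGreatest P (Fintype.card G)
  obtain ⟨h, hh⟩ : P m := Nat.findGreatest_spec (Nat.zero_le _) hP0
  have hmax : ¬ P (m + 1) := fun hP => by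
    have := Nat.le_findGreatest (hPle _ hP) hP
    exact Nat.not_succ_le_self m this
  -- A family of maximal size that is independent modulo the ideal also spans modulo it; the bound
  -- by `|G|` guarantees that a maximal size exists.
  have hspan : ∀ p : S, ∃ c : Fin m → k, p - ∑ j, algebraMap k S (c j) * h j ∈ D.augIdeal := by
    intro p
    by_contra! hcon
    refine hmax ⟨Fin.cons p h, fun c hc => ?_⟩
    rw [Fin.sum_univ_succ] at hc
    simp only [Fin.cons_zero, Fin.cons_succ] at hc
    have hc0 : c 0 = 0 := by
      by_contra h0
      refine hcon (fun j => -(c 0)⁻¹ * c j.succ) ?_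
      have := Ideal.mul_mem_left _ (algebraMap k S (c 0)⁻¹) hc
      convert this using 1
      rw [mul_add, ← mul_assoc, ← map_mul, inv_mul_cancel₀ h0, map_one, one_mul, Finset.mul_sum,
        sub_eq_add_neg, ← Finset.sum_neg_distrib]
      congr 1
      refine Finset.sum_congr rfl fun j _ => ?_
      rw [map_mul, map_neg]; ring
    rw [hc0, map_zero, zero_mul, zero_add] at hc
    have := hh _ hc
    funext j
    refine Fin.cases hc0 (fun i => congrFun this i) j
  let A := FixedPoints.subalgebra k S G
  have : Algebra.IsInvariant A S G := ⟨fun b hb => ⟨⟨b, hb⟩, rfl⟩⟩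
  have : Algebra.IsIntegral A S := Algebra.IsInvariant.isIntegral A S G
  have : Algebra.FiniteType A S := Algebra.FiniteType.of_restrictScalars_finiteType k A S
  have : Module.Finite A S := Algebra.IsIntegral.finite
  let J : Ideal A := RingHom.ker ((D.ε : S →+* k).comp (algebraMap A S))
  let N : Submodule A S := Submodule.span A (Set.range h)
  have hle : (⊤ : Submodule A S) ≤ N ⊔ J • (⊤ : Submodule A S) := by
    intro p _
    obtain ⟨c, hc⟩ := hspan p
    rw [← sub_add_cancel p (∑ j, algebraMap k S (c j) * h j), add_comm]
    refine Submodule.add_mem_sup ?_ ?_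
    · refine sum_mem fun j _ => ?_
      have : algebraMap k S (c j) * h j = (algebraMap k A (c j)) • h j := by
        rw [Algebra.smul_def]; rfl
      rw [this]
      exact Submodule.smul_mem _ _ (Submodule.subset_span ⟨j, rfl⟩)
    · refine Submodule.span_induction (p := fun p _ => p ∈ J • (⊤ : Submodule A S)) ?_ ?_ ?_ ?_ hc
      · intro f hf
        have : f = (⟨f, hf.1⟩ : A) • (1 : S) := by rw [Algebra.smul_def, mul_one]; rfl
        rw [this]
        exact Submodule.smul_mem_smul hf.2 trivial
      · exact zero_mem _
      · intro p q _ _ hp hq; exact add_mem hp hq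
      · intro a p _ hp
        refine Submodule.smul_induction_on hp ?_ ?_
        · intro r hr n _
          rw [smul_comm]
          exact Submodule.smul_mem_smul hr trivial
        · intro x y hx hy
          rw [smul_add]; exact add_mem hx hy
  -- Nakayama's lemma over the invariants, over which `S` is finite: `r` has augmentation one and
  -- multiplies all of `S` into the span of the `h j`.
  obtain ⟨r, hr1, hr⟩ := Submodule.exists_sub_one_mem_and_smul_le_of_fg_of_le_sup
    (N' := ⊤) (Module.Finite.fg_top (R := A) (M := S)) le_rfl hle
  have hmG : m ≤ Fintype.card G := hPle m ⟨h, hh⟩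
  obtain ⟨i⟩ : Nonempty (Fin m ↪ G) := Function.Embedding.nonempty_of_card_le (by simpa using hmG)
  -- The `m ≤ |G|` generators are padded with zeros, so that the matrix of translates becomes
  -- square.
  refine ⟨r, r.2, ?_, fun x => if hx : ∃ j, i j = x then h hx.choose else 0, fun f => ?_⟩
  · have : D.ε ((r : S) - 1) = 0 := hr1
    rw [map_sub, map_one, sub_eq_zero] at this
    rw [this]; exact one_ne_zero
  · have hmem : (r : S) * f ∈ N := by
      exact hr (Submodule.smul_mem_pointwise_smul f r ⊤ trivial)
    obtain ⟨a, ha⟩ := (Submodule.mem_span_range_iff_exists_fun A).1 hmem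
    refine ⟨fun x => if hx : ∃ j, i j = x then (a hx.choose : S) else 0, fun x w => ?_, ?_⟩
    · dsimp only
      split_ifs with hx
      · exact (a hx.choose).2 w
      · simp
    · rw [← ha, ← Finset.sum_subset (Finset.subset_univ (Finset.univ.map i))]
      · rw [Finset.sum_map]
        refine Finset.sum_congr rfl fun j _ => ?_
        have hj : ∃ j', i j' = i j := ⟨j, rfl⟩
        have hj' : hj.choose = j := i.injective hj.choose_spec
        dsimp only
        rw [dif_pos hj, dif_pos hj, hj', Algebra.smul_def]
        rfl
      · intro x _ hx
        have : ¬ ∃ j, i j = x := by simpa using hx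
        dsimp only
        rw [dif_neg this, zero_mul]

end DividedDifferences
end DividedDifferences

/-! ### Polynomial functions and Steinberg's fixed point theorem -/

section Steinberg

variable {V : Type*} [AddCommGroup V] [Module ℂ V] {W : Subgroup (V ≃ₗ[ℂ] V)}

theorem exists_eq_smul_of_ker_le {φ ψ : V →ₗ[ℂ] ℂ} (h : LinearMap.ker φ ≤ LinearMap.ker ψ) :
    ∃ c : ℂ, ψ = c • φ := by
  by_cases h0 : φ = 0
  · refine ⟨0, ?_⟩
    rw [zero_smul]
    ext v
    exact h (by simp [h0])
  · obtain ⟨v, hv⟩ : ∃ v, φ v ≠ 0 := by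
      by_contra! hv
      exact h0 (LinearMap.ext hv)
    refine ⟨ψ v / φ v, LinearMap.ext fun u => ?_⟩
    have : u - (φ u / φ v) • v ∈ LinearMap.ker ψ := h (by simp [hv])
    rw [LinearMap.mem_ker, map_sub, map_smul, sub_eq_zero] at this
    rw [this, LinearMap.smul_apply, smul_eq_mul, smul_eq_mul]
    ring

theorem exists_linearForm_of_isCoatom {H : Submodule ℂ V} (hH : IsCoatom H) :
    ∃ φ : V →ₗ[ℂ] ℂ, φ ≠ 0 ∧ LinearMap.ker φ = H := by
  obtain ⟨φ, h0, hφ⟩ := Submodule.exists_le_ker_of_lt_top H hH.lt_top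
  refine ⟨φ, h0, ?_⟩
  rcases hH.le_iff.1 hφ with h | h
  · exact absurd (LinearMap.ker_eq_top.1 h) h0
  · exact h

theorem isCoatom_ker {φ : V →ₗ[ℂ] ℂ} (h0 : φ ≠ 0) : IsCoatom (LinearMap.ker φ) :=
  LinearMap.isCoatom_ker_of_surjective (LinearMap.surjective_of_ne_zero h0)

theorem smul_mem_complement {x : V} (hx : x ∈ complement W) {t : ℂ} (ht : t ≠ 0) :
    t • x ∈ complement W := fun H hH hmem =>
  hx H hH (by simpa [ht] using H.smul_mem t⁻¹ hmem)

variable [FiniteDimensional ℂ V]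

/-- The ring of polynomial functions on `V`. -/
abbrev Poly (V : Type*) [AddCommGroup V] [Module ℂ V] : Type :=
  MvPolynomial (Fin (Module.finrank ℂ V)) ℂ

/-- Evaluation of polynomial functions. -/
def polyEval (v : V) : Poly V →ₐ[ℂ] ℂ :=
  MvPolynomial.aeval fun i => (Module.finBasis ℂ V).repr v i

/-- A linear form as a polynomial function. -/
def linForm (φ : V →ₗ[ℂ] ℂ) : Poly V :=
  ∑ i, MvPolynomial.C (φ (Module.finBasis ℂ V i)) * MvPolynomial.X i

@[simp] theorem polyEval_linForm (v : V) (φ : V →ₗ[ℂ] ℂ) : polyEval v (linForm φ) = φ v := by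
  conv_rhs => rw [← (Module.finBasis ℂ V).sum_repr v]
  simp only [polyEval, linForm, map_sum, map_mul, map_smul, MvPolynomial.aeval_X, smul_eq_mul,
    MvPolynomial.algHom_C, Algebra.algebraMap_self, RingHom.id_apply]
  exact Finset.sum_congr rfl fun i _ => mul_comm _ _

theorem poly_ext {p q : Poly V} (h : ∀ v : V, polyEval v p = polyEval v q) : p = q := by
  refine MvPolynomial.funext fun c => ?_
  have := h ((Module.finBasis ℂ V).equivFun.symm c)
  have hc : (fun i => (Module.finBasis ℂ V).repr ((Module.finBasis ℂ V).equivFun.symm c) i) = c := by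
    funext i
    exact congrFun ((Module.finBasis ℂ V).equivFun.apply_symm_apply c) i
  rw [polyEval, hc] at this
  simpa [MvPolynomial.aeval_eq_eval] using this

theorem isHomogeneous_linForm (φ : V →ₗ[ℂ] ℂ) : (linForm φ).IsHomogeneous 1 := by
  refine MvPolynomial.IsHomogeneous.sum _ _ _ fun i _ => ?_
  simpa using (MvPolynomial.isHomogeneous_C _ _).mul (MvPolynomial.isHomogeneous_X ℂ i)

theorem X_eq_linForm (i : Fin (Module.finrank ℂ V)) :
    (MvPolynomial.X i : Poly V) = linForm ((Module.finBasis ℂ V).coord i) :=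
  poly_ext fun v => by
    rw [polyEval_linForm, polyEval, MvPolynomial.aeval_X]
    rfl

/-- The substitution `p ↦ p ∘ g`. -/
def polyComp (g : V →ₗ[ℂ] V) : Poly V →ₐ[ℂ] Poly V :=
  MvPolynomial.aeval fun i => linForm ((Module.finBasis ℂ V).coord i ∘ₗ g)

@[simp] theorem polyEval_polyComp (g : V →ₗ[ℂ] V) (v : V) (p : Poly V) :
    polyEval v (polyComp g p) = polyEval (g v) p := by
  have : (polyEval v).comp (polyComp g) = polyEval (g v) := by
    refine MvPolynomial.algHom_ext fun i => ?_
    rw [AlgHom.comp_apply, polyComp, MvPolynomial.aeval_X, polyEval_linForm, X_eq_linForm,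
      polyEval_linForm]
    rfl
  exact DFunLike.congr_fun this p

theorem totalDegree_polyComp_le (g : V →ₗ[ℂ] V) (p : Poly V) :
    (polyComp g p).totalDegree ≤ p.totalDegree := by
  conv_lhs => rw [← MvPolynomial.sum_homogeneousComponent p, map_sum]
  refine MvPolynomial.totalDegree_finsetSum_le fun i hi => ?_
  have h := (MvPolynomial.homogeneousComponent_isHomogeneous i p).aeval
    (fun i => linForm ((Module.finBasis ℂ V).coord i ∘ₗ g)) (fun i => isHomogeneous_linForm _)
  have h2 := h.totalDegree_le
  rw [Finset.mem_range] at hi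
  exact h2.trans (by lia)

theorem polyComp_id (p : Poly V) : polyComp LinearMap.id p = p :=
  poly_ext fun v => by rw [polyEval_polyComp, LinearMap.id_apply]

theorem polyComp_comp (g h : V →ₗ[ℂ] V) (p : Poly V) :
    polyComp (g ∘ₗ h) p = polyComp h (polyComp g p) :=
  poly_ext fun v => by
    rw [polyEval_polyComp, polyEval_polyComp, polyEval_polyComp, LinearMap.comp_apply]

attribute [irreducible] polyEval linForm polyComp

instance polyAction : MulSemiringAction (V ≃ₗ[ℂ] V) (Poly V) where
  smul g p := polyComp ((g⁻¹ : V ≃ₗ[ℂ] V) : V →ₗ[ℂ] V) p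
  one_smul p := polyComp_id p
  mul_smul g h p := by
    refine Eq.trans ?_
      (polyComp_comp ((h⁻¹ : V ≃ₗ[ℂ] V) : V →ₗ[ℂ] V) ((g⁻¹ : V ≃ₗ[ℂ] V) : V →ₗ[ℂ] V) p)
    change polyComp _ p = _
    rw [mul_inv_rev]
    rfl
  smul_zero g := map_zero (polyComp _)
  smul_add g := map_add (polyComp _)
  smul_one g := map_one (polyComp _)
  smul_mul g := map_mul (polyComp _)

theorem smul_poly_def (g : V ≃ₗ[ℂ] V) (p : Poly V) :
    g • p = polyComp ((g⁻¹ : V ≃ₗ[ℂ] V) : V →ₗ[ℂ] V) p := rfl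

@[simp] theorem polyEval_smul (g : V ≃ₗ[ℂ] V) (v : V) (p : Poly V) :
    polyEval v (g • p) = polyEval (g⁻¹ v) p :=
  polyEval_polyComp _ _ _

instance : SMulCommClass (V ≃ₗ[ℂ] V) ℂ (Poly V) where
  smul_comm g c p := poly_ext fun v => by simp

instance : FaithfulSMul (V ≃ₗ[ℂ] V) (Poly V) where
  eq_of_smul_eq_smul {g h} hgh := by
    rw [← inv_inj]
    refine LinearEquiv.ext fun v => ?_
    refine (Module.finBasis ℂ V).ext_elem fun i => ?_
    have := congrArg (polyEval v) (hgh (linForm ((Module.finBasis ℂ V).coord i)))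
    simpa using this

/-- Modulo `linForm φ`, the identity and the action of `g` are algebra homomorphisms that agree on
the coordinates: a coordinate minus its translate vanishes on the kernel of `φ`, so it is a multiple
of `φ`. -/
theorem linForm_dvd_sub_smul (g : V ≃ₗ[ℂ] V) (φ : V →ₗ[ℂ] ℂ) (h : ∀ v, φ v = 0 → g v = v)
    (p : Poly V) : linForm φ ∣ p - g • p := by
  rw [← Ideal.mem_span_singleton, ← Ideal.Quotient.eq]
  let q := Ideal.Quotient.mkₐ ℂ (Ideal.span {linForm φ})
  have : q = q.comp (polyComp ((g⁻¹ : V ≃ₗ[ℂ] V) : V →ₗ[ℂ] V)) := by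
    refine MvPolynomial.algHom_ext fun i => ?_
    refine Ideal.Quotient.eq.2 (Ideal.mem_span_singleton.2 ?_)
    let ψ : V →ₗ[ℂ] ℂ := (Module.finBasis ℂ V).coord i -
      (Module.finBasis ℂ V).coord i ∘ₗ ((g⁻¹ : V ≃ₗ[ℂ] V) : V →ₗ[ℂ] V)
    have hle : LinearMap.ker φ ≤ LinearMap.ker ψ := by
      intro v hv
      have h1 : g⁻¹ v = v := by
        conv_lhs => rw [← h v hv]
        exact g.symm_apply_apply v
      change (Module.finBasis ℂ V).coord i v - (Module.finBasis ℂ V).coord i (g⁻¹ v) = 0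
      rw [h1, sub_self]
    obtain ⟨c, hc⟩ := exists_eq_smul_of_ker_le hle
    refine ⟨MvPolynomial.C c, ?_⟩
    refine poly_ext fun v => ?_
    have h2 := LinearMap.congr_fun hc v
    rw [X_eq_linForm, map_sub]
    change _ - polyEval v (polyComp _ _) = _
    rw [polyEval_polyComp, map_mul, polyEval_linForm, polyEval_linForm,
      polyEval_linForm, ← MvPolynomial.algebraMap_eq, AlgHom.commutes]
    rw [LinearMap.smul_apply, smul_eq_mul, mul_comm] at h2
    exact h2
  exact DFunLike.congr_fun this p

theorem linForm_ne_zero {φ : V →ₗ[ℂ] ℂ} (h0 : φ ≠ 0) : linForm φ ≠ 0 := by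
  intro h
  refine h0 (LinearMap.ext fun v => ?_)
  rw [← polyEval_linForm v φ, h, map_zero]
  rfl

/-- The degree drops because a substitution does not raise it and division by a linear form lowers
it by one. -/
theorem exists_dividedDifference {s : V ≃ₗ[ℂ] V} (hs : IsPseudoReflection s) :
    ∃ (α : Poly V) (T : Poly V → Poly V), α ≠ 0 ∧ (∀ p, p - s • p = α * T p) ∧
      ∀ p, T p ≠ 0 → (T p).totalDegree < p.totalDegree := by
  obtain ⟨φ, h0, hφ⟩ := exists_linearForm_of_isCoatom hs
  have hα := linForm_ne_zero h0
  choose T hT using linForm_dvd_sub_smul s φ fun v hv => by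
    have : v ∈ LinearMap.ker φ := hv
    rw [hφ] at this
    exact LinearMap.mem_fixedSubmodule_iff.1 this
  refine ⟨linForm φ, T, hα, hT, fun p hp => ?_⟩
  have h1 := congrArg MvPolynomial.totalDegree (hT p)
  rw [MvPolynomial.totalDegree_mul_of_isDomain hα hp, (isHomogeneous_linForm _).totalDegree hα]
    at h1
  have h2 := MvPolynomial.totalDegree_sub p (s • p)
  have h3 := totalDegree_polyComp_le ((s⁻¹ : V ≃ₗ[ℂ] V) : V →ₗ[ℂ] V) p
  rw [← smul_poly_def] at h3
  rw [max_eq_left h3] at h2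
  lia

theorem exists_dividedDifferences (hW : IsComplexReflectionGroup W) :
    ∃ D : DividedDifferences ℂ W (Poly V), D.ε = polyEval 0 := by
  choose! α T hα hT hdeg using fun s : V ≃ₗ[ℂ] V => exists_dividedDifference (s := s)
  refine ⟨{
    ε := polyEval 0
    ε_smul := fun w p => ?_
    R := {s | IsPseudoReflection (s : V ≃ₗ[ℂ] V)}
    closure_R := ?_
    α := fun s => α s
    α_ne_zero := fun s hs => hα s hs
    T := fun s => T s
    α_mul_T := fun s hs p => hT s hs p
    deg := MvPolynomial.totalDegree
    deg_T := fun s hs p h0 => hdeg s hs p h0 }, rfl⟩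
  · change polyEval 0 ((w : V ≃ₗ[ℂ] V) • p) = _
    rw [polyEval_smul, map_zero]
  · refine Subgroup.map_injective W.subtype_injective ?_
    rw [MonoidHom.map_closure, ← MonoidHom.range_eq_map, Subgroup.range_subtype]
    conv_rhs => rw [← hW.closure_eq]
    congr 1
    ext s
    simp [and_comm]

/-- A nontrivial element that acts trivially on the polynomial functions modulo a prime element is
a pseudo-reflection, and the prime vanishes on its hyperplane only. -/
theorem isPseudoReflection_of_dvd {g : V ≃ₗ[ℂ] V} (hg : g ≠ 1) {π : Poly V} (hπ : Prime π)
    (h : ∀ f : Poly V, π ∣ g • f - f) :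
    IsPseudoReflection g ∧ ∀ v, polyEval v π = 0 → g v = v := by
  have hsub : ∀ φ : V →ₗ[ℂ] ℂ, g • linForm φ - linForm φ =
      linForm (φ ∘ₗ ((g⁻¹ : V ≃ₗ[ℂ] V) : V →ₗ[ℂ] V) - φ) := fun φ => poly_ext fun v => by
    rw [map_sub, polyEval_smul, polyEval_linForm, polyEval_linForm, polyEval_linForm]
    rfl
  have hfix : ∀ v, polyEval v π = 0 → g v = v := by
    intro v hv
    have h1 : g⁻¹ v = v := by
      refine (Module.finBasis ℂ V).ext_elem fun i => ?_
      obtain ⟨q, hq⟩ := h (linForm ((Module.finBasis ℂ V).coord i))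
      have := congrArg (polyEval v) hq
      rw [map_mul, hv, zero_mul, map_sub, polyEval_smul, polyEval_linForm, polyEval_linForm,
        sub_eq_zero] at this
      exact this
    conv_lhs => rw [← h1]
    exact g.apply_symm_apply v
  refine ⟨?_, hfix⟩
  obtain ⟨φ, hφ⟩ : ∃ φ : V →ₗ[ℂ] ℂ, φ ∘ₗ ((g⁻¹ : V ≃ₗ[ℂ] V) : V →ₗ[ℂ] V) - φ ≠ 0 := by
    by_contra! hcon
    refine hg (inv_eq_one.1 (LinearEquiv.ext fun v => ?_))
    refine (Module.finBasis ℂ V).ext_elem fun i => ?_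
    have := LinearMap.congr_fun (hcon ((Module.finBasis ℂ V).coord i)) v
    rw [LinearMap.sub_apply, LinearMap.zero_apply, sub_eq_zero] at this
    exact this
  obtain ⟨q, hq⟩ := h (linForm φ)
  rw [hsub] at hq
  set ψ := φ ∘ₗ ((g⁻¹ : V ≃ₗ[ℂ] V) : V →ₗ[ℂ] V) - φ with hψ
  have hψ0 := linForm_ne_zero hφ
  have hq0 : q ≠ 0 := fun h0 => hψ0 (by rw [hq, h0, mul_zero])
  -- A nonconstant divisor of a nonzero linear form has degree one with constant cofactor, so `π`
  -- vanishes on the hyperplane where `ψ` does.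
  have hdeg := congrArg MvPolynomial.totalDegree hq
  rw [(isHomogeneous_linForm _).totalDegree hψ0,
    MvPolynomial.totalDegree_mul_of_isDomain hπ.ne_zero hq0] at hdeg
  have hπdeg : π.totalDegree ≠ 0 := by
    intro h0
    rw [MvPolynomial.totalDegree_eq_zero_iff_eq_C] at h0
    have hc : MvPolynomial.coeff 0 π ≠ 0 := fun hc => hπ.ne_zero (by rw [h0, hc, map_zero])
    exact hπ.not_isUnit (by rw [h0]; exact (IsUnit.mk0 _ hc).map MvPolynomial.C)
  have hqdeg : q.totalDegree = 0 := by lia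
  rw [MvPolynomial.totalDegree_eq_zero_iff_eq_C] at hqdeg
  have hc : MvPolynomial.coeff 0 q ≠ 0 := fun hc => hq0 (by rw [hqdeg, hc, map_zero])
  have hle : LinearMap.ker ψ ≤ LinearMap.fixedSubmodule (g : V →ₗ[ℂ] V) := by
    intro v hv
    refine LinearMap.mem_fixedSubmodule_iff.2 (hfix v ?_)
    have := congrArg (polyEval v) hq
    rw [polyEval_linForm, LinearMap.mem_ker.1 hv, map_mul, hqdeg, ← MvPolynomial.algebraMap_eq,
      AlgHom.commutes] at this
    exact (mul_eq_zero.1 this.symm).resolve_right hc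
  rcases (isCoatom_ker hφ).le_iff.1 hle with htop | heq
  · refine absurd ?_ hg
    ext v
    have : v ∈ LinearMap.fixedSubmodule (g : V →ₗ[ℂ] V) := by rw [htop]; trivial
    exact LinearMap.mem_fixedSubmodule_iff.1 this
  · change IsCoatom _
    rw [heq]
    exact isCoatom_ker hφ

/-- **Steinberg's fixed point theorem** for points on no reflecting hyperplane. -/
theorem eq_one_of_apply_eq (hW : IsComplexReflectionGroup W) {x : V} (hx : x ∈ complement W)
    {w : V ≃ₗ[ℂ] V} (hw : w ∈ W) (hwx : w x = x) : w = 1 := by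
  classical
  have := hW.finite
  let _ := Fintype.ofFinite W
  by_contra hne
  obtain ⟨D, hD⟩ := exists_dividedDifferences hW
  obtain ⟨g, hg, hg0, h, hgen⟩ := D.exists_generators
  rw [hD] at hg0
  -- Generation is only known where `g` does not vanish, in particular near the origin. Scaling
  -- moves `x` there and changes neither its stabiliser nor its avoidance of the hyperplanes.
  obtain ⟨t, ht0, ht⟩ : ∃ t : ℂ, t ≠ 0 ∧ polyEval (t • x) g ≠ 0 := by
    have hcont : Continuous fun t : ℂ => polyEval (t • x) g := by
      have : (fun t : ℂ => polyEval (t • x) g) = fun t =>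
          MvPolynomial.eval (fun i => t * (Module.finBasis ℂ V).repr x i) g := by
        funext t
        rw [polyEval]
        simp [MvPolynomial.aeval_eq_eval]
      rw [this]
      exact (MvPolynomial.continuous_eval g).comp (by fun_prop)
    have h0 : polyEval ((0 : ℂ) • x) g ≠ 0 := by rw [zero_smul]; exact hg0
    have hev := (hcont.continuousAt (x := 0)).eventually_ne h0
    obtain ⟨t, ht, ht0⟩ := ((hev.filter_mono nhdsWithin_le_nhds).and
      (self_mem_nhdsWithin (s := {(0 : ℂ)}ᶜ))).exists
    exact ⟨t, ht0, ht⟩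
  set y := t • x with hy
  have hyM : y ∈ complement W := smul_mem_complement hx ht0
  have hwy : w y = y := by rw [hy, map_smul, hwx]
  set Δ := (Matrix.of fun u j : W => u • h j).det with hΔ
  have hΔ0 : Δ ≠ 0 := by
    have := det_smul_notMem (⊥ : Ideal (Poly V)) h g
      (fun hb => ht (by rw [Ideal.mem_bot.1 hb, map_zero])) hgen hg (fun u hu => by
        refine eq_of_smul_eq_smul (α := Poly V) fun f => ?_
        rw [one_smul]
        exact sub_eq_zero.1 (Ideal.mem_bot.1 (hu f)))
    simpa using this
  have hΔy : polyEval y Δ = 0 := by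
    rw [hΔ, AlgHom.map_det]
    -- Since `w` fixes `y`, the rows of `1` and `w` agree at `y`.
    refine Matrix.det_zero_of_row_eq (i := 1) (j := ⟨w, hw⟩) (fun h1 => hne ?_) ?_
    · exact (congrArg Subtype.val h1).symm
    · funext j
      change polyEval y ((1 : W) • h j) = polyEval y (w • h j)
      have : w⁻¹ y = y := by
        conv_lhs => rw [← hwy]
        exact w.symm_apply_apply y
      rw [one_smul, polyEval_smul, this]
  obtain ⟨π, hπ, hπΔ, hπy⟩ : ∃ π : Poly V, Prime π ∧ π ∣ Δ ∧ polyEval y π = 0 := by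
    obtain ⟨u, hu⟩ := UniqueFactorizationMonoid.factors_prod hΔ0
    rw [← hu, map_mul] at hΔy
    have h1 := (mul_eq_zero.1 hΔy).resolve_right ((u.isUnit.map (polyEval y)).ne_zero)
    rw [map_multiset_prod, Multiset.prod_eq_zero_iff, Multiset.mem_map] at h1
    obtain ⟨π, hπ, h0⟩ := h1
    exact ⟨π, UniqueFactorizationMonoid.prime_of_factor _ hπ,
      UniqueFactorizationMonoid.dvd_of_mem_factors hπ, h0⟩
  have hP : (Ideal.span {π}).IsPrime := (Ideal.span_singleton_prime hπ.ne_zero).2 hπ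
  -- The prime `π` divides the determinant although `g` is nonzero at its zero `y`, so its inertia
  -- group must be nontrivial. An inertia element is a pseudo-reflection fixing `y`, which
  -- contradicts the choice of `x`.
  obtain ⟨u, hu, hu1⟩ : ∃ u : W, (∀ f : Poly V, u • f - f ∈ Ideal.span {π}) ∧ u ≠ 1 := by
    by_contra! hcon
    refine det_smul_notMem (Ideal.span {π}) h g (fun hmem => ?_) hgen hg hcon
      (Ideal.mem_span_singleton.2 hπΔ)
    obtain ⟨q, hq⟩ := Ideal.mem_span_singleton.1 hmem
    exact ht (by rw [hq, map_mul, hπy, zero_mul])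
  obtain ⟨hrefl, hfix⟩ := isPseudoReflection_of_dvd (g := (u : V ≃ₗ[ℂ] V))
    (fun h1 => hu1 (Subtype.ext h1)) hπ (fun f => Ideal.mem_span_singleton.1 (hu f))
  exact hyM _ ⟨u, u.2, hrefl, rfl⟩ (LinearMap.mem_fixedSubmodule_iff.2 (hfix y hπy))

end Steinberg

/-! ### Functors from paths to a group and their local primitives -/

section PathHom

open unitInterval Topology

/-- A homotopy invariant, multiplicative function on the paths of a space: a functor from the
fundamental groupoid to a group. -/
structure PathHom (X Q : Type*) [TopologicalSpace X] [Group Q] where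
  toFun : ∀ {y z : X}, Path y z → Q
  homotopic : ∀ {y z : X} {p q : Path y z}, p.Homotopic q → toFun p = toFun q
  trans : ∀ {x y z : X} (p : Path x y) (q : Path y z), toFun (p.trans q) = toFun p * toFun q

namespace PathHom

variable {X Y Q : Type*} [TopologicalSpace X] [TopologicalSpace Y] [Group Q]

instance : CoeFun (PathHom X Q) fun _ => ∀ {y z : X}, Path y z → Q := ⟨PathHom.toFun⟩

variable (F : PathHom X Q)

theorem refl (y : X) : F (Path.refl y) = 1 := by
  have h := F.trans (Path.refl y) (Path.refl y)
  rw [Path.refl_trans_refl] at h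
  exact left_eq_mul.1 h

theorem symm {y z : X} (p : Path y z) : F p.symm = (F p)⁻¹ := by
  rw [eq_inv_iff_mul_eq_one, ← F.trans, ← F.refl z]
  exact F.homotopic ⟨(Path.Homotopy.reflSymmTrans p).symm⟩

theorem eq_of_forall_eq {y z y' z' : X} {p : Path y z} {q : Path y' z'} (h : ∀ t, p t = q t) :
    F p = F q := by
  obtain rfl : y = y' := by rw [← p.source, ← q.source, h]
  obtain rfl : z = z' := by rw [← p.target, ← q.target, h]
  congr 1
  exact Path.ext (funext h)

theorem eq_one_of_forall_eq {y z : X} {p : Path y z} (c : X) (h : ∀ t, p t = c) : F p = 1 :=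
  (F.eq_of_forall_eq (q := Path.refl c) h).trans (F.refl c)

/-- The pullback along a continuous map. -/
def comap (f : C(Y, X)) : PathHom Y Q where
  toFun p := F (p.map f.continuous)
  homotopic h := F.homotopic (h.map f)
  trans p q := by rw [Path.map_trans, F.trans]

@[simp] theorem comap_apply (f : C(Y, X)) {y z : Y} (p : Path y z) :
    F.comap f p = F (p.map f.continuous) := rfl

theorem eq_of_simplyConnected [SimplyConnectedSpace X] {y z : X} (p q : Path y z) : F p = F q :=
  F.homotopic (SimplyConnectedSpace.paths_homotopic p q)

/-- The two ways around a square agree. -/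
theorem square (K : C(I × I, X)) {a b c d : X} (p₀ : Path a b) (p₁ : Path c d) (l : Path a c)
    (r : Path b d) (h₀ : ∀ t, p₀ t = K (t, 0)) (h₁ : ∀ t, p₁ t = K (t, 1))
    (hl : ∀ t, l t = K (0, t)) (hr : ∀ t, r t = K (1, t)) : F p₀ * F r = F l * F p₁ := by
  have : ContractibleSpace I := (convex_Icc (0 : ℝ) 1).contractibleSpace ⟨0, by simp⟩
  let id' : Path (0 : I) 1 := ⟨ContinuousMap.id I, rfl, rfl⟩
  have key := (F.comap K).eq_of_simplyConnected
    ((id'.prod (Path.refl 0)).trans ((Path.refl 1).prod id'))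
    (((Path.refl 0).prod id').trans (id'.prod (Path.refl 1)))
  rw [(F.comap K).trans, (F.comap K).trans] at key
  convert key using 2
  · exact F.eq_of_forall_eq h₀
  · exact F.eq_of_forall_eq hr
  · exact F.eq_of_forall_eq hl
  · exact F.eq_of_forall_eq h₁

/-- A function is flat on `U` if along short paths from points of `U` it changes by the values
of `F`. -/
def Flat (g : X → Q) (U : Set X) : Prop :=
  ∀ y ∈ U, ∃ N ∈ 𝓝 y, ∀ (z : X) (η : Path y z), (∀ t, η t ∈ N) → g z = g y * F η

variable {F}

theorem Flat.mono {g : X → Q} {U U' : Set X} (h : F.Flat g U) (hU : U' ⊆ U) : F.Flat g U' :=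
  fun y hy => h y (hU hy)

theorem Flat.const_mul {g : X → Q} {U : Set X} (h : F.Flat g U) (c : Q) :
    F.Flat (fun x => c * g x) U := fun y hy => by
  obtain ⟨N, hN, hg⟩ := h y hy
  exact ⟨N, hN, fun z η hη => by
    change c * g z = c * g y * _
    rw [hg z η hη, mul_assoc]⟩

theorem Flat.congr {g g' : X → Q} {U : Set X} (h : F.Flat g U) (hU : IsOpen U)
    (hg : ∀ x ∈ U, g x = g' x) : F.Flat g' U := fun y hy => by
  obtain ⟨N, hN, hF⟩ := h y hy
  refine ⟨N ∩ U, Filter.inter_mem hN (hU.mem_nhds hy), fun z η hη => ?_⟩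
  have hz : z ∈ U := by
    have := (hη 1).2
    rwa [η.target] at this
  rw [← hg z hz, ← hg y hy]
  exact hF z η fun t => (hη t).1

/-- Flatness makes `g (η t)`, corrected by the inverse of `F` on the initial piece of `η` up to `t`,
locally constant in `t`. Connectedness of the interval then compares its two ends. -/
theorem Flat.apply_eq {g : X → Q} {U : Set X} (h : F.Flat g U) {y z : X} (η : Path y z)
    (hη : ∀ t, η t ∈ U) : g z = g y * F η := by
  let c : I → Q := fun t => g (η t) * (F (η.subpath 0 t))⁻¹
  have hsub : ∀ s t, F (η.subpath 0 s) * F (η.subpath s t) = F (η.subpath 0 t) := fun s t => by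
    rw [← F.trans]
    exact F.homotopic ⟨Path.Homotopy.subpathTransSubpath η 0 s t⟩
  have hc : IsLocallyConstant c := by
    rw [IsLocallyConstant.iff_eventually_eq]
    intro t₀
    obtain ⟨N, hN, hg⟩ := h (η t₀) (hη t₀)
    have hpre : η ⁻¹' N ∈ 𝓝 t₀ := η.continuous.continuousAt hN
    obtain ⟨ε, hε, hball⟩ := Metric.mem_nhds_iff.1 hpre
    filter_upwards [Metric.ball_mem_nhds t₀ hε] with t ht
    have hin : ∀ u, (η.subpath t₀ t) u ∈ N := by
      intro u
      have hu : (η.subpath t₀ t) u ∈ η '' Set.uIcc t₀ t := by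
        rw [← Path.range_subpath]
        exact ⟨u, rfl⟩
      obtain ⟨v, hv, hvu⟩ := hu
      rw [← hvu]
      refine hball ?_
      rw [Metric.mem_ball, Subtype.dist_eq, Real.dist_eq] at ht ⊢
      refine lt_of_le_of_lt ?_ ht
      have hv' : (v : ℝ) ∈ Set.uIcc (t₀ : ℝ) (t : ℝ) := hv
      exact Set.abs_sub_left_of_mem_uIcc hv'
    have := hg _ _ hin
    change g (η t) * _ = g (η t₀) * _
    rw [this, ← hsub t₀ t, mul_inv_rev]
    group
  have h01 : c 1 = c 0 := hc.apply_eq_of_isPreconnected isPreconnected_univ trivial trivial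
  have e1 : F (η.subpath 0 1) = F η := F.eq_of_forall_eq fun t => by simp
  have e0 : F (η.subpath 0 0) = 1 := F.eq_one_of_forall_eq (η 0) fun t => by simp
  have e2 : g (η 1) * (F η)⁻¹ = g (η 0) := by
    have : c 1 = c 0 := h01
    simp only [c, e1, e0, inv_one, mul_one] at this
    exact this
  rw [η.source, η.target] at e2
  rw [← e2, inv_mul_cancel_right]

theorem Flat.eq_one_of_loop {g : X → Q} {U : Set X} (h : F.Flat g U) {y : X} (η : Path y y)
    (hη : ∀ t, η t ∈ U) : F η = 1 :=
  (left_eq_mul.1 (h.apply_eq η hη))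

/-- Flat functions on two open sets with path connected intersection can be glued. -/
theorem exists_flat_union {U₁ U₂ : Set X} (hU₁ : IsOpen U₁) (hU₂ : IsOpen U₂)
    (hconn : ∀ y ∈ U₁ ∩ U₂, ∀ z ∈ U₁ ∩ U₂, JoinedIn (U₁ ∩ U₂) y z)
    (h₁ : ∃ g, F.Flat g U₁) (h₂ : ∃ g, F.Flat g U₂) : ∃ g, F.Flat g (U₁ ∪ U₂) := by
  classical
  obtain ⟨g₁, h₁⟩ := h₁
  obtain ⟨g₂, h₂⟩ := h₂
  -- On the path connected overlap two flat functions differ by a constant left factor, which is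
  -- absorbed into `g₂`.
  obtain ⟨c, hc⟩ : ∃ c : Q, ∀ z ∈ U₁ ∩ U₂, g₁ z = c * g₂ z := by
    by_cases hne : (U₁ ∩ U₂).Nonempty
    · obtain ⟨y, hy⟩ := hne
      refine ⟨g₁ y * (g₂ y)⁻¹, fun z hz => ?_⟩
      obtain ⟨η, hη⟩ := hconn y hy z hz
      rw [h₁.apply_eq η fun t => (hη t).1, h₂.apply_eq η fun t => (hη t).2]
      group
    · exact ⟨1, fun z hz => absurd ⟨z, hz⟩ hne⟩
  refine ⟨fun z => if z ∈ U₁ then g₁ z else c * g₂ z, ?_⟩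
  rintro y (hy | hy)
  · exact h₁.congr hU₁ (fun x hx => (if_pos hx).symm) y hy
  · refine (h₂.const_mul c).congr hU₂ (fun x hx => ?_) y hy
    split_ifs with hx1
    · exact (hc x ⟨hx1, hx⟩).symm
    · rfl

/-- Let `f` be a map from a simply connected space with open image such that paths in the image
lift. If `F` is trivial on the images of paths between points of the same fibre, then there is a
flat function on the image. -/
theorem exists_flat_range [SimplyConnectedSpace Y] (F : PathHom X Q) (f : C(Y, X))
    (hopen : IsOpen (Set.range f))
    (hlift : ∀ {y z : X} (η : Path y z), (∀ t, η t ∈ Set.range f) → ∀ a, f a = y →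
      ∃ (b : Y) (η' : Path a b), ∀ t, f (η' t) = η t)
    (hmon : ∀ a b, f a = f b → ∃ p : Path a b, F (p.map f.continuous) = 1) :
    ∃ g, F.Flat g (Set.range f) := by
  obtain ⟨a₀⟩ := (inferInstance : PathConnectedSpace Y).nonempty
  have : Nonempty Y := ⟨a₀⟩
  let pth : ∀ b : Y, Path a₀ b := fun b => PathConnectedSpace.somePath a₀ b
  let τ : X → Y := Function.invFun f
  have hτ : ∀ z ∈ Set.range f, f (τ z) = z := fun z hz => Function.invFun_eq hz
  refine ⟨fun z => F ((pth (τ z)).map f.continuous), ?_⟩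
  intro y hy
  refine ⟨Set.range f, hopen.mem_nhds hy, fun z η hη => ?_⟩
  have hz : z ∈ Set.range f := by
    have := hη 1
    rwa [η.target] at this
  obtain ⟨b, η', hη'⟩ := hlift η hη (τ y) (hτ y hy)
  have hb : f b = f (τ z) := by
    rw [hτ z hz, ← η'.target, hη', η.target]
  -- The section `τ` need not be continuous, so the lift may end at another point of the fibre than
  -- `τ z`. The path `p` bridges this gap without changing the value of `F`.
  obtain ⟨p, hp⟩ := hmon b (τ z) hb
  have h1 := (F.comap f).eq_of_simplyConnected (pth (τ z)) (((pth (τ y)).trans η').trans p)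
  rw [(F.comap f).trans, (F.comap f).trans] at h1
  have h2 : F (η'.map f.continuous) = F η := F.eq_of_forall_eq hη'
  simp only [comap_apply, hp, h2, mul_one] at h1
  exact h1

end PathHom
end PathHom

/-! ### Loops in a plane with finitely many punctures -/

section PuncturedPlane

open unitInterval Topology

namespace PathHom

variable {Q : Type*} [Group Q]

/-- Flat functions exist on balls that avoid the punctures. -/
theorem exists_flat_ball {E : Type*} [NormedAddCommGroup E] [NormedSpace ℝ E] {M : Set E}
    (F : PathHom M Q) (q : E) {ε : ℝ} (hε : 0 < ε) (hM : Metric.ball q ε ⊆ M) :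
    ∃ g, F.Flat g {z : M | (z : E) ∈ Metric.ball q ε} := by
  have : ContractibleSpace (Metric.ball q ε) :=
    (convex_ball q ε).contractibleSpace ⟨q, Metric.mem_ball_self hε⟩
  let f : C(Metric.ball q ε, M) := ⟨fun z => ⟨z, hM z.2⟩, by fun_prop⟩
  have hr : Set.range f = {z : M | (z : E) ∈ Metric.ball q ε} := by
    ext z
    constructor
    · rintro ⟨w, rfl⟩
      exact w.2
    · intro hz
      exact ⟨⟨z, hz⟩, rfl⟩
  rw [← hr]
  refine F.exists_flat_range f ?_ ?_ ?_
  · rw [hr]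
    exact Metric.isOpen_ball.preimage continuous_subtype_val
  · intro y z η hη a ha
    have hη' : ∀ t, ((η t : M) : E) ∈ Metric.ball q ε := fun t => by
      have := hη t
      rwa [hr] at this
    have h0 : (⟨η 0, hη' 0⟩ : Metric.ball q ε) = a := by
      apply Subtype.ext
      change ((η 0 : M) : E) = a
      rw [η.source, ← ha]
      rfl
    exact ⟨⟨η 1, hη' 1⟩, ⟨⟨fun t => ⟨η t, hη' t⟩, by fun_prop⟩, h0, rfl⟩, fun t => rfl⟩
  · intro a b hab
    obtain rfl : a = b := Subtype.ext (congrArg (fun z : M => (z : E)) hab)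
    exact ⟨Path.refl a, F.refl _⟩

/-- If `F` is trivial on small circles around a puncture `q`, there is a flat function near `q`. -/
theorem exists_flat_puncturedBall {M : Set ℂ} (F : PathHom M Q) (q : ℂ) (r : ℝ)
    (hM : ∀ u : ℂ, u.re < r → q + Complex.exp u ∈ M) (hq : q ∉ M)
    (hcirc : ∀ (u : ℂ), u.re < r → ∀ (y : M) (c : Path y y),
      (∀ t : I, (c t : ℂ) = q + Complex.exp (u + 2 * Real.pi * Complex.I * ((t : ℝ) : ℂ))) →
      F c = 1) :
    ∃ g, F.Flat g {z : M | (z : ℂ) ∈ Metric.ball q (Real.exp r)} := by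
  let Y : Set ℂ := {u | u.re < r}
  have hY : Convex ℝ Y := convex_halfSpace_re_lt r
  have : ContractibleSpace Y := hY.contractibleSpace ⟨((r - 1 : ℝ) : ℂ), by simp [Y]⟩
  -- The exponential parametrizes the punctured disc of radius `exp r` by a half plane, which is
  -- convex and so simply connected.
  let f : C(Y, M) := ⟨fun u => ⟨q + Complex.exp u, hM u u.2⟩, by fun_prop⟩
  have hr : Set.range f = {z : M | (z : ℂ) ∈ Metric.ball q (Real.exp r)} := by
    ext z
    constructor
    · rintro ⟨u, rfl⟩
      have : u.1.re < r := u.2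
      simpa [f, Complex.norm_exp] using this
    · intro hz
      have hz0 : (z : ℂ) - q ≠ 0 := fun h => hq (by rw [← sub_eq_zero.1 h]; exact z.2)
      refine ⟨⟨Complex.log (z - q), ?_⟩, ?_⟩
      · change (Complex.log _).re < r
        rw [Complex.log_re, Real.log_lt_iff_lt_exp (norm_pos_iff.2 hz0)]
        simpa [dist_eq_norm] using hz
      · apply Subtype.ext
        simp [f, Complex.exp_log hz0]
  rw [← hr]
  refine F.exists_flat_range f ?_ ?_ ?_
  · rw [hr]
    exact Metric.isOpen_ball.preimage continuous_subtype_val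
  · intro y z η hη a ha
    have hne : ∀ t, ((η t : M) : ℂ) - q ≠ 0 := fun t h =>
      hq (by rw [← sub_eq_zero.1 h]; exact (η t).2)
    let η₀ : C(I, {z : ℂ // z ≠ 0}) := ⟨fun t => ⟨(η t : ℂ) - q, hne t⟩, by fun_prop⟩
    have h0 : η₀ 0 = ⟨Complex.exp a, Complex.exp_ne_zero _⟩ := by
      apply Subtype.ext
      change ((η 0 : M) : ℂ) - q = _
      rw [η.source, ← ha]
      simp [f]
    obtain ⟨Γ, hΓ, hΓ0⟩ := Complex.isCoveringMap_exp.exists_path_lifts η₀ a h0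
    have hΓ' : ∀ t, Complex.exp (Γ t) = (η t : ℂ) - q := fun t =>
      congrArg Subtype.val (congrFun hΓ t)
    have hΓY : ∀ t, Γ t ∈ Y := by
      intro t
      have h1 := hη t
      rw [hr] at h1
      have h2 : ‖((η t : M) : ℂ) - q‖ < Real.exp r := by simpa [dist_eq_norm] using h1
      rw [← hΓ', Complex.norm_exp] at h2
      exact Real.exp_lt_exp.1 h2
    refine ⟨⟨Γ 1, hΓY 1⟩, ⟨⟨fun t => ⟨Γ t, hΓY t⟩, by fun_prop⟩, Subtype.ext hΓ0, rfl⟩, fun t => ?_⟩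
    apply Subtype.ext
    change q + Complex.exp (Γ t) = _
    rw [hΓ']
    ring
  -- Points of one fibre differ by a multiple of `2πi`. One step upward maps to a circle around the
  -- puncture; negative multiples are handled by reversal.
  · have hstep : ∀ a b : Y, (b : ℂ) = a + 2 * Real.pi * Complex.I →
        ∃ p : Path a b, F (p.map f.continuous) = 1 := by
      intro a b hab
      have hmem : ∀ t : I, (a : ℂ) + 2 * Real.pi * Complex.I * ((t : ℝ) : ℂ) ∈ Y := by
        intro t
        have : a.1.re < r := a.2
        simpa [Y] using this
      let p : Path a b := ⟨⟨fun t => ⟨(a : ℂ) + 2 * Real.pi * Complex.I * ((t : ℝ) : ℂ), hmem t⟩,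
        by fun_prop⟩, Subtype.ext (by simp), Subtype.ext (by simp [hab])⟩
      have hfab : f a = f b := Subtype.ext (by simp [f, hab, Complex.exp_add])
      refine ⟨p, ?_⟩
      have h1 := hcirc a a.2 (f a) ((p.map f.continuous).cast rfl hfab) (fun t => rfl)
      rw [← h1]
      exact F.eq_of_forall_eq fun t => rfl
    have hnat : ∀ (n : ℕ) (a b : Y), (b : ℂ) = a + n * (2 * Real.pi * Complex.I) →
        ∃ p : Path a b, F (p.map f.continuous) = 1 := by
      intro n
      induction n with
      | zero =>
        intro a b hab
        obtain rfl : a = b := Subtype.ext (by simpa using hab.symm)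
        exact ⟨Path.refl a, F.refl _⟩
      | succ n ih =>
        intro a b hab
        have hc : (a : ℂ) + n * (2 * Real.pi * Complex.I) ∈ Y := by
          have : a.1.re < r := a.2
          simpa [Y] using this
        obtain ⟨p, hp⟩ := ih a ⟨_, hc⟩ rfl
        obtain ⟨p', hp'⟩ := hstep ⟨_, hc⟩ b (by rw [hab]; push_cast; ring)
        refine ⟨p.trans p', ?_⟩
        rw [Path.map_trans, F.trans, hp, hp', one_mul]
    intro a b hab
    have hexp : Complex.exp a = Complex.exp b := by
      have := congrArg Subtype.val hab
      simpa [f] using this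
    obtain ⟨n, hn⟩ := Complex.exp_eq_exp_iff_exists_int.1 hexp
    obtain ⟨m, rfl | rfl⟩ := n.eq_nat_or_neg
    · obtain ⟨p, hp⟩ := hnat m b a (by simpa using hn)
      refine ⟨p.symm, ?_⟩
      rw [← Path.map_symm, F.symm, hp, inv_one]
    · exact hnat m a b (by rw [hn]; push_cast; ring)

end PathHom

/-- Points of a convex open subset of the plane are joined outside a finite set. -/
theorem joinedIn_convex_diff_finite {C S : Set ℂ} (hC : Convex ℝ C) (hCo : IsOpen C)
    (hS : S.Finite) {y z : ℂ} (hy : y ∈ C \ S) (hz : z ∈ C \ S) : JoinedIn (C \ S) y z := by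
  by_cases hyz : y = z
  · rw [hyz]; exact JoinedIn.refl hz
  have hd : z - y ≠ 0 := sub_ne_zero.2 (Ne.symm hyz)
  -- The two points are joined through a point of their perpendicular bisector close to the
  -- midpoint.
  let w : ℝ → ℂ := fun τ => (y + z) / 2 + τ * Complex.I * (z - y)
  have hw : Continuous w := by fun_prop
  have hw0 : w 0 ∈ C := by
    have := hC hy.1 hz.1 (by norm_num : (0 : ℝ) ≤ 1 / 2) (by norm_num : (0 : ℝ) ≤ 1 / 2)
      (by norm_num)
    convert this using 1
    simp [w]; ring
  have hev : ∀ᶠ τ in 𝓝 (0 : ℝ), w τ ∈ C := hw.continuousAt (hCo.mem_nhds hw0)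
  obtain ⟨δ, hδ, hball⟩ := Metric.eventually_nhds_iff.1 hev
  -- In the coordinate `(s - y) / (z - y)`, the segment from `y` to `w τ` consists of the points `l
  -- / 2 + l τ i`; so each puncture excludes at most one `τ`, and likewise for the segment from `z`.
  let bad : Set ℝ := (fun s : ℂ => ((s - y) / (z - y)).im / (2 * ((s - y) / (z - y)).re)) '' S ∪
    (fun s : ℂ => -((s - z) / (z - y)).im / (2 * ((s - z) / (z - y)).re)) '' S
  have hbad : bad.Finite := (hS.image _).union (hS.image _)
  obtain ⟨τ, hτ, hτb⟩ := ((Set.Ioo_infinite hδ).sdiff hbad).nonempty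
  have hwC : w τ ∈ C := hball (by simpa [abs_of_pos hτ.1] using hτ.2)
  have hseg1 : segment ℝ y (w τ) ⊆ C \ S := by
    intro s hs
    refine ⟨hC.segment_subset hy.1 hwC hs, fun hsS => hτb (Or.inl ⟨s, hsS, ?_⟩)⟩
    rw [segment_eq_image'] at hs
    obtain ⟨l, hl, rfl⟩ := hs
    have hl0 : l ≠ 0 := by
      rintro rfl
      exact hy.2 (by simpa using hsS)
    have h1 : (y + l • (w τ - y) - y) / (z - y) = ⟨l / 2, l * τ⟩ := by
      rw [div_eq_iff hd, Complex.real_smul]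
      have : (⟨l / 2, l * τ⟩ : ℂ) = l / 2 + l * τ * Complex.I := by
        apply Complex.ext <;> simp
      rw [this]
      simp only [w]
      ring
    dsimp only
    rw [h1]
    field_simp
  have hseg2 : segment ℝ z (w τ) ⊆ C \ S := by
    intro s hs
    refine ⟨hC.segment_subset hz.1 hwC hs, fun hsS => hτb (Or.inr ⟨s, hsS, ?_⟩)⟩
    rw [segment_eq_image'] at hs
    obtain ⟨l, hl, rfl⟩ := hs
    have hl0 : l ≠ 0 := by
      rintro rfl
      exact hz.2 (by simpa using hsS)
    have h1 : (z + l • (w τ - z) - z) / (z - y) = ⟨-l / 2, l * τ⟩ := by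
      rw [div_eq_iff hd, Complex.real_smul]
      have : (⟨-l / 2, l * τ⟩ : ℂ) = -l / 2 + l * τ * Complex.I := by
        apply Complex.ext <;> simp
      rw [this]
      simp only [w]
      ring
    dsimp only
    rw [h1]
    field_simp
  exact (JoinedIn.of_segment_subset hseg1).trans (JoinedIn.of_segment_subset hseg2).symm

/-- A property of open intervals that holds for small intervals around every point, passes to
subintervals, and holds for the union of two overlapping intervals, holds for all intervals. -/
theorem interval_induction {P : ℝ → ℝ → Prop}
    (hmono : ∀ {a b a' b'}, a ≤ a' → b' ≤ b → P a b → P a' b')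
    (hloc : ∀ t, ∃ ε > 0, P (t - ε) (t + ε))
    (hglue : ∀ {a b c d}, a ≤ b → b < c → c ≤ d → P a c → P b d → P a d) (A B : ℝ) : P A B := by
  by_cases hAB : A ≤ B
  swap
  · obtain ⟨ε, hε, h⟩ := hloc A
    refine hmono (a := A - ε) (b := A + ε) ?_ ?_ h <;> linarith [not_le.1 hAB]
  let s : Set ℝ := {t | P A t}
  obtain ⟨ε₀, hε₀, h₀⟩ := hloc A
  have hA : P A (A + ε₀) := hmono (by linarith) le_rfl h₀
  by_contra hB
  have hbdd : BddAbove s := ⟨B, fun t ht => by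
    by_contra hlt
    exact hB (hmono le_rfl (not_le.1 hlt).le ht)⟩
  have hne : s.Nonempty := ⟨_, hA⟩
  let T := sSup s
  have hAT : A + ε₀ ≤ T := le_csSup hbdd hA
  obtain ⟨ε, hε, hT⟩ := hloc T
  -- The minimum with `ε₀` keeps the left end of the new interval to the right of `A`, as gluing
  -- requires.
  obtain ⟨t, ht, hlt⟩ := exists_lt_of_lt_csSup hne (show T - min ε ε₀ < T by
    linarith [lt_min hε hε₀])
  have htT : t ≤ T := le_csSup hbdd ht
  have h1 : P (T - min ε ε₀) (T + ε) := hmono (by linarith [min_le_left ε ε₀]) le_rfl hT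
  have h2 : P A (T + ε) := hglue (by linarith [min_le_right ε ε₀]) hlt (by linarith) ht h1
  have : T + ε ≤ T := le_csSup hbdd h2
  linarith

/-- Paths in the plane outside a finite set: `F` is trivial on loops if it is so on small circles
around the punctures. -/
theorem PathHom.eq_one_of_puncturedPlane {Q : Type*} [Group Q] {S : Set ℂ} (hS : S.Finite)
    (F : PathHom (Sᶜ : Set ℂ) Q)
    (hcirc : ∀ q ∈ S, ∃ r : ℝ, ∀ u : ℂ, u.re < r → ∀ (y : (Sᶜ : Set ℂ)) (c : Path y y),
      (∀ t : I, (c t : ℂ) = q + Complex.exp (u + 2 * Real.pi * Complex.I * ((t : ℝ) : ℂ))) →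
      F c = 1) {y : (Sᶜ : Set ℂ)} (η : Path y y) : F η = 1 := by
  have hlocal : ∀ q : ℂ, ∃ ε > 0, ∃ g, F.Flat g {z : (Sᶜ : Set ℂ) | (z : ℂ) ∈ Metric.ball q ε} := by
    intro q
    have hd : ∀ᶠ z in 𝓝 q, z ∉ S \ {q} :=
      (hS.subset Set.sdiff_subset).isClosed.isOpen_compl.mem_nhds (by simp)
    obtain ⟨ε, hε, hball⟩ := Metric.eventually_nhds_iff_ball.1 hd
    by_cases hq : q ∈ S
    · obtain ⟨r, hr⟩ := hcirc q hq
      refine ⟨Real.exp (min r (Real.log ε)), Real.exp_pos _,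
        F.exists_flat_puncturedBall q _ (fun u hu => ?_) (by simpa using hq)
        (fun u hu => hr u (hu.trans_le (min_le_left _ _)))⟩
      have h1 : q + Complex.exp u ∈ Metric.ball q ε := by
        have : u.re < Real.log ε := hu.trans_le (min_le_right _ _)
        simpa [Complex.norm_exp] using (Real.lt_log_iff_exp_lt hε).1 this
      intro hmem
      exact hball _ h1 ⟨hmem, by simp [Complex.exp_ne_zero]⟩
    · refine ⟨ε, hε, F.exists_flat_ball q hε fun z hz hzS => ?_⟩
      exact hball z hz ⟨hzS, fun h => hq (by rw [← Set.mem_singleton_iff.1 h]; exact hzS)⟩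
  let rect : ℝ → ℝ → ℝ → ℝ → Set ℂ := fun a b c d => {z | (a < z.re ∧ z.re < b) ∧ c < z.im ∧ z.im < d}
  let R : ℝ → ℝ → ℝ → ℝ → Set (Sᶜ : Set ℂ) := fun a b c d => {z | (z : ℂ) ∈ rect a b c d}
  have hrecto : ∀ a b c d, IsOpen (rect a b c d) := fun a b c d =>
    ((isOpen_lt continuous_const Complex.continuous_re).inter
      (isOpen_lt Complex.continuous_re continuous_const)).inter
    ((isOpen_lt continuous_const Complex.continuous_im).inter
      (isOpen_lt Complex.continuous_im continuous_const))
  have hrectc : ∀ a b c d, Convex ℝ (rect a b c d) := fun a b c d =>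
    ((convex_halfSpace_re_gt a).inter (convex_halfSpace_re_lt b)).inter
      ((convex_halfSpace_im_gt c).inter (convex_halfSpace_im_lt d))
  have hRo : ∀ a b c d, IsOpen (R a b c d) := fun a b c d =>
    (hrecto a b c d).preimage continuous_subtype_val
  have hRj : ∀ a b c d, ∀ y ∈ R a b c d, ∀ z ∈ R a b c d, JoinedIn (R a b c d) y z := by
    intro a b c d y hy z hz
    obtain ⟨p, hp⟩ := joinedIn_convex_diff_finite (hrectc a b c d) (hrecto a b c d) hS
      (y := y) (z := z) ⟨hy, y.2⟩ ⟨hz, z.2⟩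
    exact ⟨⟨⟨fun t => ⟨p t, (hp t).2⟩, by fun_prop⟩, Subtype.ext p.source, Subtype.ext p.target⟩,
      fun t => (hp t).1⟩
  have hglue : ∀ {U₁ U₂ U : Set (Sᶜ : Set ℂ)} {a b c d}, IsOpen U₁ → IsOpen U₂ →
      U₁ ∩ U₂ = R a b c d → U ⊆ U₁ ∪ U₂ → (∃ g, F.Flat g U₁) → (∃ g, F.Flat g U₂) →
      ∃ g, F.Flat g U := by
    intro U₁ U₂ U a b c d h₁ h₂ hint hU hF₁ hF₂
    obtain ⟨g, hg⟩ := exists_flat_union h₁ h₂ (by rw [hint]; exact hRj a b c d) hF₁ hF₂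
    exact ⟨g, hg.mono hU⟩
  -- Discs are first glued horizontally into a strip, whose height may shrink at each gluing, and
  -- then strips are glued vertically. Overlaps are rectangles, which remain path connected without
  -- the punctures.
  have hrow : ∀ (t A B : ℝ), ∃ ε > 0, ∃ g, F.Flat g (R A B (t - ε) (t + ε)) := by
    intro t A B
    refine interval_induction (P := fun a b => ∃ ε > 0, ∃ g, F.Flat g (R a b (t - ε) (t + ε)))
      ?_ ?_ ?_ A B
    · rintro a b a' b' ha hb ⟨ε, hε, g, hg⟩
      exact ⟨ε, hε, g, hg.mono fun z hz => ⟨⟨ha.trans_lt hz.1.1, hz.1.2.trans_le hb⟩, hz.2⟩⟩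
    · intro s
      obtain ⟨ε, hε, g, hg⟩ := hlocal ⟨s, t⟩
      refine ⟨ε / 2, half_pos hε, ε / 2, half_pos hε, g, hg.mono ?_⟩
      rintro z ⟨⟨h1, h2⟩, h3, h4⟩
      refine Metric.mem_ball.2 ((dist_eq_norm (z : ℂ) _).trans_lt ?_)
      refine (Complex.norm_le_abs_re_add_abs_im _).trans_lt ?_
      have e1 : |((z : ℂ) - ⟨s, t⟩).re| < ε / 2 := by
        rw [Complex.sub_re, abs_lt]; constructor <;> linarith
      have e2 : |((z : ℂ) - ⟨s, t⟩).im| < ε / 2 := by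
        rw [Complex.sub_im, abs_lt]; constructor <;> linarith
      linarith
    · rintro a b c d hab hbc hcd ⟨ε₁, hε₁, g₁, h₁⟩ ⟨ε₂, hε₂, g₂, h₂⟩
      refine ⟨min ε₁ ε₂, lt_min hε₁ hε₂, ?_⟩
      have m1 := min_le_left ε₁ ε₂
      have m2 := min_le_right ε₁ ε₂
      set ε := min ε₁ ε₂
      refine hglue (hRo a c (t - ε) (t + ε)) (hRo b d (t - ε) (t + ε))
        (a := b) (b := c) (c := t - ε) (d := t + ε) ?_ ?_
        ⟨g₁, h₁.mono fun z hz => ⟨hz.1, ?_, ?_⟩⟩ ⟨g₂, h₂.mono fun z hz => ⟨hz.1, ?_, ?_⟩⟩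
      · ext z
        exact ⟨fun h => ⟨⟨h.2.1.1, h.1.1.2⟩, h.1.2⟩, fun h => ⟨⟨⟨hab.trans_lt h.1.1, h.1.2⟩, h.2⟩,
          ⟨⟨h.1.1, h.1.2.trans_le hcd⟩, h.2⟩⟩⟩
      · intro z hz
        by_cases hzc : (z : ℂ).re < c
        · exact Or.inl ⟨⟨hz.1.1, hzc⟩, hz.2⟩
        · exact Or.inr ⟨⟨hbc.trans_le (not_lt.1 hzc), hz.1.2⟩, hz.2⟩
      all_goals
        have := hz.2.1
        have := hz.2.2
        linarith
  have hall : ∀ A B C D : ℝ, ∃ g, F.Flat g (R A B C D) := by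
    intro A B C D
    refine interval_induction (P := fun c d => ∃ g, F.Flat g (R A B c d)) ?_ ?_ ?_ C D
    · rintro a b a' b' ha hb ⟨g, hg⟩
      exact ⟨g, hg.mono fun z hz => ⟨hz.1, ha.trans_lt hz.2.1, hz.2.2.trans_le hb⟩⟩
    · exact fun t => hrow t A B
    · intro a b c d hab hbc hcd h₁ h₂
      refine hglue (hRo A B a c) (hRo A B b d) (a := A) (b := B) (c := b) (d := c) ?_ ?_ h₁ h₂
      · ext z
        exact ⟨fun h => ⟨h.1.1, h.2.2.1, h.1.2.2⟩, fun h => ⟨⟨h.1, hab.trans_lt h.2.1, h.2.2⟩,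
          ⟨h.1, h.2.1, h.2.2.trans_le hcd⟩⟩⟩
      · intro z hz
        by_cases hzc : (z : ℂ).im < c
        · exact Or.inl ⟨hz.1, hz.2.1, hzc⟩
        · exact Or.inr ⟨hz.1, hbc.trans_le (not_lt.1 hzc), hz.2.2⟩
  obtain ⟨K, hK⟩ := (isCompact_range (f := fun t => ((η t : (Sᶜ : Set ℂ)) : ℂ))
    (by fun_prop)).isBounded.exists_norm_le
  obtain ⟨g, hg⟩ := hall (-K - 1) (K + 1) (-K - 1) (K + 1)
  refine hg.eq_one_of_loop η fun t => ?_
  have h1 := hK _ ⟨t, rfl⟩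
  have h2 := abs_le.1 ((Complex.abs_re_le_norm _).trans h1)
  have h3 := abs_le.1 ((Complex.abs_im_le_norm _).trans h1)
  refine ⟨⟨?_, ?_⟩, ?_, ?_⟩ <;> linarith [h2.1, h2.2, h3.1, h3.2]

end PuncturedPlane

/-! ### From lines to the complement of the arrangement -/

section Arrangement

open unitInterval Topology

variable {V : Type*} [NormedAddCommGroup V] [NormedSpace ℂ V] {W : Subgroup (V ≃ₗ[ℂ] V)}

theorem isCoatom_of_mem_reflectingHyperplanes {H : Submodule ℂ V}
    (hH : H ∈ reflectingHyperplanes W) : IsCoatom H := by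
  obtain ⟨s, -, hs, rfl⟩ := hH
  exact hs

theorem finite_reflectingHyperplanes [Finite W] : (reflectingHyperplanes W).Finite := by
  refine (Set.finite_range fun w : W =>
    LinearMap.fixedSubmodule ((w : V ≃ₗ[ℂ] V) : V →ₗ[ℂ] V)).subset ?_
  rintro H ⟨s, hs, -, rfl⟩
  exact ⟨⟨s, hs⟩, rfl⟩

theorem exists_eq_add_smul {H : Submodule ℂ V} (hH : IsCoatom H) {v : V} (hv : v ∉ H) (d : V) :
    ∃ d₀ ∈ H, ∃ c : ℂ, d = d₀ + c • v := by
  obtain ⟨φ, -, rfl⟩ := exists_linearForm_of_isCoatom hH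
  have hv' : φ v ≠ 0 := hv
  exact ⟨d - (φ d / φ v) • v, by simp [hv'], φ d / φ v, by simp⟩

/-- A complex line through a point of the complement meets the hyperplanes in finitely many
points. -/
theorem finite_line_notMem [Finite W] {a : V} (ha : a ∈ complement W) (c : V) :
    {z : ℂ | a + z • (c - a) ∉ complement W}.Finite := by
  have : {z : ℂ | a + z • (c - a) ∉ complement W} ⊆
      ⋃ H ∈ reflectingHyperplanes W, {z : ℂ | a + z • (c - a) ∈ H} := by
    intro z hz
    simp only [complement, Set.mem_ofPred_eq, not_forall, not_not] at hz
    obtain ⟨H, hH, hz⟩ := hz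
    exact Set.mem_biUnion hH hz
  refine (finite_reflectingHyperplanes.biUnion fun H hH => Set.Subsingleton.finite ?_).subset this
  intro z hz z' hz'
  by_contra hne
  have h1 : (z - z') • (c - a) ∈ H := by
    have := H.sub_mem hz hz'
    rwa [add_sub_add_left_eq_sub, ← sub_smul] at this
  have h2 : c - a ∈ H := (H.smul_mem_iff (sub_ne_zero.2 hne)).1 h1
  refine ha H hH ?_
  have := H.sub_mem hz (H.smul_mem z h2)
  simpa using this

/-- The complex line through the two points has only finitely many punctures, and a plane without
countably many points is path connected. -/
theorem joinedIn_line_complement [Finite W] {a c : V} (ha : a ∈ complement W)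
    (hc : c ∈ complement W) :
    ∃ ζ : Path (0 : ℂ) 1, ∀ t, a + ζ t • (c - a) ∈ complement W := by
  have hS := (finite_line_notMem ha c).countable
  obtain ⟨ζ, hζ⟩ := (hS.isPathConnected_compl_of_one_lt_rank
    (by rw [Complex.rank_real_complex]; norm_num)).joinedIn 0 (by simpa using ha) 1
      (by simpa using hc)
  exact ⟨ζ, fun t => by simpa using hζ t⟩

/-- A path in a complex line, as a path in the complement. -/
def linePath {a c : V} {z w : ℂ} (ζ : Path z w) (h : ∀ t, a + ζ t • (c - a) ∈ complement W) :
    Path (⟨a + z • (c - a), by simpa using h 0⟩ : complement W)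
      ⟨a + w • (c - a), by simpa using h 1⟩ where
  toFun t := ⟨a + ζ t • (c - a), h t⟩
  source' := by simp
  target' := by simp

@[simp] theorem coe_linePath {a c : V} {z w : ℂ} (ζ : Path z w)
    (h : ∀ t, a + ζ t • (c - a) ∈ complement W) (t : I) :
    (linePath ζ h t : V) = a + ζ t • (c - a) := rfl

theorem joined_complement [Finite W] (a c : complement W) : Joined a c := by
  obtain ⟨ζ, hζ⟩ := joinedIn_line_complement a.2 c.2
  exact ⟨(linePath ζ hζ).cast (Subtype.ext (by simp)) (Subtype.ext (by simp))⟩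

variable [FiniteDimensional ℂ V]

theorem isOpen_complement [Finite W] : IsOpen (complement W) := by
  have : complement W = ⋂ H ∈ reflectingHyperplanes W, (H : Set V)ᶜ := by
    ext v
    simp [complement]
  rw [this]
  exact finite_reflectingHyperplanes.isOpen_biInter fun H _ =>
    (Submodule.closed_of_finiteDimensional H).isOpen_compl

theorem dense_forall_apply_ne_zero {T : Set (V →ₗ[ℂ] ℂ)} (hT : T.Finite) (h0 : ∀ φ ∈ T, φ ≠ 0) :
    Dense {v : V | ∀ φ ∈ T, φ v ≠ 0} := by
  have : {v : V | ∀ φ ∈ T, φ v ≠ 0} = ⋂ φ ∈ T, (LinearMap.ker φ : Set V)ᶜ := by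
    ext v
    simp
  have hcomplete := FiniteDimensional.complete ℂ V
  rw [this]
  refine dense_biInter_of_isOpen (fun φ _ => ?_) hT.countable fun φ hφ => ?_
  · exact (Submodule.closed_of_finiteDimensional _).isOpen_compl
  · rw [← interior_eq_empty_iff_dense_compl]
    by_contra hne
    have := Submodule.eq_top_of_nonempty_interior' _ (Set.nonempty_iff_ne_empty.2 hne)
    exact h0 φ hφ (LinearMap.ker_eq_top.1 this)

/-- The lines through `a` that meet no intersection of two hyperplanes are dense. -/
theorem dense_generic_line [Finite W] {a : V} (ha : a ∈ complement W) :
    Dense {c : V | ∀ H ∈ reflectingHyperplanes W, ∀ H' ∈ reflectingHyperplanes W, ∀ z : ℂ,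
      a + z • (c - a) ∈ H → a + z • (c - a) ∈ H' → H = H'} := by
  choose! φ hφ0 hφ using fun H : Submodule ℂ V => exists_linearForm_of_isCoatom (H := H)
  -- For `H ≠ H'` this nonzero form kills `a` and `H ⊓ H'`, so it kills `c` whenever the line
  -- through `a` and `c` meets `H ⊓ H'`.
  let T : Set (V →ₗ[ℂ] ℂ) := (fun p : Submodule ℂ V × Submodule ℂ V =>
    φ p.2 a • φ p.1 - φ p.1 a • φ p.2) '' {p | p.1 ∈ reflectingHyperplanes W ∧
      p.2 ∈ reflectingHyperplanes W ∧ p.1 ≠ p.2}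
  have hker : ∀ H ∈ reflectingHyperplanes W, ∀ v, φ H v = 0 ↔ v ∈ H := fun H hH v => by
    conv_rhs => rw [← hφ H (isCoatom_of_mem_reflectingHyperplanes hH)]
    rfl
  have hT : T.Finite := by
    refine Set.Finite.image _ (((finite_reflectingHyperplanes (W := W)).prod
      (finite_reflectingHyperplanes (W := W))).subset ?_)
    exact fun p hp => ⟨hp.1, hp.2.1⟩
  refine (dense_forall_apply_ne_zero hT ?_).mono ?_
  · rintro _ ⟨⟨H, H'⟩, ⟨hH, hH', hne⟩, rfl⟩ h0
    refine hne ?_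
    have hle : H ≤ H' := by
      intro v hv
      have h1 := LinearMap.congr_fun h0 v
      simp only [LinearMap.sub_apply, LinearMap.smul_apply, smul_eq_mul, LinearMap.zero_apply,
        (hker H hH v).2 hv, mul_zero, zero_sub, neg_eq_zero] at h1
      exact (hker H' hH' v).1 ((mul_eq_zero.1 h1).resolve_left
        fun h2 => ha H hH ((hker H hH a).1 h2))
    rcases (isCoatom_of_mem_reflectingHyperplanes hH).le_iff.1 hle with h | h
    · exact absurd h (isCoatom_of_mem_reflectingHyperplanes hH').1
    · exact h.symm
  · intro c hc H hH H' hH' z hz hz'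
    by_contra hne
    refine hc _ ⟨(H, H'), ⟨hH, hH', hne⟩, rfl⟩ ?_
    have hz0 : z ≠ 0 := by
      rintro rfl
      exact ha H hH (by simpa using hz)
    have h1 := (hker H hH _).2 hz
    have h2 := (hker H' hH' _).2 hz'
    rw [map_add, map_smul, map_sub, smul_eq_mul] at h1 h2
    refine (mul_eq_zero.1 (?_ : z * _ = 0)).resolve_left hz0
    simp only [LinearMap.sub_apply, LinearMap.smul_apply, smul_eq_mul]
    linear_combination φ H' a * h1 - φ H a * h2

theorem eventually_line_mem [Finite W] {a c : V} {z w : ℂ} (ζ : Path z w)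
    (h : ∀ t, a + ζ t • (c - a) ∈ complement W) :
    ∃ δ > 0, ∀ c' ∈ Metric.ball c δ, ∀ t, a + ζ t • (c' - a) ∈ complement W := by
  have := (isCompact_univ (X := I)).eventually_forall_of_forall_eventually (x₀ := c)
    (P := fun c' t => a + ζ t • (c' - a) ∈ complement W) (fun t _ => by
      have hcont : Continuous fun p : V × I => a + ζ p.2 • (p.1 - a) := by fun_prop
      exact hcont.continuousAt (isOpen_complement.mem_nhds (h t)))
  obtain ⟨δ, hδ, hb⟩ := Metric.eventually_nhds_iff_ball.1 this
  exact ⟨δ, hδ, fun c' hc' t => hb c' hc' t trivial⟩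

variable {Q : Type*} [Group Q]

namespace PathHom

/-- `F` is trivial on the circles `t ↦ h + exp(2πit) v` around the hyperplanes, where `v` is a
multiple of a chosen vector that is transversal to the hyperplane. -/
def TrivialOnCircles (F : PathHom (complement W) Q) (vec : Submodule ℂ V → V) : Prop :=
  ∀ H ∈ reflectingHyperplanes W, ∀ h ∈ H, ∀ μ : ℂ, μ ≠ 0 →
    (∀ z : ℂ, ‖z‖ ≤ 1 → ∀ H' ∈ reflectingHyperplanes W, h + z • μ • vec H ∈ H' → H' = H) →
    ∀ (y : complement W) (c : Path y y),
      (∀ t : I, (c t : V) = h + Complex.exp (2 * Real.pi * Complex.I * ((t : ℝ) : ℂ)) • μ • vec H) →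
      F c = 1

variable {F : PathHom (complement W) Q} {vec : Submodule ℂ V → V}

/-- `F` is trivial on small circles in lines transversal to a hyperplane. -/
theorem TrivialOnCircles.exists_small [Finite W] (hF : F.TrivialOnCircles vec)
    (hvec : ∀ H ∈ reflectingHyperplanes W, vec H ∉ H) {H : Submodule ℂ V}
    (hH : H ∈ reflectingHyperplanes W) {h : V} (hh : h ∈ H)
    (hgen : ∀ H' ∈ reflectingHyperplanes W, h ∈ H' → H' = H) {d : V} (hd : d ∉ H) :
    ∃ r : ℝ, ∀ u : ℂ, u.re < r → ∀ (y : complement W) (c : Path y y),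
      (∀ t : I, (c t : V) =
        h + Complex.exp (u + 2 * Real.pi * Complex.I * ((t : ℝ) : ℂ)) • d) → F c = 1 := by
  obtain ⟨d₀, hd₀, m, rfl⟩ := exists_eq_add_smul (isCoatom_of_mem_reflectingHyperplanes hH)
    (hvec H hH) d
  have hm : m ≠ 0 := by
    rintro rfl
    exact hd (by simpa using hd₀)
  obtain ⟨ρ, hρ, hball⟩ : ∃ ρ > 0, ∀ v ∈ Metric.ball h ρ, ∀ H' ∈ reflectingHyperplanes W,
      v ∈ H' → H' = H := by
    have : ∀ᶠ v in 𝓝 h, ∀ H' ∈ reflectingHyperplanes W, v ∈ H' → H' = H := by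
      rw [Filter.eventually_all_finite finite_reflectingHyperplanes]
      intro H' hH'
      by_cases heq : H' = H
      · exact Filter.Eventually.of_forall fun v _ => heq
      · have : h ∉ H' := fun h' => heq (hgen H' hH' h')
        filter_upwards [(Submodule.closed_of_finiteDimensional H').isOpen_compl.mem_nhds this]
          with v hv hv'
        exact absurd hv' hv
    obtain ⟨ρ, hρ, hb⟩ := Metric.eventually_nhds_iff_ball.1 this
    exact ⟨ρ, hρ, hb⟩
  let B : ℝ := ‖d₀‖ + ‖m • vec H‖ + 1
  have hB : 0 < B := by positivity
  -- With `|exp u| < ρ / B`, every circle of the homotopy below stays in the ball around `h` that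
  -- meets no hyperplane but `H`.
  refine ⟨Real.log (ρ / B), fun u hu y c hc => ?_⟩
  have hu' : Real.exp u.re * B < ρ := by
    rw [← lt_div_iff₀ hB]
    exact (Real.lt_log_iff_exp_lt (by positivity)).1 hu
  have hin : ∀ (e : ℂ) (s : ℝ), ‖e‖ ≤ 1 → 0 ≤ s → s ≤ 1 →
      h + (e * Complex.exp u) • (s • d₀ + m • vec H) ∈ Metric.ball h ρ := by
    intro e s he hs0 hs1
    rw [mem_ball_iff_norm, add_sub_cancel_left, norm_smul, norm_mul, Complex.norm_exp]
    refine lt_of_le_of_lt ?_ hu'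
    refine mul_le_mul (mul_le_of_le_one_left (Real.exp_pos _).le he) ?_ (norm_nonneg _)
      (Real.exp_pos _).le
    refine (norm_add_le _ _).trans ?_
    have : ‖s • d₀‖ ≤ ‖d₀‖ := by
      rw [norm_smul, Real.norm_of_nonneg hs0]
      exact mul_le_of_le_one_left (norm_nonneg _) hs1
    linarith
  have hmem : ∀ (e : ℂ) (s : ℝ), ‖e‖ = 1 → 0 ≤ s → s ≤ 1 →
      h + (e * Complex.exp u) • (s • d₀ + m • vec H) ∈ complement W := by
    intro e s he hs0 hs1 H' hH' hv
    obtain rfl := hball _ (hin e s he.le hs0 hs1) H' hH' hv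
    have he0 : e ≠ 0 := by
      rintro rfl
      simp at he
    have h1 := (H'.add_mem_iff_right hh).1 hv
    rw [H'.smul_mem_iff (mul_ne_zero he0 (Complex.exp_ne_zero u)),
      H'.add_mem_iff_right (H'.smul_of_tower_mem s hd₀), H'.smul_mem_iff hm] at h1
    exact hvec H' hH' h1
  let e : I → ℂ := fun t => Complex.exp (2 * Real.pi * Complex.I * ((t : ℝ) : ℂ))
  have he : ∀ t, ‖e t‖ = 1 := fun t => by simp [e, Complex.norm_exp]
  have he0 : e 0 = 1 := by simp [e]
  have he1 : e 1 = 1 := by simp [e]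
  have hecont : Continuous e := by fun_prop
  -- The component `d₀` along `H` is shrunk to zero, which moves the circle into the chosen
  -- transversal direction. The free homotopy only conjugates the value of `F`.
  let K : C(I × I, complement W) :=
    ⟨fun p => ⟨h + (e p.1 * Complex.exp u) • ((p.2 : ℝ) • d₀ + m • vec H),
      hmem _ _ (he _) p.2.2.1 p.2.2.2⟩, by fun_prop⟩
  let p₀ : Path (K (0, 0)) (K (0, 0)) := ⟨⟨fun t => K (t, 0), by fun_prop⟩, rfl,
    Subtype.ext (by simp [K, he0, he1])⟩
  let l : Path (K (0, 0)) (K (0, 1)) := ⟨⟨fun t => K (0, t), by fun_prop⟩, rfl, rfl⟩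
  have hcK : ∀ t, c t = K (t, 1) := fun t => by
    apply Subtype.ext
    rw [hc]
    simp [K, e, Complex.exp_add, mul_comm]
  have hK01 : ∀ t, K (0, t) = K (1, t) := fun t => Subtype.ext <| by
    change h + (e 0 * Complex.exp u) • _ = h + (e 1 * Complex.exp u) • _
    rw [he0, he1]
  have hy : y = K (0, 1) := by rw [← hcK, c.source]
  have hsq := F.square K p₀ c (l.cast rfl hy) (l.cast rfl hy) (fun t => rfl) hcK (fun t => rfl)
    hK01
  have h0 : F p₀ = 1 := by
    refine hF H hH h hh (Complex.exp u * m) (mul_ne_zero (Complex.exp_ne_zero _) hm) ?_ _ p₀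
      fun t => ?_
    · intro z hz H' hH' hv
      refine hball _ ?_ H' hH' hv
      have := hin z 0 hz le_rfl zero_le_one
      simpa [smul_smul, mul_assoc] using this
    · simp [p₀, K, e, smul_smul, mul_assoc]
  rw [h0, one_mul] at hsq
  exact left_eq_mul.1 hsq

/-- On a generic line every puncture lies on exactly one hyperplane, transversally, so small circles
around it are trivial and the result for the punctured plane applies. -/
theorem linePath_eq_one_of_generic [Finite W] (hF : F.TrivialOnCircles vec)
    (hvec : ∀ H ∈ reflectingHyperplanes W, vec H ∉ H) {a c : V} (ha : a ∈ complement W)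
    (hc : ∀ H ∈ reflectingHyperplanes W, ∀ H' ∈ reflectingHyperplanes W, ∀ z : ℂ,
      a + z • (c - a) ∈ H → a + z • (c - a) ∈ H' → H = H') {z : ℂ} (ζ : Path z z)
    (h : ∀ t, a + ζ t • (c - a) ∈ complement W) : F (linePath ζ h) = 1 := by
  set S := {z : ℂ | a + z • (c - a) ∉ complement W} with hS
  have hSc : ∀ z : (Sᶜ : Set ℂ), a + (z : ℂ) • (c - a) ∈ complement W := fun z =>
    not_not.1 z.2
  let f : C((Sᶜ : Set ℂ), complement W) := ⟨fun z => ⟨a + (z : ℂ) • (c - a), hSc z⟩, by fun_prop⟩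
  have hζ : ∀ t, ζ t ∈ Sᶜ := fun t => by simpa [hS] using h t
  have hz : z ∈ Sᶜ := by simpa using hζ 0
  let ζ' : Path (⟨z, hz⟩ : (Sᶜ : Set ℂ)) ⟨z, hz⟩ :=
    ⟨⟨fun t => ⟨ζ t, hζ t⟩, by fun_prop⟩, by simp, by simp⟩
  have key := (F.comap f).eq_one_of_puncturedPlane (finite_line_notMem ha c) (fun q hq => ?_) ζ'
  · exact (F.eq_of_forall_eq fun t => rfl).trans key
  · simp only [Set.mem_ofPred_eq, complement, not_forall, not_not] at hq
    obtain ⟨H, hH, hqH⟩ := hq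
    have hd : c - a ∉ H := fun hd => ha H hH ((H.add_mem_iff_left (H.smul_mem q hd)).1 hqH)
    obtain ⟨r, hr⟩ := hF.exists_small hvec hH hqH (fun H' hH' hq' => hc H' hH' H hH q hq' hqH) hd
    refine ⟨r, fun u hu y p hp => hr u hu (f y) (p.map f.continuous) fun t => ?_⟩
    change a + ((p t : (Sᶜ : Set ℂ)) : ℂ) • (c - a) = _
    rw [hp, add_smul, add_assoc]

/-- By compactness the loop stays in the complement when the line is tilted slightly around `a` to a
generic one. Its base point `a` does not move, so the value of `F` is unchanged. -/
theorem linePath_eq_one [Finite W] (hF : F.TrivialOnCircles vec)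
    (hvec : ∀ H ∈ reflectingHyperplanes W, vec H ∉ H) {a c : V} (ha : a ∈ complement W)
    (ζ : Path (0 : ℂ) 0) (h : ∀ t, a + ζ t • (c - a) ∈ complement W) : F (linePath ζ h) = 1 := by
  obtain ⟨δ, hδ, hb⟩ := eventually_line_mem ζ h
  obtain ⟨c', hc', hgen⟩ := (dense_generic_line ha).exists_mem_open Metric.isOpen_ball
    ⟨c, Metric.mem_ball_self hδ⟩
  have hseg : ∀ s : I, c + (s : ℝ) • (c' - c) ∈ Metric.ball c δ := fun s => by
    refine (convex_ball c δ).segment_subset (Metric.mem_ball_self hδ) hgen ?_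
    rw [segment_eq_image']
    exact ⟨s, s.2, rfl⟩
  let K : C(I × I, complement W) :=
    ⟨fun p => ⟨a + ζ p.1 • (c + (p.2 : ℝ) • (c' - c) - a), hb _ (hseg p.2) p.1⟩, by fun_prop⟩
  have hzero : ∀ b : V, a + (0 : ℂ) • (b - a) ∈ complement W := fun b => by simpa using ha
  let l : Path (⟨a + (0 : ℂ) • (c - a), hzero c⟩ : complement W) ⟨a + (0 : ℂ) • (c' - a), hzero c'⟩ :=
    ⟨⟨fun t => ⟨a, ha⟩, by fun_prop⟩, by simp, by simp⟩
  have hl : F l = 1 := F.eq_one_of_forall_eq ⟨a, ha⟩ fun t => rfl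
  have hsq := F.square K (linePath ζ h) (linePath ζ (hb c' hgen)) l l
    (fun t => Subtype.ext (by simp [K])) (fun t => Subtype.ext (by simp [K]))
    (fun t => Subtype.ext (by simp [K, l])) (fun t => Subtype.ext (by simp [K, l]))
  rw [hl, mul_one, one_mul, linePath_eq_one_of_generic hF hvec ha hc'] at hsq
  exact hsq

/-- A functor on the fundamental groupoid of the complement that is trivial on circles around the
hyperplanes is trivial on all loops. -/
theorem TrivialOnCircles.eq_one_of_loop [Finite W] (hF : F.TrivialOnCircles vec)
    (hvec : ∀ H ∈ reflectingHyperplanes W, vec H ∉ H) {a : complement W} (η : Path a a) :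
    F η = 1 := by
  choose ζ hζ using fun c : complement W => joinedIn_line_complement a.2 c.2
  -- Two paths from `a` to `c` in their common line form a loop in that line, so `F` on such a path
  -- depends on `c` alone. This defines a global primitive of `F`.
  have hwd : ∀ (c : complement W) (ζ' : Path (0 : ℂ) 1)
      (h : ∀ t, (a : V) + ζ' t • ((c : V) - a) ∈ complement W),
      F (linePath (ζ c) (hζ c)) = F (linePath ζ' h) := by
    intro c ζ' h
    have h1 : ∀ t, (a : V) + ((ζ c).trans ζ'.symm) t • ((c : V) - a) ∈ complement W := by
      intro t
      rw [Path.trans_apply]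
      split_ifs
      · exact hζ c _
      · exact h _
    have h2 := linePath_eq_one hF hvec a.2 _ h1
    have h3 : F (linePath ((ζ c).trans ζ'.symm) h1) =
        F ((linePath (ζ c) (hζ c)).trans (linePath ζ' h).symm) := by
      refine F.eq_of_forall_eq fun t => Subtype.ext ?_
      rw [coe_linePath, Path.trans_apply, Path.trans_apply]
      split_ifs <;> rfl
    rw [h3, F.trans, F.symm, mul_inv_eq_one] at h2
    exact h2
  -- For `c'` near `c` the same parameter path `ζ c` serves, and moving `c` to `c'` along `p` sweeps
  -- out a square whose side at `a` is constant.
  have hflat : F.Flat (fun c => F (linePath (ζ c) (hζ c))) Set.univ := by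
    intro c _
    obtain ⟨δ, hδ, hb⟩ := eventually_line_mem (ζ c) (hζ c)
    refine ⟨{z | (z : V) ∈ Metric.ball (c : V) δ},
      (Metric.isOpen_ball.preimage continuous_subtype_val).mem_nhds (Metric.mem_ball_self hδ),
      fun c' p hp => ?_⟩
    let K : C(I × I, complement W) :=
      ⟨fun s => ⟨a + ζ c s.1 • ((p s.2 : V) - a), hb _ (hp s.2) s.1⟩, by fun_prop⟩
    have hc' : (c' : V) ∈ Metric.ball (c : V) δ := by
      have := hp 1
      rwa [p.target] at this
    let p₁ := linePath (ζ c) (hb c' hc')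
    have hzero : ∀ b : V, (a : V) + (0 : ℂ) • (b - a) ∈ complement W := fun b => by
      simp
    let l : Path (⟨a + (0 : ℂ) • ((c : V) - a), hzero c⟩ : complement W)
        ⟨a + (0 : ℂ) • ((c' : V) - a), hzero c'⟩ :=
      ⟨⟨fun t => a, by fun_prop⟩, Subtype.ext (by simp), Subtype.ext (by simp)⟩
    have hl : F l = 1 := F.eq_one_of_forall_eq a fun t => rfl
    let p' : Path (⟨a + (1 : ℂ) • ((c : V) - a), by simp⟩ : complement W)
        ⟨a + (1 : ℂ) • ((c' : V) - a), by simp⟩ :=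
      p.cast (Subtype.ext (by simp)) (Subtype.ext (by simp))
    have hp' : F p' = F p := F.eq_of_forall_eq fun t => rfl
    have hsq := F.square K (linePath (ζ c) (hζ c)) p₁ l p'
      (fun t => Subtype.ext (by simp [K])) (fun t => Subtype.ext (by simp [K, p₁]))
      (fun t => Subtype.ext (by simp [K, l])) (fun t => Subtype.ext (by simp [K, p']))
    rw [hl, one_mul, hp'] at hsq
    change F (linePath (ζ c') (hζ c')) = F (linePath (ζ c) (hζ c)) * F p
    rw [hwd c' (ζ c) (hb c' hc')]
    exact hsq.symm
  exact hflat.eq_one_of_loop η fun t => trivial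

end PathHom
end Arrangement

/-! ### Distinguished pseudo-reflections -/

section Distinguished

variable {V : Type*} [AddCommGroup V] [Module ℂ V] {W : Subgroup (V ≃ₗ[ℂ] V)}

theorem finite_fixer [Finite W] (X : Submodule ℂ V) : Finite (fixer W X) :=
  Finite.of_injective (Subgroup.inclusion (fixer_le W X)) (Subgroup.inclusion_injective _)

/-- The pointwise stabiliser of a reflecting hyperplane contains an element with eigenvalue
`exp(2πi/e)`, where `e` is its order. -/
theorem exists_distinguished [Finite W] {H : Submodule ℂ V} (hH : H ∈ reflectingHyperplanes W) :
    ∃ s ∈ fixer W H, ∃ v ∉ H,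
      s v = Complex.exp (2 * Real.pi * Complex.I / hyperplaneOrder W H) • v := by
  obtain ⟨s₀, hs₀, hs₀r, hs₀H⟩ := hH
  have hHc : IsCoatom H := hs₀H ▸ hs₀r
  obtain ⟨φ, hφ0, hφ⟩ := exists_linearForm_of_isCoatom hHc
  have hmem : ∀ v, φ v = 0 ↔ v ∈ H := fun v => by rw [← hφ]; rfl
  have : Finite (fixer W H) := finite_fixer H
  have hχ : ∀ w : fixer W H, ∃ c : ℂ, ∀ v, φ ((w : V ≃ₗ[ℂ] V) v) = c * φ v := by
    intro w
    obtain ⟨c, hc⟩ := exists_eq_smul_of_ker_le (φ := φ)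
      (ψ := φ ∘ₗ ((w : V ≃ₗ[ℂ] V) : V →ₗ[ℂ] V)) (fun v hv => by
        have hv' : v ∈ H := (hmem v).1 hv
        change φ ((w : V ≃ₗ[ℂ] V) v) = 0
        rw [w.2.2 v hv']
        exact hv)
    exact ⟨c, fun v => LinearMap.congr_fun hc v⟩
  choose χ hχ using hχ
  obtain ⟨u, hu⟩ : ∃ u, φ u ≠ 0 := by
    by_contra! h
    exact hφ0 (LinearMap.ext h)
  let χ' : fixer W H →* ℂ :=
    { toFun := χ
      map_one' := mul_right_cancel₀ hu (by rw [← hχ, one_mul]; rfl)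
      map_mul' := fun a b => mul_right_cancel₀ hu (by
        rw [← hχ, mul_assoc, ← hχ, ← hχ]
        rfl) }
  -- The character `χ` gives the action on the quotient by `H`. An element of its kernel satisfies
  -- `w ^ n v = v + n (w v - v)`, so finite order forces it to be the identity.
  have hinj : Function.Injective χ' := by
    rw [injective_iff_map_eq_one]
    intro w hw
    have hw1 : χ w = 1 := hw
    have hN : ∀ v, (w : V ≃ₗ[ℂ] V) v - v ∈ H := fun v => by
      rw [← hmem, map_sub, hχ, hw1, one_mul, sub_self]
    have hpow : ∀ (n : ℕ) v, ((w ^ n : fixer W H) : V ≃ₗ[ℂ] V) v =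
        v + (n : ℂ) • ((w : V ≃ₗ[ℂ] V) v - v) := by
      intro n v
      induction n with
      | zero => simp
      | succ n ih =>
        have : ((w ^ (n + 1) : fixer W H) : V ≃ₗ[ℂ] V) v =
            (w : V ≃ₗ[ℂ] V) (((w ^ n : fixer W H) : V ≃ₗ[ℂ] V) v) := by
          rw [pow_succ']
          rfl
        rw [this, ih, map_add, map_smul, w.2.2 _ (hN v)]
        push_cast
        rw [add_smul, one_smul]
        abel
    apply Subtype.ext
    ext v
    have h1 := hpow (Nat.card (fixer W H)) v
    rw [pow_card_eq_one'] at h1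
    have h2 : ((Nat.card (fixer W H) : ℕ) : ℂ) • ((w : V ≃ₗ[ℂ] V) v - v) = 0 :=
      left_eq_add.1 h1
    rw [smul_eq_zero] at h2
    exact sub_eq_zero.1 (h2.resolve_left (by exact_mod_cast Nat.card_pos.ne'))
  set e := Nat.card (fixer W H) with he
  have he0 : e ≠ 0 := Nat.card_pos.ne'
  have hζ : IsPrimitiveRoot (Complex.exp (2 * Real.pi * Complex.I / e)) e :=
    Complex.isPrimitiveRoot_exp e he0
  obtain ⟨s, hs⟩ : ∃ s, χ' s = Complex.exp (2 * Real.pi * Complex.I / e) := by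
    classical
    let _ := Fintype.ofFinite (fixer W H)
    -- An injective character of a group of order `e` takes all `e`-th roots of unity as values, by
    -- counting.
    have hsub : Finset.univ.image χ' ⊆ Polynomial.nthRootsFinset e (1 : ℂ) := by
      intro z hz
      obtain ⟨w, -, rfl⟩ := Finset.mem_image.1 hz
      rw [Polynomial.mem_nthRootsFinset (Nat.pos_of_ne_zero he0), ← map_pow, he, pow_card_eq_one',
        map_one]
    have heq := Finset.eq_of_subset_of_card_le hsub (by
      rw [hζ.card_nthRootsFinset, Finset.card_image_of_injective _ hinj, Finset.card_univ, he,
        Nat.card_eq_fintype_card])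
    have hmem' : Complex.exp (2 * Real.pi * Complex.I / e) ∈ Finset.univ.image χ' := by
      rw [heq, Polynomial.mem_nthRootsFinset (Nat.pos_of_ne_zero he0)]
      exact hζ.pow_eq_one
    obtain ⟨s, -, hs⟩ := Finset.mem_image.1 hmem'
    exact ⟨s, hs⟩
  have hζ1 : Complex.exp (2 * Real.pi * Complex.I / e) ≠ 1 := by
    refine hζ.ne_one ?_
    rw [he, Finite.one_lt_card_iff_nontrivial]
    refine ⟨⟨⟨s₀, hs₀, fun v hv => ?_⟩, 1, fun h => ?_⟩⟩
    · rw [← hs₀H] at hv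
      exact LinearMap.mem_fixedSubmodule_iff.1 hv
    · have h1 : s₀ = 1 := congrArg Subtype.val h
      refine hs₀r.1 (eq_top_iff.2 fun v _ => ?_)
      rw [LinearMap.mem_fixedSubmodule_iff, h1]
      rfl
  -- Since `s u - χ(s) u` lies in `H` and is fixed by `s`, the vector `s u - u` is an eigenvector
  -- for `χ(s)`.
  refine ⟨s, s.2, (s : V ≃ₗ[ℂ] V) u - u, fun h => ?_, ?_⟩
  · rw [← hmem, map_sub, hχ] at h
    have h1 : (χ' s - 1) * φ u = 0 := by rw [sub_mul, one_mul]; exact h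
    rw [hs] at h1
    exact hu ((mul_eq_zero.1 h1).resolve_left (sub_ne_zero.2 hζ1))
  · have hk : (s : V ≃ₗ[ℂ] V) u - χ' s • u ∈ H := by
      rw [← hmem, map_sub, map_smul, smul_eq_mul, hχ]
      exact sub_self _
    have h1 := s.2.2 _ hk
    rw [map_sub, map_smul] at h1
    have hord : hyperplaneOrder W H = e := rfl
    rw [hord, ← hs, map_sub, smul_sub]
    rw [sub_eq_sub_iff_add_eq_add] at h1 ⊢
    rw [h1, add_comm]

theorem pow_hyperplaneOrder_eq_one {H : Submodule ℂ V} {s : V ≃ₗ[ℂ] V} (hs : s ∈ fixer W H) :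
    s ^ hyperplaneOrder W H = 1 := by
  have := pow_card_eq_one' (x := (⟨s, hs⟩ : fixer W H))
  exact congrArg Subtype.val this

end Distinguished

/-! ### The covering of the orbit space and its monodromy -/

section Covering

open unitInterval Topology

variable {V : Type*} [NormedAddCommGroup V] [NormedSpace ℂ V] {W : Subgroup (V ≃ₗ[ℂ] V)}

/-- If a finite group acts freely on the complement, the projection to the orbit space is a
covering. -/
theorem isQuotientCoveringMap_proj [FiniteDimensional ℂ V] [Finite W]
    (hfree : ∀ w ∈ W, ∀ x ∈ complement W, w x = x → w = 1) :
    IsQuotientCoveringMap (proj W) W := by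
  have : ContinuousConstSMul W (complement W) := ⟨continuous_smul_complement W⟩
  have : ProperSpace V := FiniteDimensional.proper ℂ V
  have : LocallyCompactSpace (complement W) := isOpen_complement.locallyCompactSpace
  have : IsCancelSMul W (complement W) := isCancelSMul_iff_eq_one_of_smul_eq.2 fun w x h =>
    Subtype.ext (hfree w w.2 x x.2 (congrArg Subtype.val h))
  exact isQuotientCoveringMap_quotientMk_of_properlyDiscontinuousSMul

/-- The homomorphism from the braid group to the opposite of the reflection group. -/
def braidToGroup (hp : IsQuotientCoveringMap (proj W) W) (x : complement W) :
    BraidGroup W x →* Wᵐᵒᵖ :=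
  hp.fundamentalGroupToMulOpposite ⟨x, rfl⟩

theorem braidToGroup_braidOfPath (hp : IsQuotientCoveringMap (proj W) W) (x : complement W) (w : W)
    (η : Path x (w • x)) : braidToGroup hp x (braidOfPath W w η) = MulOpposite.op w := by
  rw [braidToGroup, hp.fundamentalGroupToMulOpposite_apply_eq_Iff]
  have := hp.isCoveringMap.monodromy_eq_of_map_eq (x := proj W x) (y := proj W x)
    (γ := braidOfPath W w η) (ex := ⟨x, rfl⟩) (ey := ⟨w • x, proj_smul W w x⟩)
    (Path.Homotopic.Quotient.mk η) rfl
  rw [this]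
  rfl

/-- The lift of a loop starting at `x` ends in the fibre through `x`, which is a `W`-orbit. -/
theorem exists_eq_braidOfPath (hp : IsQuotientCoveringMap (proj W) W) (x : complement W)
    (b : BraidGroup W x) : ∃ (w : W) (η : Path x (w • x)), b = braidOfPath W w η := by
  let e : proj W ⁻¹' {proj W x} := ⟨x, rfl⟩
  obtain ⟨w, hw⟩ := hp.apply_eq_iff_mem_orbit.1 (hp.isCoveringMap.monodromy b e).2
  have hw' : w • x = hp.isCoveringMap.monodromy b e := hw
  obtain ⟨η, hη⟩ := Path.Homotopic.Quotient.mk_surjective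
    ((hp.isCoveringMap.liftPathQuotient b e).cast rfl hw')
  refine ⟨w, η, ?_⟩
  have h1 := hp.isCoveringMap.map_liftPathQuotient b e
  have h2 : (Path.Homotopic.Quotient.mk η).map ⟨proj W, continuous_proj W⟩ =
      Path.Homotopic.Quotient.cast b rfl (proj_smul W w x) := by
    rw [hη, Path.Homotopic.Quotient.map_cast, h1]
    exact Path.Homotopic.Quotient.cast_cast _ _ _ _ _
  change b = ((Path.Homotopic.Quotient.mk η).map ⟨proj W, continuous_proj W⟩).cast rfl
    (proj_smul W w x).symm
  rw [h2]
  exact ((Path.Homotopic.Quotient.cast_cast _ _ _ _ _).trans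
    (Path.Homotopic.Quotient.cast_rfl_rfl _)).symm

end Covering

/-! ### From the fundamental group to all paths -/

section OfHom

open CategoryTheory

variable {X Q : Type*} [TopologicalSpace X] [PathConnectedSpace X] [Group Q]

/-- A choice of homotopy classes of paths from the base point, constant at the base point. -/
def baseArrow (x y : X) : FundamentalGroupoid.mk x ⟶ FundamentalGroupoid.mk y :=
  inv (FundamentalGroupoid.fromPath
    (Path.Homotopic.Quotient.mk (PathConnectedSpace.somePath x x))) ≫
    FundamentalGroupoid.fromPath (Path.Homotopic.Quotient.mk (PathConnectedSpace.somePath x y))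

theorem baseArrow_self (x : X) : baseArrow x x = 𝟙 _ := IsIso.inv_hom_id _

/-- The extension to all paths of a homomorphism on the fundamental group of a path connected
space. -/
def PathHom.ofHom (x : X) (ψ : FundamentalGroup X x →* Q) : PathHom X Qᵐᵒᵖ where
  toFun {y z} p := MulOpposite.op (ψ (FundamentalGroup.fromArrow
    (baseArrow x y ≫ FundamentalGroupoid.fromPath (Path.Homotopic.Quotient.mk p) ≫
      inv (baseArrow x z))))
  homotopic {y z p q} h := by
    rw [Path.Homotopic.Quotient.eq.2 h]
  trans {a b c} p q := by
    -- The product in the fundamental group reverses concatenation, which is why the values lie in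
    -- the opposite group.
    rw [← MulOpposite.op_mul, ← map_mul]
    congr 2
    change _ = (_ ≫ _) ≫ (_ ≫ _)
    have : FundamentalGroupoid.fromPath (Path.Homotopic.Quotient.mk (p.trans q)) =
      FundamentalGroupoid.fromPath (Path.Homotopic.Quotient.mk p) ≫
        FundamentalGroupoid.fromPath (Path.Homotopic.Quotient.mk q) := rfl
    rw [this]
    simp only [Category.assoc, IsIso.inv_hom_id_assoc]

theorem PathHom.ofHom_loop (x : X) (ψ : FundamentalGroup X x →* Q) (p : Path x x) :
    PathHom.ofHom x ψ p =
      MulOpposite.op (ψ (FundamentalGroup.fromPath (Path.Homotopic.Quotient.mk p))) := by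
  change MulOpposite.op (ψ (baseArrow x x ≫ _ ≫ inv (baseArrow x x))) = _
  congr 2
  rw [baseArrow_self, IsIso.inv_id, Category.comp_id, Category.id_comp]

end OfHom

/-! ### Pure braids and powers of braided reflections -/

section Braids

open unitInterval

variable {V : Type*} [NormedAddCommGroup V] [NormedSpace ℂ V] {W : Subgroup (V ≃ₗ[ℂ] V)}

theorem pathConnectedSpace_orbitSpace [Finite W] (x : complement W) :
    PathConnectedSpace (OrbitSpace W) :=
  have : PathConnectedSpace (complement W) := ⟨⟨x⟩, joined_complement⟩
  (Quotient.mk_surjective (s := MulAction.orbitRel W (complement W))).pathConnectedSpace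
    (continuous_proj W)

/-- A homomorphism on the braid group extends to a function on all paths in the complement, which
is invariant under the reflection group. -/
theorem exists_pathHom [Finite W] {Q : Type*} [Group Q] {x : complement W}
    (ψ : BraidGroup W x →* Q) :
    ∃ F : PathHom (complement W) Qᵐᵒᵖ,
      (∀ (w : W) (η : Path x (w • x)), F η = MulOpposite.op (ψ (braidOfPath W w η))) ∧
      ∀ {y y' z z' : complement W} (w : W) (p : Path y z) (q : Path y' z'),
        (∀ t, q t = w • p t) → F q = F p := by
  have := pathConnectedSpace_orbitSpace x
  refine ⟨(PathHom.ofHom (proj W x) ψ).comap ⟨proj W, continuous_proj W⟩, fun w η => ?_,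
    fun w p q h => ?_⟩
  · rw [braidOfPath, ← PathHom.ofHom_loop]
    generalize PathHom.ofHom (proj W x) ψ = G
    exact G.eq_of_forall_eq fun t => rfl
  · generalize PathHom.ofHom (proj W x) ψ = G
    refine G.eq_of_forall_eq fun t => ?_
    change proj W (q t) = proj W (p t)
    rw [h, proj_smul]

/-- If `f (θ + 1) = s • f θ` for an `s` under which `F` is invariant, then `F` takes the `n`-th
power of its value on the arc from `f 0` to `f 1` on the arc from `f 0` to `f n`. -/
theorem PathHom.apply_arc {X Q : Type*} [TopologicalSpace X] [Group Q] (F : PathHom X Q)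
    (f : C(ℝ, X)) (s : X → X)
    (hF : ∀ {y y' z z' : X} (p : Path y z) (q : Path y' z'), (∀ t, q t = s (p t)) → F q = F p)
    (hf : ∀ θ, f (θ + 1) = s (f θ)) (n : ℕ) {y z y' z' : X} (α : Path y z) (c : Path y' z')
    (hα : ∀ t : I, α t = f t) (hc : ∀ t : I, c t = f (n * t)) : F c = F α ^ n := by
  let L : ∀ a b : ℝ, Path a b := fun a b =>
    { toFun := fun t => a + t * (b - a)
      continuous_toFun := by fun_prop
      source' := by simp
      target' := by simp }
  have hL : ∀ a b (t : I), L a b t = a + t * (b - a) := fun _ _ _ => rfl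
  have hone : ∀ k : ℕ, F.comap f (L k (k + 1)) = F α := by
    intro k
    induction k with
    | zero =>
      refine F.eq_of_forall_eq fun t => ?_
      rw [hα]
      change f (L _ _ t) = _
      rw [hL]
      simp
    | succ k ih =>
      rw [← ih]
      refine hF _ _ fun t => ?_
      change f (L _ _ t) = s (f (L _ _ t))
      rw [← hf, hL, hL]
      congr 1
      push_cast
      ring
  have hmain : ∀ k : ℕ, F.comap f (L 0 k) = F α ^ k := by
    intro k
    induction k with
    | zero =>
      rw [pow_zero]
      refine (F.comap f).eq_one_of_forall_eq 0 fun t => ?_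
      rw [hL]
      simp
    | succ k ih =>
      rw [pow_succ, ← ih, ← hone k, ← (F.comap f).trans]
      have : ((k + 1 : ℕ) : ℝ) = k + 1 := by push_cast; rfl
      rw [this]
      exact (F.comap f).eq_of_simplyConnected _ _
  rw [← hmain n]
  refine F.eq_of_forall_eq fun t => ?_
  rw [hc]
  change _ = f (L _ _ t)
  rw [hL]
  congr 1
  ring

/-- A homomorphism on the braid group that kills the appropriate powers of the braided reflections
kills the pure braids. -/
theorem eq_one_of_pure [FiniteDimensional ℂ V] [Finite W] {Q : Type*} [Group Q] {x : complement W}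
    (ψ : BraidGroup W x →* Q)
    (hψ : ∀ (H : reflectingHyperplanes W) (b : BraidGroup W x), IsBraidedReflection W x H b →
      ψ b ^ hyperplaneOrder W (H : Submodule ℂ V) = 1) (η : Path x ((1 : W) • x)) :
    ψ (braidOfPath W 1 η) = 1 := by
  classical
  obtain ⟨F, hF, hinv⟩ := exists_pathHom ψ
  rw [← MulOpposite.op_eq_one_iff, ← hF]
  have hdist : ∀ H : Submodule ℂ V, ∃ s v, H ∈ reflectingHyperplanes W → s ∈ fixer W H ∧ v ∉ H ∧
      s v = Complex.exp (2 * Real.pi * Complex.I / hyperplaneOrder W H) • v := fun H => by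
    by_cases hH : H ∈ reflectingHyperplanes W
    · obtain ⟨s, hs, v, hv, hsv⟩ := exists_distinguished hH
      exact ⟨s, v, fun _ => ⟨hs, hv, hsv⟩⟩
    · exact ⟨1, 0, fun h => absurd h hH⟩
  choose s vec hsv using hdist
  have hcirc : F.TrivialOnCircles vec := by
    intro H hH h hh μ hμ hdisc y c hc
    obtain ⟨hs, hv, hsv⟩ := hsv H hH
    set e := hyperplaneOrder W H with he
    have he0 : (e : ℂ) ≠ 0 := by
      have : Finite (fixer W H) := finite_fixer H
      rw [he]
      exact_mod_cast (Nat.card_pos (α := fixer W H)).ne'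
    let s' : W := ⟨s H, hs.1⟩
    let v := μ • vec H
    have hv0 : v ∉ H := fun h' => hv ((H.smul_mem_iff hμ).1 h')
    have hs'v : (s' : V ≃ₗ[ℂ] V) v = Complex.exp (2 * Real.pi * Complex.I / e) • v := by
      change s H (μ • vec H) = _ • μ • vec H
      rw [map_smul, hsv, smul_comm]
    let f₀ : ℝ → V := fun θ => h + Complex.exp (2 * Real.pi * Complex.I * θ / e) • v
    have hf₀c : Continuous f₀ := by fun_prop
    have hf₀ : ∀ θ, f₀ θ ∈ complement W := by
      intro θ H' hH' hmem
      have hnorm : ‖Complex.exp (2 * Real.pi * Complex.I * θ / e)‖ ≤ 1 := by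
        have : 2 * Real.pi * Complex.I * θ / e =
            ((2 * Real.pi * θ / e : ℝ) : ℂ) * Complex.I := by
          push_cast
          ring
        rw [this, Complex.norm_exp_ofReal_mul_I]
      obtain rfl := hdisc _ hnorm H' hH' hmem
      exact hv0 ((H'.smul_mem_iff (Complex.exp_ne_zero _)).1 ((H'.add_mem_iff_right hh).1 hmem))
    let f : C(ℝ, complement W) := ⟨fun θ => ⟨f₀ θ, hf₀ θ⟩, hf₀c.subtype_mk _⟩
    have hfs : ∀ θ, f (θ + 1) = s' • f θ := by
      intro θ
      apply Subtype.ext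
      change f₀ (θ + 1) = (s' : V ≃ₗ[ℂ] V) (f₀ θ)
      simp only [f₀]
      rw [map_add, map_smul, hs'v]
      generalize v = v'
      rw [smul_smul, ← Complex.exp_add]
      congr 1
      · exact (hs.2 h hh).symm
      · congr 2
        push_cast
        ring
    let α : Path (f 0) (s' • f 0) :=
      { toFun := fun t => f t
        continuous_toFun := by fun_prop
        source' := rfl
        target' := by rw [← hfs]; simp }
    -- The circle consists of `e` arcs, successive translates of `α` by `s'`, on which the invariant
    -- `F` takes the same value.
    have hcα : F c = F α ^ e := by
      refine F.apply_arc f (fun z => s' • z) (fun p q h => hinv s' p q h) hfs e α c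
        (fun t => rfl) fun t => Subtype.ext ?_
      rw [hc]
      change _ = f₀ _
      simp only [f₀]
      congr 3
      push_cast
      field_simp
    let γ : Path x (f 0) := (joined_complement x (f 0)).somePath
    have hσ : IsBraidedReflection W x ⟨H, hH⟩ (braidOfPath W s'
        ((γ.trans α).trans (γ.map (continuous_smul_complement W s')).symm)) := by
      refine ⟨s', h, v, f 0, γ, α, hs, fun h0 => hv0 (h0 ▸ H.zero_mem), hs'v, hh, hdisc, ?_,
        fun t => rfl, rfl⟩
      change f₀ 0 = _
      simp [f₀]
    -- By invariance `F` takes the same value on `γ` and its translate, so the braided reflection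
    -- has as value a conjugate of `F α`.
    have h1 := congrArg MulOpposite.op (hψ _ _ hσ)
    rw [MulOpposite.op_pow, ← hF, F.trans, F.trans, F.symm,
      hinv s' γ (γ.map (continuous_smul_complement W s')) (fun _ => rfl), conj_pow,
      MulOpposite.op_one, conj_eq_one_iff] at h1
    rw [hcα]
    exact h1
  have := hcirc.eq_one_of_loop (fun H hH => (hsv H hH).2.1)
    (η.cast rfl (one_smul W x).symm)
  rw [← this]
  exact F.eq_of_forall_eq fun t => rfl

end Braids

/-! ### Parabolic subgroups in the braid group and in the reflection group -/

section Parabolic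

variable {V : Type*} [NormedAddCommGroup V] [NormedSpace ℂ V] {W : Subgroup (V ≃ₗ[ℂ] V)}
  {I : Submodule ℂ V}

/-- In the orbit space `γ` and its translate by `w` have the same image, so the returning leg of the
base point change lifts to the reversed translate, which ends at `w • x`. -/
theorem ParabolicContraction.braidHom_braidOfPath [FiniteDimensional ℂ V]
    (D : ParabolicContraction W I) (x : complement W) (γ : Path x (D.toFun (toParabolic W I x)))
    (w : fixer W I) (η : Path (toParabolic W I x) (w • toParabolic W I x)) :
    D.braidHom x γ (braidOfPath (fixer W I) w η) =
      braidOfPath W ⟨w, fixer_le W I w.2⟩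
        (γ.trans (((η.map D.continuous_toFun).cast rfl (D.toFun_smul w _).symm).trans
          (γ.map (continuous_smul_complement W ⟨w, fixer_le W I w.2⟩)).symm)) := by
  change Path.Homotopic.Quotient.mk ((γ.map (continuous_proj W)).symm.symm.trans
    ((((η.map (continuous_proj (fixer W I))).cast rfl (proj_smul _ w _).symm).map
      D.orbitMap.continuous).trans (γ.map (continuous_proj W)).symm)) =
    Path.Homotopic.Quotient.mk _
  congr 1
  have hsm : (γ.map (continuous_proj W)).symm =
      ((γ.map (continuous_smul_complement W ⟨w, fixer_le W I w.2⟩)).symm.map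
        (continuous_proj W)).cast (proj_smul W _ _).symm (proj_smul W _ _).symm := by
    ext t
    exact (proj_smul W ⟨w, fixer_le W I w.2⟩ (γ (unitInterval.symm t))).symm
  rw [Path.symm_symm, hsm, Path.map_trans, Path.map_trans]
  rfl

theorem braidToGroup_surjective (hW : IsComplexReflectionGroup W)
    (hp : IsQuotientCoveringMap (proj W) W) (x : complement W) :
    Function.Surjective (braidToGroup hp x) := by
  have := hW.finite
  intro w
  exact ⟨braidOfPath W w.unop (joined_complement x (w.unop • x)).somePath,
    braidToGroup_braidOfPath hp x _ _⟩

variable [FiniteDimensional ℂ V]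

theorem isQuotientCoveringMap_proj_of_isComplexReflectionGroup (hW : IsComplexReflectionGroup W) :
    IsQuotientCoveringMap (proj W) W :=
  have := hW.finite
  isQuotientCoveringMap_proj fun _ hw _ hx h => eq_one_of_apply_eq hW hx hw h

/-- The equivariant contraction turns a fixed point in `ℳ_I` into one in `ℳ`, so freeness follows
from Steinberg's theorem for `W` itself. It need not be known that `W_I` is generated by
pseudo-reflections. -/
theorem ParabolicContraction.isQuotientCoveringMap_proj (hW : IsComplexReflectionGroup W)
    (D : ParabolicContraction W I) : IsQuotientCoveringMap (proj (fixer W I)) (fixer W I) := by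
  have := hW.finite
  have := finite_fixer (W := W) I
  refine ReflHecke.isQuotientCoveringMap_proj fun w hw y hy h => ?_
  have h1 := D.toFun_smul ⟨w, hw⟩ ⟨y, hy⟩
  have h2 : (⟨w, hw⟩ : fixer W I) • (⟨y, hy⟩ : complement (fixer W I)) = ⟨y, hy⟩ := Subtype.ext h
  rw [h2] at h1
  exact eq_one_of_apply_eq hW (D.toFun ⟨y, hy⟩).2 hw.1 (congrArg Subtype.val h1.symm)

/-- The image in the reflection group of the braid group of a parabolic subgroup is that
subgroup. -/
theorem ParabolicContraction.range_braidToGroup (hW : IsComplexReflectionGroup W)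
    (hp : IsQuotientCoveringMap (proj W) W) (D : ParabolicContraction W I) (x : complement W)
    (γ : Path x (D.toFun (toParabolic W I x))) (w : W) :
    (∃ b, braidToGroup hp x (D.braidHom x γ b) = MulOpposite.op w) ↔
      (w : V ≃ₗ[ℂ] V) ∈ fixer W I := by
  have := hW.finite
  constructor
  · rintro ⟨b, hb⟩
    obtain ⟨w', η, rfl⟩ := exists_eq_braidOfPath (D.isQuotientCoveringMap_proj hW) _ b
    rw [D.braidHom_braidOfPath, braidToGroup_braidOfPath] at hb
    rw [← MulOpposite.op_injective hb]
    exact w'.2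
  · intro hw
    let η : Path x (w • x) := (joined_complement x (w • x)).somePath
    -- A path in `ℳ` is also a path in the larger space `ℳ_I`.
    let η' : Path (toParabolic W I x) ((⟨w, hw⟩ : fixer W I) • toParabolic W I x) :=
      η.map (f := toParabolic W I) (continuous_subtype_val.subtype_mk _)
    refine ⟨braidOfPath _ _ η', ?_⟩
    rw [D.braidHom_braidOfPath, braidToGroup_braidOfPath]

/-- A homomorphism that kills the appropriate powers of the braided reflections factors through
the reflection group. -/
theorem eq_of_braidToGroup_eq (hW : IsComplexReflectionGroup W)
    (hp : IsQuotientCoveringMap (proj W) W) {x : complement W} {Q : Type*} [Group Q]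
    (ψ : BraidGroup W x →* Q)
    (hψ : ∀ (H : reflectingHyperplanes W) (b : BraidGroup W x), IsBraidedReflection W x H b →
      ψ b ^ hyperplaneOrder W (H : Submodule ℂ V) = 1) {b b' : BraidGroup W x}
    (h : braidToGroup hp x b = braidToGroup hp x b') : ψ b = ψ b' := by
  have := hW.finite
  rw [← div_eq_one, ← map_div] at h ⊢
  obtain ⟨w, η, hη⟩ := exists_eq_braidOfPath hp x (b / b')
  rw [hη] at h ⊢
  rw [braidToGroup_braidOfPath, MulOpposite.op_eq_one_iff] at h
  subst h
  exact eq_one_of_pure ψ hψ η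

/-- The image of a braided reflection in the reflection group. -/
theorem IsBraidedReflection.braidToGroup_pow {x : complement W} {H : reflectingHyperplanes W}
    {b : BraidGroup W x} (hb : IsBraidedReflection W x H b)
    (hp : IsQuotientCoveringMap (proj W) W) :
    braidToGroup hp x b ^ hyperplaneOrder W (H : Submodule ℂ V) = 1 := by
  obtain ⟨s, h, v, y, γ, α, hs, -, -, -, -, -, -, rfl⟩ := hb
  rw [braidToGroup_braidOfPath, ← MulOpposite.op_pow, MulOpposite.op_eq_one_iff]
  exact Subtype.ext (pow_hyperplaneOrder_eq_one hs)

end Parabolic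

/-! ### Inverting roots, and exchanging left and right bases -/

section Algebra

open Polynomial

/-- If `∏ (a - u_j) = 0`, then `∏ (a⁻¹ - u_j⁻¹) = 0`. -/
theorem aeval_prod_inv_eq_zero {R A ι : Type*} [CommRing R] [Ring A] [Algebra R A] (s : Finset ι)
    (u v : ι → R) (huv : ∀ j, u j * v j = 1) {a b : A} (hab : a * b = 1) (hba : b * a = 1)
    (h : aeval a (∏ j ∈ s, (X - C (u j))) = 0) : aeval b (∏ j ∈ s, (X - C (v j))) = 0 := by
  classical
  -- Each factor obeys `(b - v) a = -v (a - u)`, because `b a = 1` and `u v = 1`.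
  have key : ∀ t : Finset ι, aeval b (∏ j ∈ t, (X - C (v j))) * a ^ t.card =
      (∏ j ∈ t, (- v j)) • aeval a (∏ j ∈ t, (X - C (u j))) := by
    intro t
    induction t using Finset.induction_on with
    | empty => simp
    | insert j t hj ih =>
      have hcomm : aeval a (∏ j ∈ t, (X - C (u j))) * a = a * aeval a (∏ j ∈ t, (X - C (u j))) := by
        have h2 := congrArg (aeval a) (mul_comm (∏ j ∈ t, (X - C (u j))) X)
        simpa only [map_mul, aeval_X] using h2
      have hlin : (b - algebraMap R A (v j)) * a = (- v j) • (a - algebraMap R A (u j)) := by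
        rw [sub_mul, hba, smul_sub, ← Algebra.smul_def, neg_smul, neg_smul,
          Algebra.smul_def (v j) (algebraMap R A (u j)),
          ← map_mul, mul_comm (v j), huv, map_one]
        abel
      rw [Finset.prod_insert hj, Finset.prod_insert hj, Finset.prod_insert hj,
        Finset.card_insert_of_notMem hj, pow_succ, map_mul, map_mul, mul_assoc, ← mul_assoc _ _ a,
        ih, smul_mul_assoc, hcomm, mul_smul_comm, ← mul_assoc]
      simp only [map_sub, aeval_X, aeval_C]
      rw [hlin, smul_mul_assoc, smul_smul, mul_comm]
  have h1 := key s
  rw [h, smul_zero] at h1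
  have h2 := congrArg (· * b ^ s.card) h1
  have hpow : a ^ s.card * b ^ s.card = 1 := by
    have hc : Commute a b := hab.trans hba.symm
    rw [← hc.mul_pow, hab, one_pow]
  simpa only [mul_assoc, hpow, mul_one, zero_mul] using h2

/-- Bijectivity of the coordinate map can be transported along bijections that are only semilinear
and reverse products. -/
theorem nonempty_basis_iff {S M : Type*} [Semiring S] [AddCommMonoid M] [Module S M] {r : ℕ} :
    Nonempty (Module.Basis (Fin r) S M) ↔
      ∃ v : Fin r → M, Function.Bijective fun c : Fin r → S => ∑ i, c i • v i := by
  constructor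
  · rintro ⟨b⟩
    refine ⟨b, ?_⟩
    have h : (fun c : Fin r → S => ∑ i, c i • b i) = b.equivFun.symm :=
      funext fun c => (b.equivFun_symm_apply c).symm
    rw [h]
    exact b.equivFun.symm.bijective
  · rintro ⟨v, hv⟩
    exact ⟨Module.Basis.ofEquivFun
      (LinearEquiv.ofBijective (Fintype.linearCombination S v) hv).symm⟩

/-- An anti-involution that preserves a subalgebra exchanges left and right bases. -/
theorem isLeftFreeOfRank_iff_isRightFreeOfRank {R A : Type*} [CommSemiring R] [Semiring A]
    [Algebra R A] (S : Subalgebra R A) (T : A →+* Aᵐᵒᵖ) (hT : ∀ a, (T (T a).unop).unop = a)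
    (hS : ∀ a ∈ S, (T a).unop ∈ S) (r : ℕ) :
    IsLeftFreeOfRank S r ↔ IsRightFreeOfRank S r := by
  let τ : A ≃ A := ⟨fun a => (T a).unop, fun a => (T a).unop, hT, hT⟩
  let ρ : S.op ≃ S :=
    { toFun := fun s => ⟨(T s.1.unop).unop, hS _ s.2⟩
      invFun := fun s => ⟨MulOpposite.op (T s.1).unop, hS _ s.2⟩
      left_inv := fun s => Subtype.ext (congrArg MulOpposite.op (hT s.1.unop))
      right_inv := fun s => Subtype.ext (hT s.1) }
  have key : ∀ v : Fin r → A, (fun c : Fin r → S.op => ∑ i, c i • τ (v i)) =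
      τ ∘ (fun c : Fin r → S => ∑ i, c i • v i) ∘ fun c i => ρ (c i) := by
    intro v
    funext c
    change _ = (T (∑ i, (T (c i).1.unop).unop * v i)).unop
    rw [map_sum, Finset.unop_sum]
    refine Finset.sum_congr rfl fun i _ => ?_
    rw [map_mul, MulOpposite.unop_mul, hT]
    rfl
  have hbij : ∀ v : Fin r → A, (Function.Bijective fun c : Fin r → S.op => ∑ i, c i • τ (v i)) ↔
      Function.Bijective fun c : Fin r → S => ∑ i, c i • v i := by
    intro v
    have hρ : Function.Bijective fun (c : Fin r → S.op) i => ρ (c i) :=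
      (Equiv.arrowCongr (Equiv.refl _) ρ).bijective
    rw [key, τ.bijective.of_comp_iff', hρ.of_comp_iff]
  unfold IsLeftFreeOfRank IsRightFreeOfRank
  rw [nonempty_basis_iff, nonempty_basis_iff]
  constructor
  · rintro ⟨v, hv⟩
    exact ⟨fun i => τ (v i), (hbij v).2 hv⟩
  · rintro ⟨v, hv⟩
    refine ⟨fun i => τ.symm (v i), (hbij _).1 ?_⟩
    simpa only [Equiv.apply_symm_apply] using hv

end Algebra

/-! ### The bar involution of the parameters -/

section AntiInvolution

open Polynomial

variable {V : Type*} [AddCommGroup V] [Module ℂ V]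

/-- The involution of the parameter ring that inverts the indeterminates. -/
def paramBar (W : Subgroup (V ≃ₗ[ℂ] V)) : ParamRing W →+* ParamRing W :=
  AddMonoidAlgebra.mapDomainRingHom ℤ (negAddMonoidHom : _ →+ _)

theorem paramBar_single (W : Subgroup (V ≃ₗ[ℂ] V)) (a) (n : ℤ) :
    paramBar W (AddMonoidAlgebra.single a n) = AddMonoidAlgebra.single (-a) n :=
  AddMonoidAlgebra.mapDomain_single

theorem paramBar_paramBar (W : Subgroup (V ≃ₗ[ℂ] V)) (c : ParamRing W) :
    paramBar W (paramBar W c) = c := by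
  induction c using AddMonoidAlgebra.induction_linear with
  | zero => simp
  | add a b ha hb => rw [map_add, map_add, ha, hb]
  | single a n => rw [paramBar_single, paramBar_single, neg_neg]

theorem param_mul_paramBar (W : Subgroup (V ≃ₗ[ℂ] V)) (C : HyperplaneOrbit W)
    (j : Fin (orbitOrder W C)) : param W C j * paramBar W (param W C j) = 1 := by
  rw [param, paramBar_single, AddMonoidAlgebra.single_mul_single, add_neg_cancel, mul_one]
  rfl

end AntiInvolution

/-! ### The anti-involution of the Hecke algebra -/

section Hecke

open Polynomial

variable {V : Type*} [NormedAddCommGroup V] [NormedSpace ℂ V] [FiniteDimensional ℂ V]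
  (W : Subgroup (V ≃ₗ[ℂ] V)) (x : complement W)

theorem heckeMk_surjective : Function.Surjective (heckeMk W x) :=
  RingQuot.mkAlgHom_surjective _ _

/-- A ring homomorphism on the group algebra that respects the Hecke relations descends to the
Hecke algebra. -/
theorem exists_heckeLift {T : Type*} [Semiring T]
    (f : MonoidAlgebra (ParamRing W) (BraidGroup W x) →+* T)
    (hf : ∀ (H : reflectingHyperplanes W) (b : BraidGroup W x), IsBraidedReflection W x H b →
      f (aeval (MonoidAlgebra.of (ParamRing W) (BraidGroup W x) b)
        (∏ j : Fin (orbitOrder W (hyperplaneOrbit W H)),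
          (X - C (param W (hyperplaneOrbit W H) j)))) = 0) :
    ∃ g : HeckeAlgebra W x →+* T, ∀ a, g (heckeMk W x a) = f a := by
  refine ⟨RingQuot.lift ⟨f, ?_⟩, fun a => ?_⟩
  · rintro _ _ ⟨H, b, hb⟩
    rw [hf H b hb, map_zero]
  · have h : heckeMk W x a = RingQuot.mkRingHom (HeckeRel W x) a := by
      rw [← RingQuot.mkAlgHom_coe (ParamRing W)]
      rfl
    rw [h, RingQuot.lift_mkRingHom_apply]

theorem heckeMk_relation (H : reflectingHyperplanes W) (b : BraidGroup W x)
    (hb : IsBraidedReflection W x H b) :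
    aeval (heckeMk W x (MonoidAlgebra.of (ParamRing W) (BraidGroup W x) b))
        (∏ j : Fin (orbitOrder W (hyperplaneOrbit W H)),
          (X - C (param W (hyperplaneOrbit W H) j))) = 0 := by
  rw [aeval_algHom_apply]
  exact (RingQuot.mkAlgHom_rel _ (HeckeRel.braided H b hb)).trans (map_zero _)

theorem heckeMk_single (b : BraidGroup W x) (c : ParamRing W) :
    heckeMk W x (MonoidAlgebra.single b c) =
      c • heckeMk W x (MonoidAlgebra.of (ParamRing W) (BraidGroup W x) b) := by
  rw [← map_smul, MonoidAlgebra.of_apply, MonoidAlgebra.smul_single, smul_eq_mul, mul_one]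

/-- The anti-involution of the Hecke algebra that inverts the braids and the parameters. -/
theorem exists_antiInvolution :
    ∃ T : HeckeAlgebra W x →+* (HeckeAlgebra W x)ᵐᵒᵖ, ∀ b c,
      (T (heckeMk W x (MonoidAlgebra.single b c))).unop =
        heckeMk W x (MonoidAlgebra.single b⁻¹ (paramBar W c)) := by
  let g : BraidGroup W x →* (HeckeAlgebra W x)ᵐᵒᵖ :=
    { toFun := fun b => MulOpposite.op (heckeMk W x (MonoidAlgebra.of (ParamRing W) (BraidGroup W x) b⁻¹))
      map_one' := by rw [inv_one, map_one, map_one, MulOpposite.op_one]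
      map_mul' := fun a b => by
        rw [mul_inv_rev, map_mul, map_mul, MulOpposite.op_mul] }
  let f : ParamRing W →+* (HeckeAlgebra W x)ᵐᵒᵖ :=
    (algebraMap (ParamRing W) (HeckeAlgebra W x)ᵐᵒᵖ).comp (paramBar W)
  let p : MonoidAlgebra (ParamRing W) (BraidGroup W x) →+* (HeckeAlgebra W x)ᵐᵒᵖ :=
    MonoidAlgebra.liftNCRingHom f g fun c b => Algebra.commutes (paramBar W c) (g b)
  have hp : ∀ b c, (p (MonoidAlgebra.single b c)).unop =
      heckeMk W x (MonoidAlgebra.single b⁻¹ (paramBar W c)) := by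
    intro b c
    have h1 : p (MonoidAlgebra.single b c) = f c * g b := MonoidAlgebra.liftNC_single _ _ _ _
    have h2 : f c * g b = paramBar W c • g b := (Algebra.smul_def (paramBar W c) (g b)).symm
    rw [h1, h2, heckeMk_single]
    rfl
  -- Powers of a single braid commute, so on polynomials in it the reversal of products is
  -- invisible; what remains is to invert the braid and bar the coefficients.
  have hpoly : ∀ b (P : (ParamRing W)[X]), (p (aeval (MonoidAlgebra.of (ParamRing W) (BraidGroup W x) b) P)).unop =
      aeval (heckeMk W x (MonoidAlgebra.of (ParamRing W) (BraidGroup W x) b⁻¹)) (P.map (paramBar W)) := by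
    intro b P
    induction P using Polynomial.induction_on' with
    | add P Q hP hQ =>
      rw [map_add, map_add, MulOpposite.unop_add, hP, hQ, Polynomial.map_add, map_add]
    | monomial n c =>
      rw [aeval_monomial, Polynomial.map_monomial, aeval_monomial, ← Algebra.smul_def,
        ← Algebra.smul_def, ← map_pow, ← map_pow, ← map_pow, MonoidAlgebra.of_apply,
        MonoidAlgebra.smul_single, smul_eq_mul, mul_one, hp, heckeMk_single, inv_pow]
  obtain ⟨T, hT⟩ := exists_heckeLift W x p (by
    intro H b hb
    apply MulOpposite.unop_injective
    rw [hpoly, Polynomial.map_prod, MulOpposite.unop_zero]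
    simp only [Polynomial.map_sub, map_X, map_C]
    refine aeval_prod_inv_eq_zero _ _ _ (fun j => param_mul_paramBar W _ j)
      (a := heckeMk W x (MonoidAlgebra.of (ParamRing W) (BraidGroup W x) b)) ?_ ?_ (heckeMk_relation W x H b hb)
    · rw [← map_mul, ← map_mul, mul_inv_cancel, map_one, map_one]
    · rw [← map_mul, ← map_mul, inv_mul_cancel, map_one, map_one])
  exact ⟨T, fun b c => by rw [hT, hp]⟩

variable {W x} {I : Submodule ℂ V}

/-- Additive induction on elements of the Hecke algebra. -/
theorem hecke_induction {P : HeckeAlgebra W x → Prop} (a : HeckeAlgebra W x) (zero : P 0)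
    (add : ∀ a b, P a → P b → P (a + b))
    (single : ∀ b c, P (heckeMk W x (MonoidAlgebra.single b c))) : P a := by
  obtain ⟨a, rfl⟩ := heckeMk_surjective W x a
  induction a using MonoidAlgebra.induction_linear with
  | zero => rwa [map_zero]
  | add a b ha hb => rw [map_add]; exact add _ _ ha hb
  | single b c => exact single b c

/-- Additive induction on elements of the parabolic Hecke subalgebra. -/
theorem parabolicHecke_induction {D : ParabolicContraction W I}
    {γ : Path x (D.toFun (toParabolic W I x))} {P : HeckeAlgebra W x → Prop} {a : HeckeAlgebra W x}
    (ha : a ∈ parabolicHecke W I x D γ) (zero : P 0) (add : ∀ a b, P a → P b → P (a + b))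
    (single : ∀ b c, P (heckeMk W x (MonoidAlgebra.single (D.braidHom x γ b) c))) : P a := by
  obtain ⟨a, rfl⟩ := ha
  induction a using MonoidAlgebra.induction_linear with
  | zero => rwa [map_zero]
  | add a b ha hb => rw [map_add]; exact add _ _ ha hb
  | single b c =>
    have h := single b c
    rwa [← MonoidAlgebra.mapDomain_single (f := D.braidHom x γ)] at h

theorem single_mem_parabolicHecke (D : ParabolicContraction W I)
    (γ : Path x (D.toFun (toParabolic W I x))) (b) (c : ParamRing W) :
    heckeMk W x (MonoidAlgebra.single (D.braidHom x γ b) c) ∈ parabolicHecke W I x D γ := by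
  refine ⟨MonoidAlgebra.single b c, ?_⟩
  rw [← MonoidAlgebra.mapDomain_single (f := D.braidHom x γ)]
  rfl

/-- The anti-involution preserves the subalgebra because the image of `B_I(W)` is closed under
inverses and all parameters are allowed as coefficients. -/
theorem isLeftFreeOfRank_parabolicHecke_iff (D : ParabolicContraction W I)
    (γ : Path x (D.toFun (toParabolic W I x))) (r : ℕ) :
    IsLeftFreeOfRank (parabolicHecke W I x D γ) r ↔
      IsRightFreeOfRank (parabolicHecke W I x D γ) r := by
  obtain ⟨T, hT⟩ := exists_antiInvolution W x
  refine isLeftFreeOfRank_iff_isRightFreeOfRank _ T (fun a => ?_) (fun a ha => ?_) r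
  · induction a using hecke_induction with
    | zero => simp
    | add a b ha hb => rw [map_add, MulOpposite.unop_add, map_add, MulOpposite.unop_add, ha, hb]
    | single b c => rw [hT, hT, inv_inv, paramBar_paramBar]
  · refine parabolicHecke_induction
      (P := fun a => (T a).unop ∈ parabolicHecke W I x D γ) ha ?_ (fun a b ha hb => ?_) fun b c => ?_
    · simp only [map_zero]
      exact Subalgebra.zero_mem _
    · simp only [map_add]
      exact Subalgebra.add_mem _ ha hb
    · rw [hT, ← map_inv]
      exact single_mem_parabolicHecke D γ _ _

end Hecke

/-! ### Specialization of the parameters at roots of unity -/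

section Specialization

open Polynomial

theorem prod_X_sub_C_pow {e : ℕ} {ζ : ℂ} (hζ : IsPrimitiveRoot ζ e) (he : 0 < e) :
    ∏ j : Fin e, (X - C (ζ ^ (j : ℕ))) = X ^ e - 1 := by
  rw [X_pow_sub_one_eq_prod he hζ]
  refine Finset.prod_bij (fun j _ => ζ ^ (j : ℕ)) (fun j _ => ?_) (fun i _ j _ h => ?_)
    (fun z hz => ?_) fun _ _ => rfl
  · rw [mem_nthRootsFinset he, ← pow_mul, mul_comm, pow_mul, hζ.pow_eq_one, one_pow]
  · exact Fin.ext (hζ.pow_inj i.2 j.2 h)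
  · rw [mem_nthRootsFinset he] at hz
    have : NeZero e := ⟨he.ne'⟩
    obtain ⟨i, hi, h⟩ := hζ.eq_pow_of_pow_eq_one hz
    exact ⟨⟨i, hi⟩, Finset.mem_univ _, h⟩

variable {V : Type*} [AddCommGroup V] [Module ℂ V]

/-- There is a specialization of the parameters at which the Hecke relations become
`σ ^ e = 1`. -/
theorem exists_specialization (W : Subgroup (V ≃ₗ[ℂ] V)) [Finite W] :
    ∃ φ : ParamRing W →+* ℂ, ∀ H : reflectingHyperplanes W,
      (∏ j : Fin (orbitOrder W (hyperplaneOrbit W H)),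
        (X - C (param W (hyperplaneOrbit W H) j))).map φ =
      X ^ hyperplaneOrder W (H : Submodule ℂ V) - 1 := by
  -- The parameter of index `j` goes to `exp(2πi/e) ^ j`; as `j` runs from `0` to `e - 1`, every
  -- `e`-th root of unity occurs once.
  let θ : (Σ C : HyperplaneOrbit W, Fin (orbitOrder W C)) → Additive ℂˣ := fun i =>
    Additive.ofMul (Units.mk0 (Complex.exp (2 * Real.pi * Complex.I / orbitOrder W i.1) ^ (i.2 : ℕ))
      (pow_ne_zero _ (Complex.exp_ne_zero _)))
  let Θ : ((Σ C : HyperplaneOrbit W, Fin (orbitOrder W C)) →₀ ℤ) →+ Additive ℂˣ :=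
    Finsupp.liftAddHom fun i => zmultiplesHom _ (θ i)
  let φ : ParamRing W →+* ℂ := (AddMonoidAlgebra.lift ℤ ℂ _
    ((Units.coeHom ℂ).comp (AddMonoidHom.toMultiplicativeLeft Θ))).toRingHom
  refine ⟨φ, fun H => ?_⟩
  have hφ : ∀ C j, φ (param W C j) =
      Complex.exp (2 * Real.pi * Complex.I / orbitOrder W C) ^ (j : ℕ) := by
    intro C j
    have h1 : φ (param W C j) = (1 : ℤ) • ((Θ (Finsupp.single ⟨C, j⟩ 1)).toMul : ℂ) :=
      AddMonoidAlgebra.lift_single _ _ _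
    have h2 : Θ (Finsupp.single ⟨C, j⟩ 1) = θ ⟨C, j⟩ := by
      simp [Θ]
    rw [h1, h2, one_smul]
    rfl
  rw [Polynomial.map_prod]
  simp only [Polynomial.map_sub, map_X, map_C, hφ]
  have he : 0 < orbitOrder W (hyperplaneOrbit W H) := by
    have := finite_fixer (W := W) (H : Submodule ℂ V)
    exact Nat.card_pos (α := fixer W (H : Submodule ℂ V))
  exact prod_X_sub_C_pow (Complex.isPrimitiveRoot_exp _ he.ne') he

/-- The elements of the opposite group that lie in the pointwise stabiliser of a subspace. -/
def fixerOp (W : Subgroup (V ≃ₗ[ℂ] V)) (I : Submodule ℂ V) : Subgroup Wᵐᵒᵖ :=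
  ((fixer W I).subgroupOf W).op

theorem card_quotient_fixerOp (W : Subgroup (V ≃ₗ[ℂ] V)) [Finite W] (I : Submodule ℂ V) :
    (Nat.card (Quotient (QuotientGroup.rightRel (fixerOp W I))) : ℚ) =
      (Nat.card W : ℚ) / (Nat.card (fixer W I) : ℚ) := by
  have : Finite (fixer W I) := finite_fixer I
  have h1 := Subgroup.card_eq_card_quotient_mul_card_subgroup (fixerOp W I)
  have h2 : Nat.card (fixerOp W I) = Nat.card (fixer W I) :=
    (Nat.card_congr (Subgroup.equivOp _).symm).trans
      (Nat.card_congr (Subgroup.subgroupOfEquivOfLe (fixer_le W I)).toEquiv)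
  have h3 : Nat.card Wᵐᵒᵖ = Nat.card W := Nat.card_congr MulOpposite.opEquiv.symm
  have h4 := Nat.card_congr (QuotientGroup.quotientRightRelEquivQuotientLeftRel (fixerOp W I))
  rw [h2, h3] at h1
  have h5 : (Nat.card (fixer W I) : ℚ) ≠ 0 := by exact_mod_cast Nat.card_pos.ne'
  rw [eq_div_iff h5, h4, h1]
  push_cast
  rfl

end Specialization

/-! ### The rank, by counting semilinear functionals -/

section Rank

open Polynomial

variable {V : Type*} [NormedAddCommGroup V] [NormedSpace ℂ V] [FiniteDimensional ℂ V]
  {W : Subgroup (V ≃ₗ[ℂ] V)} {x : complement W}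

/-- The specialization of the Hecke algebra to the group algebra of the reflection group. -/
theorem exists_toGroupAlgebra (hp : IsQuotientCoveringMap (proj W) W) (φ : ParamRing W →+* ℂ)
    (hφ : ∀ H : reflectingHyperplanes W,
      (∏ j : Fin (orbitOrder W (hyperplaneOrbit W H)),
        (X - C (param W (hyperplaneOrbit W H) j))).map φ =
      X ^ hyperplaneOrder W (H : Submodule ℂ V) - 1) :
    ∃ Ψ : HeckeAlgebra W x →+* MonoidAlgebra ℂ Wᵐᵒᵖ, ∀ b c,
      Ψ (heckeMk W x (MonoidAlgebra.single b c)) =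
        MonoidAlgebra.single (braidToGroup hp x b) (φ c) := by
  let p : MonoidAlgebra (ParamRing W) (BraidGroup W x) →+* MonoidAlgebra ℂ Wᵐᵒᵖ :=
    MonoidAlgebra.liftNCRingHom ((algebraMap ℂ (MonoidAlgebra ℂ Wᵐᵒᵖ)).comp φ)
      ((MonoidAlgebra.of ℂ Wᵐᵒᵖ).comp (braidToGroup hp x)) fun c b => Algebra.commutes (φ c) _
  have hsingle : ∀ b c, p (MonoidAlgebra.single b c) =
      MonoidAlgebra.single (braidToGroup hp x b) (φ c) := by
    intro b c
    refine (MonoidAlgebra.liftNC_single _ _ _ _).trans ?_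
    refine (Algebra.smul_def (φ c) (MonoidAlgebra.of ℂ Wᵐᵒᵖ (braidToGroup hp x b))).symm.trans ?_
    rw [MonoidAlgebra.of_apply, MonoidAlgebra.smul_single, smul_eq_mul, mul_one]
  have hpoly : ∀ b (P : (ParamRing W)[X]),
      p (aeval (MonoidAlgebra.of (ParamRing W) (BraidGroup W x) b) P) =
      aeval (MonoidAlgebra.of ℂ Wᵐᵒᵖ (braidToGroup hp x b)) (P.map φ) := by
    intro b P
    induction P using Polynomial.induction_on' with
    | add P Q hP hQ => rw [map_add, map_add, hP, hQ, Polynomial.map_add, map_add]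
    | monomial n c =>
      rw [aeval_monomial, Polynomial.map_monomial, aeval_monomial, ← Algebra.smul_def,
        ← Algebra.smul_def, ← map_pow, ← map_pow, MonoidAlgebra.of_apply, MonoidAlgebra.of_apply,
        MonoidAlgebra.smul_single, MonoidAlgebra.smul_single, smul_eq_mul, smul_eq_mul, mul_one,
        mul_one, hsingle, map_pow]
  obtain ⟨Ψ, hΨ⟩ := exists_heckeLift W x p fun H b hb => by
    rw [hpoly, hφ, map_sub, map_pow, aeval_X, ← map_pow, hb.braidToGroup_pow hp, map_one, map_one,
      sub_self]
  exact ⟨Ψ, fun b c => by rw [hΨ, hsingle]⟩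

/-- An additive function on the Hecke algebra that is semilinear over the specialization of the
parameters only depends on the image of a braid in the reflection group. -/
theorem apply_eq_of_braidToGroup_eq (hW : IsComplexReflectionGroup W)
    (hp : IsQuotientCoveringMap (proj W) W) (φ : ParamRing W →+* ℂ)
    (hφ : ∀ H : reflectingHyperplanes W,
      (∏ j : Fin (orbitOrder W (hyperplaneOrbit W H)),
        (X - C (param W (hyperplaneOrbit W H) j))).map φ =
      X ^ hyperplaneOrder W (H : Submodule ℂ V) - 1)
    (f : HeckeAlgebra W x →+ ℂ) (hf : ∀ c a, f (c • a) = φ c * f a) {b b' : BraidGroup W x}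
    (h : braidToGroup hp x b = braidToGroup hp x b') :
    f (heckeMk W x (MonoidAlgebra.of _ _ b)) = f (heckeMk W x (MonoidAlgebra.of _ _ b')) := by
  let m : BraidGroup W x →* HeckeAlgebra W x :=
    (heckeMk W x : _ →* _).comp (MonoidAlgebra.of (ParamRing W) (BraidGroup W x))
  -- The braids that can be deleted anywhere inside the argument of `f` form a normal subgroup. Once
  -- it contains the `e`-th powers of the braided reflections, the quotient by it factors through
  -- the reflection group.
  let K : Subgroup (BraidGroup W x) :=
    { carrier := {n | ∀ a a', f (a * m n * a') = f (a * a')}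
      one_mem' := fun a a' => by rw [map_one, mul_one]
      mul_mem' := fun {n n'} hn hn' a a' => by
        rw [map_mul m, ← mul_assoc, hn', hn]
      inv_mem' := fun {n} hn a a' => by
        rw [← hn (a * m n⁻¹) a', mul_assoc a, ← map_mul, inv_mul_cancel, map_one, mul_one] }
  have : K.Normal := ⟨fun n hn g a a' => by
    have h1 := hn (a * m g) (m g⁻¹ * a')
    rw [map_mul m, map_mul m]
    have h2 : a * m g * (m g⁻¹ * a') = a * a' := by
      rw [mul_assoc, ← mul_assoc (m g), ← map_mul, mul_inv_cancel, map_one, one_mul]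
    rw [h2] at h1
    rw [← h1]
    simp only [mul_assoc]⟩
  have hpow : ∀ (H : reflectingHyperplanes W) (b : BraidGroup W x), IsBraidedReflection W x H b →
      QuotientGroup.mk' K b ^ hyperplaneOrder W (H : Submodule ℂ V) = 1 := by
    intro H b hb
    rw [← map_pow]
    refine (QuotientGroup.eq_one_iff _).2 fun a a' => ?_
    -- Through `ℓ` the Hecke relation between two arbitrary factors is evaluated with specialized
    -- coefficients, where it reads `X ^ e - 1`.
    let ℓ : ℂ[X] →ₗ[ℂ] ℂ := Polynomial.lsum fun k => LinearMap.toSpanSingleton ℂ ℂ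
      (f (a * m b ^ k * a'))
    have hℓ : ∀ k c, ℓ (monomial k c) = c * f (a * m b ^ k * a') := fun k c => by
      simp [ℓ, Polynomial.lsum_apply]
    have key : ∀ P : (ParamRing W)[X], f (a * aeval (m b) P * a') = ℓ (P.map φ) := by
      intro P
      induction P using Polynomial.induction_on' with
      | add P Q hP hQ =>
        rw [map_add, mul_add, add_mul, map_add, hP, hQ, Polynomial.map_add, map_add]
      | monomial n c =>
        rw [aeval_monomial, Polynomial.map_monomial, hℓ, ← Algebra.smul_def, mul_smul_comm,
          smul_mul_assoc, hf]
    have h1 := key (∏ j : Fin (orbitOrder W (hyperplaneOrbit W H)),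
        (X - C (param W (hyperplaneOrbit W H) j)))
    have h0 : aeval (m b) (∏ j : Fin (orbitOrder W (hyperplaneOrbit W H)),
        (X - C (param W (hyperplaneOrbit W H) j))) = 0 := heckeMk_relation W x H b hb
    rw [h0, hφ, mul_zero, zero_mul, map_zero, map_sub, ← monomial_one_right_eq_X_pow, hℓ,
      ← monomial_zero_one, hℓ, one_mul, one_mul, pow_zero, mul_one] at h1
    rw [map_pow]
    exact sub_eq_zero.1 h1.symm
  have h1 : QuotientGroup.mk' K b = QuotientGroup.mk' K b' :=
    eq_of_braidToGroup_eq hW hp (QuotientGroup.mk' K) hpow h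
  have h2 : b⁻¹ * b' ∈ K := QuotientGroup.eq.1 h1
  have h3 := h2 (m b) 1
  rw [← map_mul, mul_inv_cancel_left, mul_one, mul_one] at h3
  exact h3.symm

variable {I : Submodule ℂ V}

/-- The rank of the Hecke algebra over a parabolic subalgebra. -/
theorem rank_eq_of_isLeftFreeOfRank (hW : IsComplexReflectionGroup W)
    (D : ParabolicContraction W I) (γ : Path x (D.toFun (toParabolic W I x))) {r : ℕ}
    (hr : IsLeftFreeOfRank (parabolicHecke W I x D γ) r) :
    (r : ℚ) = (Nat.card W : ℚ) / (Nat.card (fixer W I) : ℚ) := by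
  have := hW.finite
  obtain ⟨bas⟩ := hr
  have hp := isQuotientCoveringMap_proj_of_isComplexReflectionGroup hW
  obtain ⟨φ, hφ⟩ := exists_specialization W
  obtain ⟨Ψ, hΨ⟩ := exists_toGroupAlgebra (x := x) hp φ hφ
  let S := parabolicHecke W I x D γ
  let ε : HeckeAlgebra W x →+* ℂ := (MonoidAlgebra.lift ℂ ℂ Wᵐᵒᵖ 1).toRingHom.comp Ψ
  have hε : ∀ b c, ε (heckeMk W x (MonoidAlgebra.single b c)) = φ c := fun b c => by
    change MonoidAlgebra.lift ℂ ℂ Wᵐᵒᵖ 1 (Ψ _) = _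
    rw [hΨ, MonoidAlgebra.lift_single, MonoidHom.one_apply, smul_eq_mul, mul_one]
  -- The scalars `ℂ` become the trivial module of the specialized parabolic subalgebra.
  let _ : Module S ℂ := Module.compHom ℂ (ε.comp S.toSubsemiring.subtype)
  have hsmul : ∀ (s : S) (z : ℂ), s • z = ε s * z := fun _ _ => rfl
  have : SMulCommClass S ℂ ℂ := ⟨fun s c z => by
    rw [hsmul, hsmul, smul_eq_mul, smul_eq_mul, mul_left_comm]⟩
  let G := fixerOp W I
  let q : BraidGroup W x → Quotient (QuotientGroup.rightRel G) := fun b =>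
    Quotient.mk _ (braidToGroup hp x b)
  have hq : Function.Surjective q :=
    Quotient.mk_surjective.comp (braidToGroup_surjective hW hp x)
  let Λ : (HeckeAlgebra W x →ₗ[S] ℂ) →ₗ[ℂ] (BraidGroup W x → ℂ) :=
    { toFun := fun f b => f (heckeMk W x (MonoidAlgebra.of _ _ b))
      map_add' := fun _ _ => rfl
      map_smul' := fun _ _ => rfl }
  let Φ : (Quotient (QuotientGroup.rightRel G) → ℂ) →ₗ[ℂ] (BraidGroup W x → ℂ) :=
    LinearMap.funLeft ℂ ℂ q
  have hΦ : Function.Injective Φ := LinearMap.funLeft_injective_of_surjective ℂ ℂ q hq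
  have hlin : ∀ (f : HeckeAlgebra W x →ₗ[S] ℂ) c a, f (c • a) = φ c * f a := by
    intro f c a
    have h1 : c • a = (algebraMap (ParamRing W) S c) • a := (algebraMap_smul S c a).symm
    have h2 : ((algebraMap (ParamRing W) S c : S) : HeckeAlgebra W x) =
        heckeMk W x (MonoidAlgebra.single 1 c) := by
      rw [heckeMk_single, map_one, map_one, ← Algebra.algebraMap_eq_smul_one]
      rfl
    rw [h1, map_smul, hsmul, h2, hε]
  have hΛ : Function.Injective Λ := by
    intro f g h
    ext a
    induction a using hecke_induction with
    | zero => rw [map_zero, map_zero]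
    | add a b ha hb => rw [map_add, map_add, ha, hb]
    | single b c =>
      rw [heckeMk_single, hlin, hlin]
      exact congrArg (φ c * ·) (congrFun h b)
  -- Restricted to braids, the `S`-linear functionals are exactly the functions on the cosets of
  -- `W_I`.
  have hrange : LinearMap.range Λ = LinearMap.range Φ := by
    apply le_antisymm
    · rintro _ ⟨f, rfl⟩
      have hf : ∀ b b', q b = q b' → Λ f b = Λ f b' := by
        intro b b' hbb
        have h1 := QuotientGroup.rightRel_apply.1 (Quotient.exact hbb)
        -- Braids in one coset differ, up to the kernel of the map to the reflection group, by a
        -- left factor from `B_I(W)`, on which `ε` is one.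
        obtain ⟨β, hβ⟩ := (D.range_braidToGroup hW hp x γ
          (braidToGroup hp x b' * (braidToGroup hp x b)⁻¹).unop).2 h1
        have h2 : braidToGroup hp x (D.braidHom x γ β * b) = braidToGroup hp x b' := by
          rw [map_mul, hβ, MulOpposite.op_unop, inv_mul_cancel_right]
        have h3 := apply_eq_of_braidToGroup_eq hW hp φ hφ f.toAddMonoidHom (hlin f) h2
        have h4 : f (heckeMk W x (MonoidAlgebra.of _ _ (D.braidHom x γ β * b))) =
            f (heckeMk W x (MonoidAlgebra.of _ _ b)) := by
          have h5 := f.map_smul ⟨_, single_mem_parabolicHecke D γ β 1⟩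
            (heckeMk W x (MonoidAlgebra.of _ _ b))
          rw [hsmul, hε, map_one, one_mul] at h5
          rw [← h5, map_mul, map_mul]
          rfl
        exact h4.symm.trans h3
      refine ⟨fun t => Λ f (Function.surjInv hq t), funext fun b => ?_⟩
      exact hf _ _ (Function.surjInv_eq hq (q b))
    · rintro _ ⟨k, rfl⟩
      -- Conversely, a function on cosets extends linearly to the group algebra and is pulled back
      -- along `Ψ`; constancy on cosets becomes `S`-linearity.
      let κ : MonoidAlgebra ℂ Wᵐᵒᵖ →+ ℂ :=
        MonoidAlgebra.liftNC (AddMonoidHom.id ℂ) fun g => k (Quotient.mk _ g)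
      have hκ : ∀ g c, κ (MonoidAlgebra.single g c) = c * k (Quotient.mk _ g) := fun g c =>
        MonoidAlgebra.liftNC_single _ _ _ _
      have hmul : ∀ s ∈ S, ∀ a, κ (Ψ (s * a)) = ε s * κ (Ψ a) := by
        intro s hs a
        refine parabolicHecke_induction (P := fun s => κ (Ψ (s * a)) = ε s * κ (Ψ a)) hs ?_
          (fun s s' h h' => ?_) fun β d => ?_
        · rw [zero_mul, map_zero, map_zero, map_zero, zero_mul]
        · rw [add_mul, map_add, map_add, h, h', map_add, add_mul]
        · rw [hε]
          induction a using hecke_induction with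
          | zero => rw [mul_zero, map_zero, map_zero, mul_zero]
          | add a b ha hb => rw [mul_add, map_add, map_add, ha, hb, map_add, map_add, mul_add]
          | single b c =>
            rw [map_mul, hΨ, hΨ, MonoidAlgebra.single_mul_single, hκ, hκ, mul_assoc]
            congr 3
            refine Quotient.sound (QuotientGroup.rightRel_apply.2 ?_)
            have h1 := (D.range_braidToGroup hW hp x γ
              (braidToGroup hp x (D.braidHom x γ β)).unop).1 ⟨β, rfl⟩
            rw [mul_inv_rev, mul_inv_cancel_left]
            exact G.inv_mem h1
      refine ⟨{ toFun := fun a => κ (Ψ a), map_add' := fun a b => ?_, map_smul' := fun s a => ?_ },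
        funext fun b => ?_⟩
      · rw [map_add, map_add]
      · exact hmul s s.2 a
      · change κ (Ψ (heckeMk W x (MonoidAlgebra.single b 1))) = k (q b)
        rw [hΨ, hκ, map_one, one_mul]
  have : Finite Wᵐᵒᵖ := Finite.of_equiv W MulOpposite.opEquiv
  have : Finite (Quotient (QuotientGroup.rightRel G)) := Quotient.finite _
  let _ := Fintype.ofFinite (Quotient (QuotientGroup.rightRel G))
  -- An `S`-linear map is freely determined by its values on the `r` basis elements.
  have h1 : Module.finrank ℂ (HeckeAlgebra W x →ₗ[S] ℂ) = r := by
    rw [← (bas.constr (M' := ℂ) ℂ).finrank_eq, Module.finrank_fin_fun]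
  have h2 := LinearMap.finrank_range_of_inj hΛ
  rw [hrange, LinearMap.finrank_range_of_inj hΦ, Module.finrank_fintype_fun_eq_card, h1,
    ← Nat.card_eq_fintype_card] at h2
  rw [← h2]
  exact card_quotient_fixerOp W I

end Rank

end ReflHecke

end

theorem proposition4p5 {V : Type*} [NormedAddCommGroup V] [NormedSpace ℂ V]
    [FiniteDimensional ℂ V] (W : Subgroup (V ≃ₗ[ℂ] V))
    (hW : ReflHecke.IsComplexReflectionGroup W)
    (I : Submodule ℂ V) (hI : ∃ S ⊆ ReflHecke.reflectingHyperplanes W, I = sInf S)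
    (x : ReflHecke.complement W) (D : ReflHecke.ParabolicContraction W I)
    (γ : Path x (D.toFun (ReflHecke.toParabolic W I x))) (r : ℕ) :
    (ReflHecke.IsLeftFreeOfRank (ReflHecke.parabolicHecke W I x D γ) r ↔
      ReflHecke.IsRightFreeOfRank (ReflHecke.parabolicHecke W I x D γ) r) ∧
    (ReflHecke.IsLeftFreeOfRank (ReflHecke.parabolicHecke W I x D γ) r →
      (r : ℚ) = (Nat.card W : ℚ) / (Nat.card (ReflHecke.fixer W I) : ℚ)) := by
  exact ⟨ReflHecke.isLeftFreeOfRank_parabolicHecke_iff D γ r, fun hr =>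
    ReflHecke.rank_eq_of_isLeftFreeOfRank hW D γ hr⟩
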